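/- Let $n \ge 4$ and let $(M,g)$ be a closed (compact, without boundary) connected smooth $n$-dimensional Riemannian manifold. Let $\mathrm{Rm}$ be its $(0,4)$-curvature tensor, with the sign for which $\mathrm{Rm}(X,Y,X,Y)$ is the sectional curvature of orthonormal $X,Y$, and let the Weyl tensor $W$ be defined by $$\mathrm{Rm} = \frac{\mathrm{scal}}{2(n-1)n}\, g \owedge g + \frac{1}{n-2}\, g \owedge \Big(\mathrm{Ric} - \frac{\mathrm{scal}}{n} g\Big) + W,$$ where $(S\owedge T)(X,Y,Z,V) = S(X,Z)T(Y,V) - S(X,V)T(Y,Z) + S(Y,V)T(X,Z) - S(Y,Z)T(X,V)$. At each point let $\lambda_1 \le \dots \le \lambda_{\binom n2}$ be the eigenvalues, counted with multiplicity, of the curvature operator $\mathfrak{R} \colon \Lambda^2 TM \to \Lambda^2 TM$, $g(\mathfrak{R}(X\wedge Y), Z\wedge V) = \mathrm{Rm}(X,Y,Z,V)$, where $\Lambda^2 TM$ carries the inner product for which $\{e_i\wedge e_j\}_{i<j}$ is orthonormal whenever $\{e_i\}$ is. Suppose that the Weyl tensor is divergence free, $\nabla^* W = 0$, where $\nabla$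 is the Levi-Civita connection and $(\nabla^*W)(X,Y,Z) = -\sum_i (\nabla_{e_i}W)(e_i,X,Y,Z)$. If $\lambda_1 + \dots + \lambda_{\lfloor (n-1)/2 \rfloor} \ge 0$ at every point of $M$, then $W$ is parallel, $\nabla W = 0$. If $\lambda_1 + \dots + \lambda_{\lfloor (n-1)/2 \rfloor} > 0$ at every point of $M$, then $(M,g)$ is (locally) conformally flat: around every point there are smooth coordinates $x_1,\dots,x_n$ and a smooth function $f$ with $g = e^{2f}(dx_1^2 + \dots + dx_n^2)$. -/

import Mathlib

open scoped Manifold ContDiff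

noncomputable section

namespace WeylBochner

/-- The coordinate space `ℝⁿ`. -/
abbrev Coord (n : ℕ) : Type := EuclideanSpace ℝ (Fin n)

variable {n : ℕ}

/-! ### Riemannian geometry of a metric given by its coefficients in coordinates

Here `g x i j` is the coefficient `g_ij` at the point `x` of the coordinate domain. -/

/-- The partial derivative `∂ₖ f` at `x`. -/
def pderiv (k : Fin n) (f : Coord n → ℝ) (x : Coord n) : ℝ :=
  fderiv ℝ f x (EuclideanSpace.single k 1)

/-- The Christoffel symbol `Γᵏᵢⱼ = ½ gᵏˡ (∂ᵢ gⱼₗ + ∂ⱼ gᵢₗ - ∂ₗ gᵢⱼ)` of the Levi-Civita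
connection: `∇_{∂ᵢ} ∂ⱼ = Γᵏᵢⱼ ∂ₖ`. -/
def christoffel (g : Coord n → Matrix (Fin n) (Fin n) ℝ) (k i j : Fin n) (x : Coord n) : ℝ :=
  (1 / 2) * ∑ l, (g x)⁻¹ k l *
    (pderiv i (fun y => g y j l) x + pderiv j (fun y => g y i l) x - pderiv l (fun y => g y i j) x)

/-- The coefficient of `∂ₘ` in
`∇_{∂ᵢ} ∇_{∂ⱼ} ∂ₗ - ∇_{∂ⱼ} ∇_{∂ᵢ} ∂ₗ`. -/
def riemannEnd (g : Coord n → Matrix (Fin n) (Fin n) ℝ) (m i j l : Fin n) (x : Coord n) : ℝ :=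
  pderiv i (christoffel g m j l) x - pderiv j (christoffel g m i l) x +
    ∑ p, (christoffel g p j l x * christoffel g m i p x -
      christoffel g p i l x * christoffel g m j p x)

/-- The `(0,4)` curvature tensor `Rm(∂ᵢ,∂ⱼ,∂ₖ,∂ₗ)`, with the sign for which
`Rm(X,Y,X,Y)` is the sectional curvature of orthonormal `X, Y`. -/
def riemann (g : Coord n → Matrix (Fin n) (Fin n) ℝ) (i j k l : Fin n) (x : Coord n) : ℝ :=
  ∑ m, g x k m * riemannEnd g m i j l x

/-- The Ricci tensor `Ricⱼₗ = gⁱᵏ Rmᵢⱼₖₗ`. -/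
def ricci (g : Coord n → Matrix (Fin n) (Fin n) ℝ) (x : Coord n) : Matrix (Fin n) (Fin n) ℝ :=
  fun j l => ∑ i, ∑ k, (g x)⁻¹ i k * riemann g i j k l x

/-- The scalar curvature. -/
def scal (g : Coord n → Matrix (Fin n) (Fin n) ℝ) (x : Coord n) : ℝ :=
  ∑ j, ∑ l, (g x)⁻¹ j l * ricci g x j l

/-- The trace-free Ricci tensor `Ric - (scal / n) g`. -/
def ricciZero (g : Coord n → Matrix (Fin n) (Fin n) ℝ) (x : Coord n) :
    Matrix (Fin n) (Fin n) ℝ :=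
  ricci g x - (scal g x / n) • g x

/-- The Kulkarni–Nomizu product of two symmetric `(0,2)`-tensors. -/
def kulkarniNomizu (S T : Matrix (Fin n) (Fin n) ℝ) (i j k l : Fin n) : ℝ :=
  S i k * T j l - S i l * T j k + S j l * T i k - S j k * T i l

/-- The Weyl tensor, the remainder in
`Rm = scal / (2 (n - 1) n) g ∧ g + 1 / (n - 2) g ∧ Ric₀ + W` (Kulkarni–Nomizu products). -/
def weyl (g : Coord n → Matrix (Fin n) (Fin n) ℝ) (i j k l : Fin n) (x : Coord n) : ℝ :=
  riemann g i j k l x - scal g x / (2 * ((n : ℝ) - 1) * n) * kulkarniNomizu (g x) (g x) i j k l -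
    1 / ((n : ℝ) - 2) * kulkarniNomizu (g x) (ricciZero g x) i j k l

/-- The covariant derivative `(∇_{∂ₘ} T)(∂ᵢ,∂ⱼ,∂ₖ,∂ₗ)` of a `(0,4)`-tensor field. -/
def covDeriv (g : Coord n → Matrix (Fin n) (Fin n) ℝ)
    (T : Fin n → Fin n → Fin n → Fin n → Coord n → ℝ) (m i j k l : Fin n) (x : Coord n) : ℝ :=
  pderiv m (T i j k l) x -
    ∑ p, (christoffel g p m i x * T p j k l x + christoffel g p m j x * T i p k l x +
      christoffel g p m k x * T i j p l x + christoffel g p m l x * T i j k p x)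

/-- `(∇* T)(∂ⱼ,∂ₖ,∂ₗ) = - gᵐⁱ (∇_{∂ₘ} T)(∂ᵢ,∂ⱼ,∂ₖ,∂ₗ)`. -/
def divergence (g : Coord n → Matrix (Fin n) (Fin n) ℝ)
    (T : Fin n → Fin n → Fin n → Fin n → Coord n → ℝ) (j k l : Fin n) (x : Coord n) : ℝ :=
  -∑ m, ∑ i, (g x)⁻¹ m i * covDeriv g T m i j k l x

/-- The index set of the basis `∂ᵢ ∧ ∂ⱼ`, `i < j`, of `Λ²`. -/
abbrev Pairs (n : ℕ) : Type := {p : Fin n × Fin n // p.1 < p.2}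

/-- The matrix, with respect to the basis `∂ᵢ ∧ ∂ⱼ` (`i < j`), of the curvature operator
`𝔯 : Λ² → Λ²` determined by `g(𝔯(X ∧ Y), Z ∧ W) = Rm(X,Y,Z,W)`. Its columns are given by
`𝔯(∂ᵢ ∧ ∂ⱼ) = ∑_{k < l} gᵏᵃ gˡᵇ Rmᵢⱼₐᵦ ∂ₖ ∧ ∂ₗ`. -/
def curvatureOperator (g : Coord n → Matrix (Fin n) (Fin n) ℝ) (x : Coord n) :
    Matrix (Pairs n) (Pairs n) ℝ :=
  fun kl ij => ∑ a, ∑ b, (g x)⁻¹ kl.1.1 a * (g x)⁻¹ kl.1.2 b * riemann g ij.1.1 ij.1.2 a b x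

/-- The eigenvalues `λ₁ ≤ λ₂ ≤ …` of the curvature operator, listed in increasing order and
repeated according to multiplicity. -/
def curvatureEigenvalues (g : Coord n → Matrix (Fin n) (Fin n) ℝ) (x : Coord n) : List ℝ :=
  (curvatureOperator g x).charpoly.roots.sort (· ≤ ·)

/-- `λ₁ + ⋯ + λₖ`. -/
def lowestEigenvalueSum (g : Coord n → Matrix (Fin n) (Fin n) ℝ) (k : ℕ) (x : Coord n) : ℝ :=
  ((curvatureEigenvalues g x).take k).sum

/-! ### Riemannian manifolds -/

variable {M : Type*} [TopologicalSpace M] [ChartedSpace (Coord n) M] [IsManifold (𝓡 n) ∞ M]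

/-- Smooth Riemannian metrics on the smooth `n`-manifold `M`. -/
abbrev SmoothMetric (n : ℕ) (M : Type*) [TopologicalSpace M] [ChartedSpace (Coord n) M]
    [IsManifold (𝓡 n) ∞ M] : Type _ :=
  Bundle.ContMDiffRiemannianMetric (𝓡 n) ∞ (Coord n) (fun p : M => TangentSpace (𝓡 n) p)

/-- The coordinate vector field `∂ᵢ` of the chart `φ` at the point `φ⁻¹(x)`. -/
def coordVec (φ : OpenPartialHomeomorph M (Coord n)) (x : Coord n) (i : Fin n) :
    TangentSpace (𝓡 n) (φ.symm x) :=
  mfderiv (𝓡 n) (𝓡 n) φ.symm x (EuclideanSpace.single i (1 : ℝ) : Coord n)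

/-- The coefficients `g(∂ᵢ,∂ⱼ)` of the metric in the chart `φ`. -/
def coeff (g : SmoothMetric n M) (φ : OpenPartialHomeomorph M (Coord n)) (x : Coord n) :
    Matrix (Fin n) (Fin n) ℝ :=
  fun i j => g.inner (φ.symm x) (coordVec φ x i) (coordVec φ x j)

/-- `∇* W = 0`: its components vanish in all smooth charts. -/
def WeylDivergenceFree (g : SmoothMetric n M) : Prop :=
  ∀ φ ∈ IsManifold.maximalAtlas (𝓡 n) ∞ M, ∀ x ∈ φ.target, ∀ j k l,
    divergence (coeff g φ) (weyl (coeff g φ)) j k l x = 0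

/-- `∇ W = 0`: its components vanish in all smooth charts. -/
def WeylParallel (g : SmoothMetric n M) : Prop :=
  ∀ φ ∈ IsManifold.maximalAtlas (𝓡 n) ∞ M, ∀ x ∈ φ.target, ∀ m i j k l,
    covDeriv (coeff g φ) (weyl (coeff g φ)) m i j k l x = 0

/-- At every point of `M` the curvature operator satisfies `λ₁ + ⋯ + λₖ ≥ 0`
(its eigenvalues do not depend on the chart in which they are computed). -/
def EigenvalueSumNonneg (g : SmoothMetric n M) (k : ℕ) : Prop :=
  ∀ φ ∈ IsManifold.maximalAtlas (𝓡 n) ∞ M, ∀ x ∈ φ.target,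
    0 ≤ lowestEigenvalueSum (coeff g φ) k x

/-- At every point of `M` the curvature operator satisfies `λ₁ + ⋯ + λₖ > 0`. -/
def EigenvalueSumPos (g : SmoothMetric n M) (k : ℕ) : Prop :=
  ∀ φ ∈ IsManifold.maximalAtlas (𝓡 n) ∞ M, ∀ x ∈ φ.target,
    0 < lowestEigenvalueSum (coeff g φ) k x

/-- `(M, g)` is (locally) conformally flat: around every point there are smooth coordinates in
which `g = e^{2f} (dx₁² + ⋯ + dxₙ²)` for a smooth function `f`. -/
def ConformallyFlat (g : SmoothMetric n M) : Prop :=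
  ∀ p : M, ∃ φ ∈ IsManifold.maximalAtlas (𝓡 n) ∞ M, p ∈ φ.source ∧
    ∃ f : Coord n → ℝ, ContDiffOn ℝ ∞ f φ.target ∧
      ∀ x ∈ φ.target, coeff g φ x = Real.exp (2 * f x) • (1 : Matrix (Fin n) (Fin n) ℝ)

end WeylBochner

end

noncomputable section

namespace WeylBochner

variable {n : ℕ}

/-! ### Partial derivatives of smooth functions -/

section Calculus

variable {U : Set (Coord n)} {f f₁ f₂ : Coord n → ℝ} {x : Coord n}

/-! The proof is the Bochner technique, carried out in coordinates. Write `Rm = g ∧ P + W`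
(Kulkarni–Nomizu product) with `P` the Schouten tensor. Contracting the second Bianchi identity
shows that the divergence of `W` is `n - 3` times the Cotton tensor of `P`. For `n ≥ 4` a
divergence-free `W` therefore has vanishing Cotton tensor and satisfies the second Bianchi identity
itself (`MetricOn.weylF_bianchi`). That identity and `div W = 0` turn the trace of `∇²W` into
commutators of covariant derivatives, that is, into curvature. The result is `MetricOn.bochner`, in
an orthonormal frame `Δ|W|² = 2|∇W|² + tr(R H)`, where `R` is the curvature operator and `H` is the
Gram matrix of the derivatives `E W`, with `E` running over the standard basis of `so(n)`.

Two facts control `H`. Its trace is `4(n-1)|W|²`, a Casimir computation (`trace_soGram`). As a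
quadratic form it is at most `8|W|²` (`dotProduct_soGram_le`), which rests on `‖[X,L]‖ ≤ ‖X‖‖L‖` for
skew-symmetric matrices (`frobenius_commutator_le`). So the eigenvectors of `R` receive weights
between `0` and `8|W|²` with total `4(n-1)|W|²`. For `k = ⌊(n-1)/2⌋` one has `8 ≤ 4(n-1)/k`, and the
cheapest admissible distribution puts all the weight on the `k` lowest eigenvalues: `tr(R H) ≥
(4(n-1)/k) |W|² (λ₁ + ⋯ + λₖ)` (`trace_mul_ge_sum_lowest`, `curvTerm_estimate`).

Hence `|W|²` is subharmonic. It is a scalar, independent of the chart, so on a closed connected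
manifold Hopf's strong maximum principle (`MetricOn.strong_maximum_principle`) makes it constant,
and no integration is needed. Its Laplacian is then zero, both nonnegative terms of the Bochner
inequality vanish, and `∇W = 0`; a positive eigenvalue sum forces `W = 0`.

It remains to prove the Weyl–Schouten theorem. The curvature of the tractor connection, on triples
`(σ, μ, ρ)`, is built from `W` and the Cotton tensor, so the connection is flat when `W = 0`
(`MetricOn.tractorConn_flat`), and flat linear systems have local solutions (`exists_flat_section`).
Take parallel tractors `s` null and `tᵢ` orthonormal and orthogonal to `s`. Then `yᵢ = σ(tᵢ) / σ(s)`
are coordinates with `g = σ(s)² ∑ dyᵢ²` (`MetricOn.exists_conformal_coordinates`). -/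

lemma diffAt_of_smooth (hf : ContDiffOn ℝ ∞ f U) (hU : IsOpen U) (hx : x ∈ U) :
    DifferentiableAt ℝ f x :=
  (hf.contDiffAt (hU.mem_nhds hx)).differentiableAt (by simp)

lemma contDiffOn_pderiv (hU : IsOpen U) (hf : ContDiffOn ℝ ∞ f U) (k : Fin n) :
    ContDiffOn ℝ ∞ (pderiv k f) U :=
  (hf.fderiv_of_isOpen hU (by simp)).clm_apply contDiffOn_const

lemma pderiv_const (k : Fin n) (c : ℝ) : pderiv k (fun _ => c) x = 0 := by
  simp [pderiv]

lemma pderiv_add (k : Fin n) (h₁ : DifferentiableAt ℝ f₁ x) (h₂ : DifferentiableAt ℝ f₂ x) :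
    pderiv k (fun y => f₁ y + f₂ y) x = pderiv k f₁ x + pderiv k f₂ x := by
  simp [pderiv, fderiv_fun_add h₁ h₂]

lemma pderiv_sub (k : Fin n) (h₁ : DifferentiableAt ℝ f₁ x) (h₂ : DifferentiableAt ℝ f₂ x) :
    pderiv k (fun y => f₁ y - f₂ y) x = pderiv k f₁ x - pderiv k f₂ x := by
  simp [pderiv, fderiv_fun_sub h₁ h₂]

lemma pderiv_neg (k : Fin n) : pderiv k (fun y => - f y) x = - pderiv k f x := by
  simp [pderiv, fderiv_fun_neg]

lemma pderiv_mul (k : Fin n) (h₁ : DifferentiableAt ℝ f₁ x) (h₂ : DifferentiableAt ℝ f₂ x) :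
    pderiv k (fun y => f₁ y * f₂ y) x = pderiv k f₁ x * f₂ x + f₁ x * pderiv k f₂ x := by
  simp [pderiv, fderiv_fun_mul h₁ h₂]; ring

lemma pderiv_const_mul (k : Fin n) (c : ℝ) (h : DifferentiableAt ℝ f x) :
    pderiv k (fun y => c * f y) x = c * pderiv k f x := by
  simp [pderiv, fderiv_const_mul h]

lemma pderiv_sum {ι : Type*} (s : Finset ι) (k : Fin n) {F : ι → Coord n → ℝ}
    (h : ∀ i ∈ s, DifferentiableAt ℝ (F i) x) :
    pderiv k (fun y => ∑ i ∈ s, F i y) x = ∑ i ∈ s, pderiv k (F i) x := by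
  simp [pderiv, fderiv_fun_sum h]

lemma pderiv_congr (hU : IsOpen U) (hx : x ∈ U) (h : Set.EqOn f₁ f₂ U) (k : Fin n) :
    pderiv k f₁ x = pderiv k f₂ x := by
  have : f₁ =ᶠ[nhds x] f₂ := Filter.eventuallyEq_of_mem (hU.mem_nhds hx) h
  simp [pderiv, this.fderiv_eq]

lemma pderiv_comm (hU : IsOpen U) (hf : ContDiffOn ℝ ∞ f U) (hx : x ∈ U) (i j : Fin n) :
    pderiv i (pderiv j f) x = pderiv j (pderiv i f) x := by
  have hc := hf.contDiffAt (hU.mem_nhds hx)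
  have hd : DifferentiableAt ℝ (fderiv ℝ f) x :=
    (hc.fderiv_right (m := 1) (by norm_cast)).differentiableAt (by simp)
  have key : ∀ a b : Fin n, pderiv a (pderiv b f) x =
      fderiv ℝ (fderiv ℝ f) x (EuclideanSpace.single a 1) (EuclideanSpace.single b 1) := by
    intro a b
    unfold pderiv
    rw [fderiv_clm_apply hd (differentiableAt_const _)]
    simp
  rw [key, key]
  exact (hc.isSymmSndFDerivAt (by simp; norm_cast)) _ _

lemma fderiv_eq_sum_pderiv (v : Coord n) : fderiv ℝ f x v = ∑ k, v k * pderiv k f x := by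
  have hv : v = ∑ k, v k • (EuclideanSpace.single k (1:ℝ) : Coord n) := by
    ext i; simp [Finset.sum_apply, Pi.single_apply]
  conv_lhs => rw [hv]
  simp [pderiv]

end Calculus

/-! ### Matrix-valued functions -/

section MatrixCalculus

variable {U : Set (Coord n)} {x : Coord n} {ι κ μ : Type*}

/-- Smoothness of the entries of a matrix-valued function. -/
def SmoothM (U : Set (Coord n)) (A : Coord n → Matrix ι κ ℝ) : Prop :=
  ∀ i j, ContDiffOn ℝ ∞ (fun y => A y i j) U

/-- The entrywise partial derivative of a matrix-valued function. -/
def mpd (k : Fin n) (A : Coord n → Matrix ι κ ℝ) (x : Coord n) : Matrix ι κ ℝ :=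
  fun i j => pderiv k (fun y => A y i j) x

variable {A B : Coord n → Matrix ι κ ℝ} {C : Coord n → Matrix κ μ ℝ}

lemma mpd_apply (k : Fin n) (i : ι) (j : κ) :
    mpd k A x i j = pderiv k (fun y => A y i j) x := rfl

lemma SmoothM.mpd (hU : IsOpen U) (hA : SmoothM U A) (k : Fin n) : SmoothM U (mpd k A) :=
  fun i j => contDiffOn_pderiv hU (hA i j) k

lemma SmoothM.add (hA : SmoothM U A) (hB : SmoothM U B) : SmoothM U (fun y => A y + B y) :=
  fun i j => (hA i j).add (hB i j)

lemma SmoothM.sub (hA : SmoothM U A) (hB : SmoothM U B) : SmoothM U (fun y => A y - B y) :=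
  fun i j => (hA i j).sub (hB i j)

lemma SmoothM.mul [Fintype κ] (hA : SmoothM U A) (hC : SmoothM U C) :
    SmoothM U (fun y => A y * C y) := fun i j => by
  simp only [Matrix.mul_apply]
  exact ContDiffOn.sum fun p _ => (hA i p).mul (hC p j)

lemma SmoothM.transpose (hA : SmoothM U A) : SmoothM U (fun y => (A y).transpose) :=
  fun i j => hA j i

lemma SmoothM.smul {f : Coord n → ℝ} (hf : ContDiffOn ℝ ∞ f U) (hA : SmoothM U A) :
    SmoothM U (fun y => f y • A y) := fun i j => by
  simpa using hf.mul (hA i j)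

lemma SmoothM.sum {τ : Type*} (s : Finset τ) {F : τ → Coord n → Matrix ι κ ℝ}
    (h : ∀ a ∈ s, SmoothM U (F a)) : SmoothM U (fun y => ∑ a ∈ s, F a y) := fun i j => by
  simp only [Matrix.sum_apply]
  exact ContDiffOn.sum fun a ha => h a ha i j

lemma SmoothM.dAt (hA : SmoothM U A) (hU : IsOpen U) (hx : x ∈ U) (i : ι) (j : κ) :
    DifferentiableAt ℝ (fun y => A y i j) x := diffAt_of_smooth (hA i j) hU hx

lemma mpd_add (hU : IsOpen U) (hx : x ∈ U) (hA : SmoothM U A) (hB : SmoothM U B) (k : Fin n) :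
    mpd k (fun y => A y + B y) x = mpd k A x + mpd k B x := by
  ext i j
  simpa [mpd] using pderiv_add k (hA.dAt hU hx i j) (hB.dAt hU hx i j)

lemma mpd_sub (hU : IsOpen U) (hx : x ∈ U) (hA : SmoothM U A) (hB : SmoothM U B) (k : Fin n) :
    mpd k (fun y => A y - B y) x = mpd k A x - mpd k B x := by
  ext i j
  simpa [mpd] using pderiv_sub k (hA.dAt hU hx i j) (hB.dAt hU hx i j)

lemma mpd_mul [Fintype κ] (hU : IsOpen U) (hx : x ∈ U) (hA : SmoothM U A) (hC : SmoothM U C)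
    (k : Fin n) : mpd k (fun y => A y * C y) x = mpd k A x * C x + A x * mpd k C x := by
  ext i j
  simp only [mpd, Matrix.mul_apply, Matrix.add_apply]
  rw [pderiv_sum _ _ fun p _ => (hA.dAt hU hx i p).fun_mul (hC.dAt hU hx p j),
    ← Finset.sum_add_distrib]
  exact Finset.sum_congr rfl fun p _ => pderiv_mul k (hA.dAt hU hx i p) (hC.dAt hU hx p j)

lemma mpd_smul {f : Coord n → ℝ} (hU : IsOpen U) (hx : x ∈ U) (hf : ContDiffOn ℝ ∞ f U)
    (hA : SmoothM U A) (k : Fin n) :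
    mpd k (fun y => f y • A y) x = pderiv k f x • A x + f x • mpd k A x := by
  ext i j
  simpa [mpd] using pderiv_mul k (diffAt_of_smooth hf hU hx) (hA.dAt hU hx i j)

lemma mpd_sum {τ : Type*} (s : Finset τ) {F : τ → Coord n → Matrix ι κ ℝ} (hU : IsOpen U)
    (hx : x ∈ U) (h : ∀ a ∈ s, SmoothM U (F a)) (k : Fin n) :
    mpd k (fun y => ∑ a ∈ s, F a y) x = ∑ a ∈ s, mpd k (F a) x := by
  ext i j
  simp only [mpd, Matrix.sum_apply]
  exact pderiv_sum s k fun a ha => (h a ha).dAt hU hx i j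

lemma mpd_transpose (k : Fin n) :
    mpd k (fun y => (A y).transpose) x = (mpd k A x).transpose := rfl

lemma mpd_congr (hU : IsOpen U) (hx : x ∈ U) (h : Set.EqOn A B U) (k : Fin n) :
    mpd k A x = mpd k B x := by
  ext i j
  exact pderiv_congr hU hx (fun y hy => by simp [h hy]) k

lemma mpd_const (k : Fin n) (D : Matrix ι κ ℝ) : mpd k (fun _ => D) x = 0 := by
  ext i j; simp [mpd, pderiv_const]

lemma mpd_comm (hU : IsOpen U) (hA : SmoothM U A) (hx : x ∈ U) (i j : Fin n) :
    mpd i (mpd j A) x = mpd j (mpd i A) x := by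
  ext a b
  exact pderiv_comm hU (hA a b) hx i j

lemma SmoothM.det [Fintype ι] [DecidableEq ι] {A : Coord n → Matrix ι ι ℝ} (hA : SmoothM U A) :
    ContDiffOn ℝ ∞ (fun y => (A y).det) U := by
  simp only [Matrix.det_apply']
  exact ContDiffOn.sum fun σ _ => contDiffOn_const.mul (contDiffOn_prod fun i _ => hA _ _)

/-- Cramer's rule: up to the factor `det⁻¹`, each entry of the inverse is the determinant of the
matrix with one row made constant. -/
lemma SmoothM.inv [Fintype ι] [DecidableEq ι] {A : Coord n → Matrix ι ι ℝ} (hA : SmoothM U A)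
    (h0 : ∀ y ∈ U, (A y).det ≠ 0) : SmoothM U (fun y => (A y)⁻¹) := fun i j => by
  have h1 : ContDiffOn ℝ ∞ (fun y => ((A y).det)⁻¹ * (A y).adjugate i j) U := by
    refine (hA.det.inv h0).mul ?_
    simp only [Matrix.adjugate_apply]
    refine SmoothM.det fun a b => ?_
    by_cases h : a = j
    · subst h; simpa using contDiffOn_const
    · simpa [Matrix.updateRow_apply, h] using hA a b
  refine h1.congr fun y hy => ?_
  simp [Matrix.inv_def]

/-- Differentiate `A⁻¹ A = 1`. -/
lemma mpd_inv [Fintype ι] [DecidableEq ι] {A : Coord n → Matrix ι ι ℝ} (hU : IsOpen U)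
    (hx : x ∈ U) (hA : SmoothM U A) (h0 : ∀ y ∈ U, (A y).det ≠ 0) (k : Fin n) :
    mpd k (fun y => (A y)⁻¹) x = - ((A x)⁻¹ * mpd k A x * (A x)⁻¹) := by
  have hu : ∀ y ∈ U, IsUnit (A y).det := fun y hy => (h0 y hy).isUnit
  have h1 := mpd_mul hU hx (hA.inv h0) hA k
  rw [mpd_congr (B := fun _ => (1 : Matrix ι ι ℝ)) hU hx
    (fun y hy => Matrix.nonsing_inv_mul _ (hu y hy)), mpd_const] at h1
  have h2 := congrArg (fun M => M * (A x)⁻¹) h1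
  simp only [zero_mul, add_mul, Matrix.mul_assoc, Matrix.mul_nonsing_inv _ (hu x hx),
    mul_one] at h2
  rw [Matrix.mul_assoc]
  exact eq_neg_of_add_eq_zero_left h2.symm

end MatrixCalculus

/-! ### The Levi-Civita connection and the symmetries of the curvature tensor -/

/-- `g` is a smooth Riemannian metric on the open set `U` of the coordinate space. -/
structure MetricOn (g : Coord n → Matrix (Fin n) (Fin n) ℝ) (U : Set (Coord n)) : Prop where
  isOpen : IsOpen U
  smooth : SmoothM U g
  posDef : ∀ x ∈ U, (g x).PosDef

/-- The connection matrix `Γᵢ`, with entries `(Γᵢ)ᵏⱼ`. -/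
def gam (g : Coord n → Matrix (Fin n) (Fin n) ℝ) (i : Fin n) (x : Coord n) :
    Matrix (Fin n) (Fin n) ℝ := fun k j => christoffel g k i j x

/-- The curvature endomorphism `R(∂ᵢ,∂ⱼ)`. -/
def curv (g : Coord n → Matrix (Fin n) (Fin n) ℝ) (i j : Fin n) (x : Coord n) :
    Matrix (Fin n) (Fin n) ℝ := fun m l => riemannEnd g m i j l x

lemma riemann_eq_mul (g : Coord n → Matrix (Fin n) (Fin n) ℝ) (i j k l : Fin n) (x : Coord n) :
    riemann g i j k l x = (g x * curv g i j x) k l := rfl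

/-- Cartan's structure equation `R = dΓ + Γ ∧ Γ`. It lets the Bianchi identity and the change of
coordinates be checked by noncommutative matrix algebra. -/
lemma curv_eq (g : Coord n → Matrix (Fin n) (Fin n) ℝ) (i j : Fin n) (x : Coord n) :
    curv g i j x = mpd i (gam g j) x - mpd j (gam g i) x +
      (gam g i x * gam g j x - gam g j x * gam g i x) := by
  ext m l
  simp only [curv, riemannEnd, Matrix.add_apply, Matrix.sub_apply, mpd_apply, Matrix.mul_apply,
    ← Finset.sum_sub_distrib]
  congr 1
  exact Finset.sum_congr rfl fun p _ => by simp only [gam]; ring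

lemma curv_swap (g : Coord n → Matrix (Fin n) (Fin n) ℝ) (i j : Fin n) (x : Coord n) :
    curv g i j x = - curv g j i x := by
  rw [curv_eq, curv_eq]; abel

namespace MetricOn

variable {g : Coord n → Matrix (Fin n) (Fin n) ℝ} {U : Set (Coord n)} {x : Coord n}

lemma symm (hg : MetricOn g U) (hx : x ∈ U) (i j : Fin n) : g x i j = g x j i := by
  have := (hg.posDef x hx).isHermitian.apply i j
  simpa using this.symm

lemma transpose (hg : MetricOn g U) (hx : x ∈ U) : (g x).transpose = g x := by
  ext i j; exact hg.symm hx j i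

lemma det_ne (hg : MetricOn g U) (hx : x ∈ U) : (g x).det ≠ 0 := (hg.posDef x hx).det_pos.ne'

lemma isUnit (hg : MetricOn g U) (hx : x ∈ U) : IsUnit (g x).det := (hg.det_ne hx).isUnit

lemma mul_inv (hg : MetricOn g U) (hx : x ∈ U) : g x * (g x)⁻¹ = 1 :=
  Matrix.mul_nonsing_inv _ (hg.isUnit hx)

lemma inv_mul (hg : MetricOn g U) (hx : x ∈ U) : (g x)⁻¹ * g x = 1 :=
  Matrix.nonsing_inv_mul _ (hg.isUnit hx)

lemma inv_transpose (hg : MetricOn g U) (hx : x ∈ U) : ((g x)⁻¹).transpose = (g x)⁻¹ := by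
  rw [Matrix.transpose_nonsing_inv, hg.transpose hx]

lemma inv_symm (hg : MetricOn g U) (hx : x ∈ U) (i j : Fin n) : (g x)⁻¹ i j = (g x)⁻¹ j i := by
  conv_lhs => rw [← hg.inv_transpose hx]
  rfl

lemma smooth_inv (hg : MetricOn g U) : SmoothM U (fun y => (g y)⁻¹) :=
  hg.smooth.inv fun _ hy => hg.det_ne hy

lemma pderiv_symm (hg : MetricOn g U) (hx : x ∈ U) (l i j : Fin n) :
    pderiv l (fun y => g y i j) x = pderiv l (fun y => g y j i) x :=
  pderiv_congr hg.isOpen hx (fun _ hy => hg.symm hy i j) l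

lemma christoffel_symm (hg : MetricOn g U) (hx : x ∈ U) (k i j : Fin n) :
    christoffel g k i j x = christoffel g k j i x := by
  simp only [christoffel]
  congr 1
  refine Finset.sum_congr rfl fun l _ => ?_
  rw [hg.pderiv_symm hx l i j]; ring

lemma smooth_gam (hg : MetricOn g U) (i : Fin n) : SmoothM U (gam g i) := fun k j => by
  simp only [gam, christoffel]
  refine contDiffOn_const.mul (ContDiffOn.sum fun l _ => (hg.smooth_inv k l).mul ?_)
  exact ((contDiffOn_pderiv hg.isOpen (hg.smooth _ _) _).add
    (contDiffOn_pderiv hg.isOpen (hg.smooth _ _) _)).sub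
    (contDiffOn_pderiv hg.isOpen (hg.smooth _ _) _)

lemma smooth_christoffel (hg : MetricOn g U) (k i j : Fin n) :
    ContDiffOn ℝ ∞ (christoffel g k i j) U := hg.smooth_gam i k j

lemma smooth_curv (hg : MetricOn g U) (i j : Fin n) : SmoothM U (curv g i j) := by
  have h : curv g i j = fun x => mpd i (gam g j) x - mpd j (gam g i) x +
      (gam g i x * gam g j x - gam g j x * gam g i x) := funext fun x => curv_eq g i j x
  rw [h]
  exact (((hg.smooth_gam j).mpd hg.isOpen i).sub ((hg.smooth_gam i).mpd hg.isOpen j)).add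
    (((hg.smooth_gam i).mul (hg.smooth_gam j)).sub ((hg.smooth_gam j).mul (hg.smooth_gam i)))

lemma smooth_riemann (hg : MetricOn g U) (i j k l : Fin n) :
    ContDiffOn ℝ ∞ (riemann g i j k l) U := (hg.smooth.mul (hg.smooth_curv i j)) k l

lemma smooth_ricci (hg : MetricOn g U) : SmoothM U (ricci g) := fun j l => by
  simp only [ricci]
  exact ContDiffOn.sum fun i _ => ContDiffOn.sum fun k _ =>
    (hg.smooth_inv i k).mul (hg.smooth_riemann i j k l)

lemma smooth_scal (hg : MetricOn g U) : ContDiffOn ℝ ∞ (scal g) U := by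
  unfold scal
  exact ContDiffOn.sum fun i _ => ContDiffOn.sum fun k _ =>
    (hg.smooth_inv i k).mul (hg.smooth_ricci i k)

/-- Lowering the upper index cancels the inverse metric and leaves the Christoffel symbols of the
first kind, linear in the first derivatives of `g`. -/
lemma lower_christoffel (hg : MetricOn g U) (hx : x ∈ U) (a i j : Fin n) :
    (g x * gam g i x) a j = (1 / 2) * (pderiv i (fun y => g y j a) x +
      pderiv j (fun y => g y i a) x - pderiv a (fun y => g y i j) x) := by
  set v : Fin n → ℝ := fun l => pderiv i (fun y => g y j l) x +
      pderiv j (fun y => g y i l) x - pderiv l (fun y => g y i j) x with hv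
  have h1 : ∀ k, gam g i x k j = (1 / 2) * ((g x)⁻¹.mulVec v) k := fun k => rfl
  have h2 : (g x).mulVec ((g x)⁻¹.mulVec v) = v := by
    rw [Matrix.mulVec_mulVec, hg.mul_inv hx, Matrix.one_mulVec]
  have h3 := congrFun h2 a
  rw [Matrix.mul_apply]
  simp only [h1]
  calc ∑ k, g x a k * (1 / 2 * ((g x)⁻¹.mulVec v) k)
      = 1 / 2 * ((g x).mulVec ((g x)⁻¹.mulVec v)) a := by
        conv_rhs => rw [Matrix.mulVec, dotProduct, Finset.mul_sum]
        exact Finset.sum_congr rfl fun k _ => by ring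
    _ = _ := by rw [h3]

/-- The Levi-Civita connection is metric. -/
lemma compat (hg : MetricOn g U) (hx : x ∈ U) (i : Fin n) :
    mpd i g x = (gam g i x).transpose * g x + g x * gam g i x := by
  have h0 : (gam g i x).transpose * g x = (g x * gam g i x).transpose := by
    rw [Matrix.transpose_mul, hg.transpose hx]
  ext a b
  rw [h0, Matrix.add_apply, Matrix.transpose_apply, hg.lower_christoffel hx,
    hg.lower_christoffel hx, mpd_apply, hg.pderiv_symm hx i b a, hg.pderiv_symm hx a i b,
    hg.pderiv_symm hx b i a]
  ring

/-- `∇g⁻¹ = 0`, from `∇g = 0` and the derivative of an inverse. -/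
lemma mpd_inv_eq (hg : MetricOn g U) (hx : x ∈ U) (i : Fin n) :
    mpd i (fun y => (g y)⁻¹) x =
      - (gam g i x * (g x)⁻¹ + (g x)⁻¹ * (gam g i x).transpose) := by
  rw [mpd_inv hg.isOpen hx hg.smooth (fun _ hy => hg.det_ne hy), hg.compat hx, mul_add, add_mul]
  rw [← Matrix.mul_assoc ((g x)⁻¹) (g x), hg.inv_mul hx, one_mul, Matrix.mul_assoc ((g x)⁻¹),
    Matrix.mul_assoc _ (g x), hg.mul_inv hx, mul_one, add_comm]

lemma pderiv_metric (hg : MetricOn g U) (hx : x ∈ U) (m i j : Fin n) :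
    pderiv m (fun y => g y i j) x = ∑ p, (christoffel g p m i x * g x p j +
      christoffel g p m j x * g x i p) := by
  have := congrFun (congrFun (hg.compat hx m) i) j
  rw [mpd_apply] at this
  rw [this, Finset.sum_add_distrib]
  simp only [Matrix.add_apply, Matrix.mul_apply, Matrix.transpose_apply, gam, mul_comm]

/-- The Levi-Civita connection is the only torsion-free metric connection. -/
lemma eq_gam (hg : MetricOn g U) (hx : x ∈ U) (C : Fin n → Matrix (Fin n) (Fin n) ℝ)
    (hsymm : ∀ k i j, C i k j = C j k i)
    (hC : ∀ i, mpd i g x = (C i).transpose * g x + g x * C i) (i : Fin n) :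
    C i = gam g i x := by
  have hS : ∀ a i j, (g x * C i) a j = (g x * C j) a i := fun a i j => by
    simp only [Matrix.mul_apply, hsymm _ i j]
  have h0 : ∀ i, (C i).transpose * g x = (g x * C i).transpose := fun i => by
    rw [Matrix.transpose_mul, hg.transpose hx]
  have h1 : ∀ i a b, pderiv i (fun y => g y a b) x = (g x * C i) b a + (g x * C i) a b := by
    intro i a b
    have := congrFun (congrFun (hC i) a) b
    rwa [h0, Matrix.add_apply, Matrix.transpose_apply, mpd_apply] at this
  have h2 : g x * C i = g x * gam g i x := by
    ext a j
    rw [hg.lower_christoffel hx, h1, h1, h1, hS j a i, hS i a j, hS a j i]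
    ring
  have h3 := congrArg (fun M => (g x)⁻¹ * M) h2
  simpa only [← Matrix.mul_assoc, hg.inv_mul hx, one_mul] using h3

/-- Differentiate `compat` once more: the mixed second derivatives of `g` agree, and the
antisymmetric part in `i, j` of the rest is the skewness of the curvature. -/
lemma lower_curv_skew (hg : MetricOn g U) (hx : x ∈ U) (i j : Fin n) :
    (curv g i j x).transpose * g x + g x * curv g i j x = 0 := by
  have hd : ∀ a b, mpd a (mpd b g) x =
      ((mpd a (gam g b) x).transpose * g x + (gam g b x).transpose * mpd a g x) +
        (mpd a g x * gam g b x + g x * mpd a (gam g b) x) := by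
    intro a b
    rw [mpd_congr (B := fun y => (gam g b y).transpose * g y + g y * gam g b y) hg.isOpen hx
      (fun y hy => hg.compat hy b),
      mpd_add hg.isOpen hx ((hg.smooth_gam b).transpose.mul hg.smooth)
        (hg.smooth.mul (hg.smooth_gam b)),
      mpd_mul hg.isOpen hx (hg.smooth_gam b).transpose hg.smooth,
      mpd_mul hg.isOpen hx hg.smooth (hg.smooth_gam b), mpd_transpose]
  have h := mpd_comm hg.isOpen hg.smooth hx i j
  rw [hd, hd, hg.compat hx, hg.compat hx, ← sub_eq_zero] at h
  rw [curv_eq, ← h]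
  simp only [Matrix.transpose_add, Matrix.transpose_sub, Matrix.transpose_mul]
  noncomm_ring

lemma riemann_swap₁ (i j k l : Fin n) : riemann g i j k l x = - riemann g j i k l x := by
  rw [riemann_eq_mul, riemann_eq_mul, curv_swap, mul_neg, Matrix.neg_apply]

lemma riemann_swap₂ (hg : MetricOn g U) (hx : x ∈ U) (i j k l : Fin n) :
    riemann g i j k l x = - riemann g i j l k x := by
  have h := congrFun (congrFun (hg.lower_curv_skew hx i j) k) l
  have h0 : (curv g i j x).transpose * g x = (g x * curv g i j x).transpose := by
    rw [Matrix.transpose_mul, hg.transpose hx]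
  rw [h0, Matrix.add_apply, Matrix.transpose_apply, Matrix.zero_apply] at h
  rw [riemann_eq_mul, riemann_eq_mul]; linarith

/-- A consequence of torsion-freeness: with `Γ` symmetric in its lower indices, the derivative terms
and the quadratic terms each cancel in pairs. -/
lemma riemannEnd_cyclic (hg : MetricOn g U) (hx : x ∈ U) (m i j l : Fin n) :
    riemannEnd g m i j l x + riemannEnd g m j l i x + riemannEnd g m l i j x = 0 := by
  have hc : ∀ a i j l, pderiv a (christoffel g i j l) x = pderiv a (christoffel g i l j) x :=
    fun a i j l => pderiv_congr hg.isOpen hx (fun y hy => hg.christoffel_symm hy i j l) a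
  simp only [riemannEnd]
  rw [hc i m l j, hc j m l i, hc l m j i]
  simp only [hg.christoffel_symm hx _ l i, hg.christoffel_symm hx _ l j,
    hg.christoffel_symm hx _ j i]
  have : ∀ a b c : ℝ, a + b + c = 0 →
      pderiv i (christoffel g m j l) x - pderiv j (christoffel g m i l) x + a +
      (pderiv j (christoffel g m i l) x - pderiv l (christoffel g m i j) x + b) +
      (pderiv l (christoffel g m i j) x - pderiv i (christoffel g m j l) x + c) = 0 := by
    intros; linarith
  apply this
  rw [← Finset.sum_add_distrib, ← Finset.sum_add_distrib]
  exact Finset.sum_eq_zero fun p _ => by ring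

lemma riemann_cyclic (hg : MetricOn g U) (hx : x ∈ U) (i j k l : Fin n) :
    riemann g i j k l x + riemann g j l k i x + riemann g l i k j x = 0 := by
  simp only [riemann, ← Finset.sum_add_distrib, ← mul_add, hg.riemannEnd_cyclic hx]
  simp

/-- The octahedron argument: combine the four first Bianchi identities, each holding a different
index fixed, by means of the two skew symmetries. -/
lemma riemann_pair (hg : MetricOn g U) (hx : x ∈ U) (i j k l : Fin n) :
    riemann g i j k l x = riemann g k l i j x := by
  have s1 := fun i j k l => riemann_swap₁ (g := g) (x := x) i j k l
  have s2 := fun i j k l => hg.riemann_swap₂ hx i j k l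
  have b := fun i j k l => hg.riemann_cyclic hx i j k l
  have e1 := b i j k l
  have e2 := b j k l i
  have e3 := b k l i j
  have e4 := b l i j k
  linarith [s1 i j k l, s2 i j k l, s1 j l k i, s2 j l k i, s1 l i k j, s2 l i k j, s1 j k l i,
    s2 j k l i, s1 k i l j, s2 k i l j, s1 i j l k, s2 i j l k, s1 k l i j, s2 k l i j,
    s1 l j i k, s2 l j i k, s1 j k i l, s2 j k i l, s1 l i j k, s2 l i j k, s1 i k j l,
    s2 i k j l, s1 k l j i, s2 k l j i, s1 j l i k, s2 j l i k, s1 i k l j, s2 i k l j,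
    s1 k j l i, s1 i l k j, s2 i l k j, s1 i l j k, s1 k j i l]

lemma ricci_symm (hg : MetricOn g U) (hx : x ∈ U) (j l : Fin n) :
    ricci g x j l = ricci g x l j := by
  simp only [ricci]
  rw [Finset.sum_comm]
  refine Finset.sum_congr rfl fun i _ => Finset.sum_congr rfl fun k _ => ?_
  rw [hg.inv_symm hx k i, hg.riemann_pair hx k j i l]

/-- The differential Bianchi identity for the matrices of the curvature. -/
lemma curv_bianchi (hg : MetricOn g U) (hx : x ∈ U) (a b c : Fin n) :
    (mpd a (curv g b c) x + (gam g a x * curv g b c x - curv g b c x * gam g a x)) +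
    (mpd b (curv g c a) x + (gam g b x * curv g c a x - curv g c a x * gam g b x)) +
    (mpd c (curv g a b) x + (gam g c x * curv g a b x - curv g a b x * gam g c x)) = 0 := by
  have hd : ∀ a b c, mpd a (curv g b c) x = mpd a (mpd b (gam g c)) x - mpd a (mpd c (gam g b)) x +
      ((mpd a (gam g b) x * gam g c x + gam g b x * mpd a (gam g c) x) -
        (mpd a (gam g c) x * gam g b x + gam g c x * mpd a (gam g b) x)) := by
    intro a b c
    have h : curv g b c = fun x => mpd b (gam g c) x - mpd c (gam g b) x +
      (gam g b x * gam g c x - gam g c x * gam g b x) := funext fun x => curv_eq g b c x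
    have sm := fun i => hg.smooth_gam i
    have smd := fun i k => (hg.smooth_gam i).mpd hg.isOpen k
    rw [h, mpd_add hg.isOpen hx ((smd _ _).sub (smd _ _)) (((sm _).mul (sm _)).sub ((sm _).mul (sm _))),
      mpd_sub hg.isOpen hx (smd _ _) (smd _ _),
      mpd_sub hg.isOpen hx ((sm _).mul (sm _)) ((sm _).mul (sm _)),
      mpd_mul hg.isOpen hx (sm _) (sm _), mpd_mul hg.isOpen hx (sm _) (sm _)]
  rw [hd, hd, hd]
  simp only [curv_eq]
  rw [mpd_comm hg.isOpen (hg.smooth_gam c) hx b a, mpd_comm hg.isOpen (hg.smooth_gam b) hx c a,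
    mpd_comm hg.isOpen (hg.smooth_gam a) hx c b]
  -- With the mixed second derivatives matched, the products of a derivative with `Γ` cancel, and
  -- the cubic terms are the Jacobi identity.
  noncomm_ring

end MetricOn

/-! ### Arrays with four indices -/

/-- The components of a `(0,4)`-tensor. -/
abbrev T4 (n : ℕ) : Type := Fin n → Fin n → Fin n → Fin n → ℝ

/-- Action of a matrix on the first index. -/
def slot₁ (A : Matrix (Fin n) (Fin n) ℝ) (T : T4 n) : T4 n := fun i j k l => ∑ p, A p i * T p j k l
/-- Action of a matrix on the second index. -/
def slot₂ (A : Matrix (Fin n) (Fin n) ℝ) (T : T4 n) : T4 n := fun i j k l => ∑ p, A p j * T i p k l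
/-- Action of a matrix on the third index. -/
def slot₃ (A : Matrix (Fin n) (Fin n) ℝ) (T : T4 n) : T4 n := fun i j k l => ∑ p, A p k * T i j p l
/-- Action of a matrix on the fourth index. -/
def slot₄ (A : Matrix (Fin n) (Fin n) ℝ) (T : T4 n) : T4 n := fun i j k l => ∑ p, A p l * T i j k p

/-- The infinitesimal action of a matrix on all four indices. -/
def rho (A : Matrix (Fin n) (Fin n) ℝ) (T : T4 n) : T4 n :=
  slot₁ A T + slot₂ A T + slot₃ A T + slot₄ A T

/-- The action of a matrix on all four indices. -/
def act (A : Matrix (Fin n) (Fin n) ℝ) (T : T4 n) : T4 n :=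
  slot₁ A (slot₂ A (slot₃ A (slot₄ A T)))

/-- The Euclidean pairing of two arrays. -/
def ip (T S : T4 n) : ℝ := ∑ i, ∑ j, ∑ k, ∑ l, T i j k l * S i j k l

section Slots

variable (A B : Matrix (Fin n) (Fin n) ℝ) (T S : T4 n)

lemma slot₁_add_mat : slot₁ (A + B) T = slot₁ A T + slot₁ B T := by
  ext; simp [slot₁, add_mul, Finset.sum_add_distrib]
lemma slot₂_add_mat : slot₂ (A + B) T = slot₂ A T + slot₂ B T := by
  ext; simp [slot₂, add_mul, Finset.sum_add_distrib]
lemma slot₃_add_mat : slot₃ (A + B) T = slot₃ A T + slot₃ B T := by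
  ext; simp [slot₃, add_mul, Finset.sum_add_distrib]
lemma slot₄_add_mat : slot₄ (A + B) T = slot₄ A T + slot₄ B T := by
  ext; simp [slot₄, add_mul, Finset.sum_add_distrib]

lemma slot₁_neg_mat : slot₁ (-A) T = -slot₁ A T := by ext; simp [slot₁]
lemma slot₂_neg_mat : slot₂ (-A) T = -slot₂ A T := by ext; simp [slot₂]
lemma slot₃_neg_mat : slot₃ (-A) T = -slot₃ A T := by ext; simp [slot₃]
lemma slot₄_neg_mat : slot₄ (-A) T = -slot₄ A T := by ext; simp [slot₄]

lemma slot₁_add : slot₁ A (T + S) = slot₁ A T + slot₁ A S := by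
  ext; simp [slot₁, mul_add, Finset.sum_add_distrib]
lemma slot₂_add : slot₂ A (T + S) = slot₂ A T + slot₂ A S := by
  ext; simp [slot₂, mul_add, Finset.sum_add_distrib]
lemma slot₃_add : slot₃ A (T + S) = slot₃ A T + slot₃ A S := by
  ext; simp [slot₃, mul_add, Finset.sum_add_distrib]
lemma slot₄_add : slot₄ A (T + S) = slot₄ A T + slot₄ A S := by
  ext; simp [slot₄, mul_add, Finset.sum_add_distrib]

lemma slot₁_neg : slot₁ A (-T) = -slot₁ A T := by ext; simp [slot₁]
lemma slot₂_neg : slot₂ A (-T) = -slot₂ A T := by ext; simp [slot₂]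
lemma slot₃_neg : slot₃ A (-T) = -slot₃ A T := by ext; simp [slot₃]
lemma slot₄_neg : slot₄ A (-T) = -slot₄ A T := by ext; simp [slot₄]

lemma slot₁_smul (c : ℝ) : slot₁ A (c • T) = c • slot₁ A T := by
  ext; simp [slot₁, Finset.mul_sum, mul_left_comm]
lemma slot₂_smul (c : ℝ) : slot₂ A (c • T) = c • slot₂ A T := by
  ext; simp [slot₂, Finset.mul_sum, mul_left_comm]
lemma slot₃_smul (c : ℝ) : slot₃ A (c • T) = c • slot₃ A T := by
  ext; simp [slot₃, Finset.mul_sum, mul_left_comm]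
lemma slot₄_smul (c : ℝ) : slot₄ A (c • T) = c • slot₄ A T := by
  ext; simp [slot₄, Finset.mul_sum, mul_left_comm]

lemma slot₁_slot₁ : slot₁ A (slot₁ B T) = slot₁ (B * A) T := by
  ext i j k l
  simp only [slot₁, Matrix.mul_apply, Finset.mul_sum, Finset.sum_mul]
  rw [Finset.sum_comm]
  exact Finset.sum_congr rfl fun _ _ => Finset.sum_congr rfl fun _ _ => by ring
lemma slot₂_slot₂ : slot₂ A (slot₂ B T) = slot₂ (B * A) T := by
  ext i j k l
  simp only [slot₂, Matrix.mul_apply, Finset.mul_sum, Finset.sum_mul]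
  rw [Finset.sum_comm]
  exact Finset.sum_congr rfl fun _ _ => Finset.sum_congr rfl fun _ _ => by ring
lemma slot₃_slot₃ : slot₃ A (slot₃ B T) = slot₃ (B * A) T := by
  ext i j k l
  simp only [slot₃, Matrix.mul_apply, Finset.mul_sum, Finset.sum_mul]
  rw [Finset.sum_comm]
  exact Finset.sum_congr rfl fun _ _ => Finset.sum_congr rfl fun _ _ => by ring
lemma slot₄_slot₄ : slot₄ A (slot₄ B T) = slot₄ (B * A) T := by
  ext i j k l
  simp only [slot₄, Matrix.mul_apply, Finset.mul_sum, Finset.sum_mul]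
  rw [Finset.sum_comm]
  exact Finset.sum_congr rfl fun _ _ => Finset.sum_congr rfl fun _ _ => by ring

lemma slot₂_slot₁ : slot₂ A (slot₁ B T) = slot₁ B (slot₂ A T) := by
  ext i j k l
  simp only [slot₁, slot₂, Finset.mul_sum]
  rw [Finset.sum_comm]
  exact Finset.sum_congr rfl fun _ _ => Finset.sum_congr rfl fun _ _ => by ring
lemma slot₃_slot₁ : slot₃ A (slot₁ B T) = slot₁ B (slot₃ A T) := by
  ext i j k l
  simp only [slot₁, slot₃, Finset.mul_sum]
  rw [Finset.sum_comm]
  exact Finset.sum_congr rfl fun _ _ => Finset.sum_congr rfl fun _ _ => by ring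
lemma slot₄_slot₁ : slot₄ A (slot₁ B T) = slot₁ B (slot₄ A T) := by
  ext i j k l
  simp only [slot₁, slot₄, Finset.mul_sum]
  rw [Finset.sum_comm]
  exact Finset.sum_congr rfl fun _ _ => Finset.sum_congr rfl fun _ _ => by ring
lemma slot₃_slot₂ : slot₃ A (slot₂ B T) = slot₂ B (slot₃ A T) := by
  ext i j k l
  simp only [slot₂, slot₃, Finset.mul_sum]
  rw [Finset.sum_comm]
  exact Finset.sum_congr rfl fun _ _ => Finset.sum_congr rfl fun _ _ => by ring
lemma slot₄_slot₂ : slot₄ A (slot₂ B T) = slot₂ B (slot₄ A T) := by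
  ext i j k l
  simp only [slot₂, slot₄, Finset.mul_sum]
  rw [Finset.sum_comm]
  exact Finset.sum_congr rfl fun _ _ => Finset.sum_congr rfl fun _ _ => by ring
lemma slot₄_slot₃ : slot₄ A (slot₃ B T) = slot₃ B (slot₄ A T) := by
  ext i j k l
  simp only [slot₃, slot₄, Finset.mul_sum]
  rw [Finset.sum_comm]
  exact Finset.sum_congr rfl fun _ _ => Finset.sum_congr rfl fun _ _ => by ring

lemma rho_add_mat : rho (A + B) T = rho A T + rho B T := by
  simp only [rho, slot₁_add_mat, slot₂_add_mat, slot₃_add_mat, slot₄_add_mat]; abel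

lemma rho_neg_mat : rho (-A) T = -rho A T := by
  simp only [rho, slot₁_neg_mat, slot₂_neg_mat, slot₃_neg_mat, slot₄_neg_mat]; abel

lemma rho_sub_mat : rho (A - B) T = rho A T - rho B T := by
  rw [sub_eq_add_neg, rho_add_mat, rho_neg_mat, sub_eq_add_neg]

lemma rho_add : rho A (T + S) = rho A T + rho A S := by
  simp only [rho, slot₁_add, slot₂_add, slot₃_add, slot₄_add]; abel

lemma rho_neg : rho A (-T) = -rho A T := by
  simp only [rho, slot₁_neg, slot₂_neg, slot₃_neg, slot₄_neg]; abel

lemma rho_sub : rho A (T - S) = rho A T - rho A S := by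
  rw [sub_eq_add_neg, rho_add, rho_neg, sub_eq_add_neg]

lemma rho_smul (c : ℝ) : rho A (c • T) = c • rho A T := by
  simp only [rho, slot₁_smul, slot₂_smul, slot₃_smul, slot₄_smul, smul_add]

/-- `rho` is an anti-homomorphism of Lie algebras. -/
lemma rho_commutator : rho A (rho B T) - rho B (rho A T) = rho (B * A - A * B) T := by
  rw [rho_sub_mat]
  simp only [rho, slot₁_add, slot₂_add, slot₃_add, slot₄_add, slot₂_slot₁, slot₃_slot₁,
    slot₄_slot₁, slot₃_slot₂, slot₄_slot₂, slot₄_slot₃, slot₁_slot₁, slot₂_slot₂, slot₃_slot₃,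
    slot₄_slot₄]
  abel

/-- `act` is a pullback of covariant tensors, so composition reverses the order. -/
lemma act_act : act A (act B T) = act (B * A) T := by
  simp only [act, slot₂_slot₁, slot₃_slot₁,
    slot₄_slot₁, slot₃_slot₂, slot₄_slot₂, slot₄_slot₃, slot₁_slot₁, slot₂_slot₂, slot₃_slot₃,
    slot₄_slot₄]

lemma act_one : act 1 T = T := by
  ext i j k l
  simp [act, slot₁, slot₂, slot₃, slot₄, Matrix.one_apply]

lemma act_add : act A (T + S) = act A T + act A S := by
  simp only [act, slot₁_add, slot₂_add, slot₃_add, slot₄_add]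

lemma act_neg : act A (-T) = -act A T := by
  simp only [act, slot₁_neg, slot₂_neg, slot₃_neg, slot₄_neg]

lemma act_smul (c : ℝ) : act A (c • T) = c • act A T := by
  simp only [act, slot₁_smul, slot₂_smul, slot₃_smul, slot₄_smul]

lemma act_zero : act A (0 : T4 n) = 0 := by
  simpa using act_smul A 0 0

lemma act_sum {ι : Type*} (s : Finset ι) (F : ι → T4 n) : act A (∑ a ∈ s, F a) = ∑ a ∈ s, act A (F a) := by
  classical
  induction s using Finset.induction_on with
  | empty => simp [act_zero]
  | insert a s ha ih => rw [Finset.sum_insert ha, Finset.sum_insert ha, act_add, ih]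

lemma ip_add_left (T' : T4 n) : ip (T + T') S = ip T S + ip T' S := by
  simp only [ip, Pi.add_apply, add_mul, Finset.sum_add_distrib]
lemma ip_add_right (S' : T4 n) : ip T (S + S') = ip T S + ip T S' := by
  simp only [ip, Pi.add_apply, mul_add, Finset.sum_add_distrib]
lemma ip_neg_left : ip (-T) S = - ip T S := by
  simp only [ip, Pi.neg_apply, neg_mul, Finset.sum_neg_distrib]
lemma ip_neg_right : ip T (-S) = - ip T S := by
  simp only [ip, Pi.neg_apply, mul_neg, Finset.sum_neg_distrib]
lemma ip_sub_left (T' : T4 n) : ip (T - T') S = ip T S - ip T' S := by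
  rw [sub_eq_add_neg, ip_add_left, ip_neg_left, sub_eq_add_neg]
lemma ip_sub_right (S' : T4 n) : ip T (S - S') = ip T S - ip T S' := by
  rw [sub_eq_add_neg, ip_add_right, ip_neg_right, sub_eq_add_neg]
lemma ip_smul_left (c : ℝ) : ip (c • T) S = c * ip T S := by
  simp only [ip, Pi.smul_apply, smul_eq_mul, Finset.mul_sum, mul_assoc]
lemma ip_smul_right (c : ℝ) : ip T (c • S) = c * ip T S := by
  simp only [ip, Pi.smul_apply, smul_eq_mul, Finset.mul_sum, mul_left_comm]
lemma ip_zero_left : ip (0 : T4 n) S = 0 := by simp [ip]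
lemma ip_zero_right : ip T (0 : T4 n) = 0 := by simp [ip]
lemma ip_sum_left {ι : Type*} (s : Finset ι) (F : ι → T4 n) : ip (∑ a ∈ s, F a) S = ∑ a ∈ s, ip (F a) S := by
  classical
  induction s using Finset.induction_on with
  | empty => simp [ip_zero_left]
  | insert a s ha ih => rw [Finset.sum_insert ha, Finset.sum_insert ha, ip_add_left, ih]
lemma ip_sum_right {ι : Type*} (s : Finset ι) (F : ι → T4 n) : ip T (∑ a ∈ s, F a) = ∑ a ∈ s, ip T (F a) := by
  classical
  induction s using Finset.induction_on with
  | empty => simp [ip_zero_right]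
  | insert a s ha ih => rw [Finset.sum_insert ha, Finset.sum_insert ha, ip_add_right, ih]
lemma ip_comm : ip T S = ip S T := by simp only [ip, mul_comm]
lemma ip_self_nonneg : 0 ≤ ip T T := by
  unfold ip
  exact Finset.sum_nonneg fun _ _ => Finset.sum_nonneg fun _ _ => Finset.sum_nonneg fun _ _ =>
    Finset.sum_nonneg fun _ _ => mul_self_nonneg _
lemma eq_zero_of_ip_self (h : ip T T = 0) : T = 0 := by
  ext i j k l
  unfold ip at h
  rw [Finset.sum_eq_zero_iff_of_nonneg (fun _ _ => Finset.sum_nonneg fun _ _ =>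
    Finset.sum_nonneg fun _ _ => Finset.sum_nonneg fun _ _ => mul_self_nonneg _)] at h
  have h := h i (Finset.mem_univ _)
  rw [Finset.sum_eq_zero_iff_of_nonneg (fun _ _ =>
    Finset.sum_nonneg fun _ _ => Finset.sum_nonneg fun _ _ => mul_self_nonneg _)] at h
  have h := h j (Finset.mem_univ _)
  rw [Finset.sum_eq_zero_iff_of_nonneg (fun _ _ => Finset.sum_nonneg fun _ _ => mul_self_nonneg _)] at h
  have h := h k (Finset.mem_univ _)
  rw [Finset.sum_eq_zero_iff_of_nonneg (fun _ _ => mul_self_nonneg _)] at h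
  simpa using h l (Finset.mem_univ _)

lemma sum_matrix_adjoint (t s : Fin n → ℝ) :
    ∑ i, (∑ p, A p i * t p) * s i = ∑ i, t i * ∑ p, A.transpose p i * s p := by
  simp only [Matrix.transpose_apply, Finset.sum_mul, Finset.mul_sum]
  rw [Finset.sum_comm]
  exact Finset.sum_congr rfl fun _ _ => Finset.sum_congr rfl fun _ _ => by ring

lemma ip_slot₄ : ip (slot₄ A T) S = ip T (slot₄ A.transpose S) := by
  unfold ip slot₄
  exact Finset.sum_congr rfl fun i _ => Finset.sum_congr rfl fun j _ =>
    Finset.sum_congr rfl fun k _ => sum_matrix_adjoint A (T i j k) (S i j k)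

lemma ip_slot₃ : ip (slot₃ A T) S = ip T (slot₃ A.transpose S) := by
  unfold ip slot₃
  refine Finset.sum_congr rfl fun i _ => Finset.sum_congr rfl fun j _ => ?_
  rw [Finset.sum_comm, Finset.sum_comm (f := fun k l => T i j k l * _)]
  exact Finset.sum_congr rfl fun l _ => sum_matrix_adjoint A (fun k => T i j k l) (fun k => S i j k l)

lemma ip_swap₁₃ : ip T S = ip (fun i j k l => T k j i l) (fun i j k l => S k j i l) := by
  unfold ip
  simp_rw [Finset.sum_comm (s := Finset.univ) (t := Finset.univ)
    (f := fun (a : Fin n) (b : Fin n) => ∑ l, T _ a b l * S _ a b l)]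
  rw [Finset.sum_comm]
  refine Finset.sum_congr rfl fun k _ => ?_
  rw [Finset.sum_comm]

lemma ip_swap₁₂ : ip T S = ip (fun i j k l => T j i k l) (fun i j k l => S j i k l) := by
  unfold ip
  rw [Finset.sum_comm]

lemma ip_swap₃₄ : ip T S = ip (fun i j k l => T i j l k) (fun i j k l => S i j l k) := by
  unfold ip
  refine Finset.sum_congr rfl fun i _ => Finset.sum_congr rfl fun j _ => ?_
  rw [Finset.sum_comm]

lemma ip_slot₁ : ip (slot₁ A T) S = ip T (slot₁ A.transpose S) := by
  rw [ip_swap₁₃, ip_swap₁₃ T]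
  exact ip_slot₃ A (fun i j k l => T k j i l) (fun i j k l => S k j i l)

lemma ip_slot₂ : ip (slot₂ A T) S = ip T (slot₂ A.transpose S) := by
  rw [ip_swap₁₂, ip_swap₁₂ T]
  exact ip_slot₁ A (fun i j k l => T j i k l) (fun i j k l => S j i k l)

lemma ip_rho : ip (rho A T) S = ip T (rho A.transpose S) := by
  simp only [rho, ip_add_left, ip_add_right, ip_slot₁, ip_slot₂, ip_slot₃, ip_slot₄]

lemma ip_act : ip (act A T) S = ip T (act A.transpose S) := by
  simp only [act, ip_slot₁, ip_slot₂, ip_slot₃, ip_slot₄]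
  simp only [slot₂_slot₁, slot₃_slot₁, slot₄_slot₁, slot₃_slot₂, slot₄_slot₂, slot₄_slot₃]

end Slots

/-! ### Contractions -/

/-- Contraction of the first with the third index. -/
def tr₁₃ (h : Matrix (Fin n) (Fin n) ℝ) (T : T4 n) : Matrix (Fin n) (Fin n) ℝ :=
  fun j l => ∑ i, ∑ k, h i k * T i j k l

/-- Contraction of a `(0,2)`-tensor. -/
def tr₂ (h : Matrix (Fin n) (Fin n) ℝ) (S : Matrix (Fin n) (Fin n) ℝ) : ℝ :=
  ∑ i, ∑ k, h i k * S i k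

section Traces

variable (h A : Matrix (Fin n) (Fin n) ℝ) (T : T4 n)

lemma tr₁₃_slot₁ : tr₁₃ h (slot₁ A T) = tr₁₃ (A * h) T := by
  ext j l
  simp only [tr₁₃, slot₁, Matrix.mul_apply, Finset.mul_sum, Finset.sum_mul]
  calc _ = ∑ i, ∑ p, ∑ k, h i k * (A p i * T p j k l) :=
        Finset.sum_congr rfl fun i _ => Finset.sum_comm
    _ = ∑ p, ∑ i, ∑ k, h i k * (A p i * T p j k l) := Finset.sum_comm
    _ = ∑ p, ∑ k, ∑ i, h i k * (A p i * T p j k l) :=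
        Finset.sum_congr rfl fun i _ => Finset.sum_comm
    _ = _ := Finset.sum_congr rfl fun _ _ => Finset.sum_congr rfl fun _ _ =>
        Finset.sum_congr rfl fun _ _ => by ring

lemma tr₁₃_slot₃ : tr₁₃ h (slot₃ A T) = tr₁₃ (h * A.transpose) T := by
  ext j l
  simp only [tr₁₃, slot₃, Matrix.mul_apply, Matrix.transpose_apply, Finset.mul_sum, Finset.sum_mul]
  refine Finset.sum_congr rfl fun i _ => ?_
  rw [Finset.sum_comm]
  exact Finset.sum_congr rfl fun _ _ => Finset.sum_congr rfl fun _ _ => by ring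

lemma tr₁₃_slot₂ : tr₁₃ h (slot₂ A T) = A.transpose * tr₁₃ h T := by
  ext j l
  simp only [tr₁₃, slot₂, Matrix.mul_apply, Matrix.transpose_apply, Finset.mul_sum]
  calc _ = ∑ i, ∑ p, ∑ k, h i k * (A p j * T i p k l) :=
        Finset.sum_congr rfl fun i _ => Finset.sum_comm
    _ = ∑ p, ∑ i, ∑ k, h i k * (A p j * T i p k l) := Finset.sum_comm
    _ = _ := Finset.sum_congr rfl fun _ _ => Finset.sum_congr rfl fun _ _ =>
        Finset.sum_congr rfl fun _ _ => by ring

lemma tr₁₃_slot₄ : tr₁₃ h (slot₄ A T) = tr₁₃ h T * A := by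
  ext j l
  simp only [tr₁₃, slot₄, Matrix.mul_apply, Finset.mul_sum, Finset.sum_mul]
  calc _ = ∑ i, ∑ p, ∑ k, h i k * (A p l * T i j k p) :=
        Finset.sum_congr rfl fun i _ => Finset.sum_comm
    _ = ∑ p, ∑ i, ∑ k, h i k * (A p l * T i j k p) := Finset.sum_comm
    _ = _ := Finset.sum_congr rfl fun _ _ => Finset.sum_congr rfl fun _ _ =>
        Finset.sum_congr rfl fun _ _ => by ring

lemma tr₁₃_add (T' : T4 n) : tr₁₃ h (T + T') = tr₁₃ h T + tr₁₃ h T' := by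
  ext; simp [tr₁₃, mul_add, Finset.sum_add_distrib]
lemma tr₁₃_sub (T' : T4 n) : tr₁₃ h (T - T') = tr₁₃ h T - tr₁₃ h T' := by
  ext; simp [tr₁₃, mul_sub, Finset.sum_sub_distrib]
lemma tr₁₃_add_mat (h' : Matrix (Fin n) (Fin n) ℝ) : tr₁₃ (h + h') T = tr₁₃ h T + tr₁₃ h' T := by
  ext; simp [tr₁₃, add_mul, Finset.sum_add_distrib]
lemma tr₁₃_neg_mat : tr₁₃ (-h) T = -tr₁₃ h T := by
  ext; simp [tr₁₃]

/-- The contracted slots move the matrix onto `h`. For a connection matrix and `h` the inverse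
metric, the new matrix is minus the derivative of `h`; this is why contraction commutes with
covariant differentiation. -/
lemma tr₁₃_rho : tr₁₃ h (rho A T) =
    tr₁₃ (A * h + h * A.transpose) T + (A.transpose * tr₁₃ h T + tr₁₃ h T * A) := by
  simp only [rho, tr₁₃_add, tr₁₃_slot₁, tr₁₃_slot₂, tr₁₃_slot₃, tr₁₃_slot₄, tr₁₃_add_mat]
  abel

/-- With `h = 1` and `A * A.transpose = g⁻¹` this carries the `g`-trace to the Euclidean trace in an
orthonormal frame; with `A` a Jacobian it makes the Ricci tensor natural. -/
lemma tr₁₃_act : tr₁₃ h (act A T) = A.transpose * tr₁₃ (A * h * A.transpose) T * A := by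
  simp only [act, tr₁₃_slot₁, tr₁₃_slot₂, tr₁₃_slot₃, tr₁₃_slot₄, Matrix.mul_assoc]

lemma tr₂_eq_trace (S : Matrix (Fin n) (Fin n) ℝ) : tr₂ h S = (h * S.transpose).trace := by
  simp only [tr₂, Matrix.trace, Matrix.diag, Matrix.mul_apply, Matrix.transpose_apply]

lemma kulkarniNomizu_rho (S R : Matrix (Fin n) (Fin n) ℝ) :
    rho A (kulkarniNomizu S R) = kulkarniNomizu (A.transpose * S + S * A) R +
      kulkarniNomizu S (A.transpose * R + R * A) := by
  ext i j k l
  rw [← sub_eq_zero]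
  simp only [rho, slot₁, slot₂, slot₃, slot₄, kulkarniNomizu, Matrix.mul_apply, Matrix.add_apply,
    Matrix.transpose_apply, Pi.add_apply]
  simp only [← Finset.sum_add_distrib, Finset.sum_mul, Finset.mul_sum, ← Finset.sum_sub_distrib]
  exact Finset.sum_eq_zero fun p _ => by ring

lemma kulkarniNomizu_slot_prod (S R : Matrix (Fin n) (Fin n) ℝ) :
    act A (fun i j k l => S i k * R j l) =
      fun i j k l => (A.transpose * S * A) i k * (A.transpose * R * A) j l := by
  have h1 : slot₄ A (fun i j k l => S i k * R j l) = fun i j k l => S i k * (R * A) j l := by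
    ext i j k l
    simp only [slot₄, Matrix.mul_apply, Finset.mul_sum]
    exact Finset.sum_congr rfl fun _ _ => by ring
  have h2 : ∀ S R : Matrix (Fin n) (Fin n) ℝ,
      slot₃ A (fun i j k l => S i k * R j l) = fun i j k l => (S * A) i k * R j l := by
    intro S R
    ext i j k l
    simp only [slot₃, Matrix.mul_apply, Finset.sum_mul]
    exact Finset.sum_congr rfl fun _ _ => by ring
  have h3 : ∀ S R : Matrix (Fin n) (Fin n) ℝ,
      slot₂ A (fun i j k l => S i k * R j l) = fun i j k l => S i k * (A.transpose * R) j l := by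
    intro S R
    ext i j k l
    simp only [slot₂, Matrix.mul_apply, Finset.mul_sum, Matrix.transpose_apply]
    exact Finset.sum_congr rfl fun _ _ => by ring
  have h4 : ∀ S R : Matrix (Fin n) (Fin n) ℝ,
      slot₁ A (fun i j k l => S i k * R j l) = fun i j k l => (A.transpose * S) i k * R j l := by
    intro S R
    ext i j k l
    simp only [slot₁, Matrix.mul_apply, Finset.sum_mul, Matrix.transpose_apply]
    exact Finset.sum_congr rfl fun _ _ => by ring
  rw [act, h1, h2, h3, h4]
  simp only [Matrix.mul_assoc]

end Traces

lemma act_swap₃₄ (A : Matrix (Fin n) (Fin n) ℝ) (T : T4 n) :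
    act A (fun i j k l => T i j l k) = fun i j k l => act A T i j l k := by
  have h1 : ∀ T : T4 n, slot₃ A (slot₄ A (fun i j k l => T i j l k)) =
      fun i j k l => slot₃ A (slot₄ A T) i j l k := by
    intro T
    rw [← slot₄_slot₃]
    rfl
  rw [act, h1]
  rfl

lemma kulkarniNomizu_act (A S R : Matrix (Fin n) (Fin n) ℝ) :
    act A (kulkarniNomizu S R) =
      kulkarniNomizu (A.transpose * S * A) (A.transpose * R * A) := by
  have h : ∀ S R : Matrix (Fin n) (Fin n) ℝ, kulkarniNomizu S R =
      (fun i j k l => S i k * R j l) + -(fun i j k l => S i l * R j k) +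
      (fun i j k l => R i k * S j l) + -(fun i j k l => R i l * S j k) := by
    intro S R
    ext i j k l
    simp only [kulkarniNomizu, Pi.add_apply, Pi.neg_apply]; ring
  rw [h, h]
  simp only [act_add, act_neg, kulkarniNomizu_slot_prod]
  rw [act_swap₃₄ A (fun i j k l => S i k * R j l), act_swap₃₄ A (fun i j k l => R i k * S j l)]
  simp only [kulkarniNomizu_slot_prod]

/-! ### Covariant derivatives of fields of arrays -/

/-- Smoothness of the components. -/
def Smooth4 (U : Set (Coord n)) (T : Coord n → T4 n) : Prop :=
  ∀ i j k l, ContDiffOn ℝ ∞ (fun y => T y i j k l) U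

/-- Componentwise partial derivative. -/
def pd (m : Fin n) (T : Coord n → T4 n) (x : Coord n) : T4 n :=
  fun i j k l => pderiv m (fun y => T y i j k l) x

/-- The covariant derivative of a field of `(0,4)`-tensors in the direction `∂ₘ`. -/
def cov (g : Coord n → Matrix (Fin n) (Fin n) ℝ) (m : Fin n) (T : Coord n → T4 n)
    (x : Coord n) : T4 n := pd m T x - rho (gam g m x) (T x)

/-- The covariant derivative of a field of `(0,2)`-tensors in the direction `∂ₘ`. -/
def cov₂ (g : Coord n → Matrix (Fin n) (Fin n) ℝ) (m : Fin n)
    (S : Coord n → Matrix (Fin n) (Fin n) ℝ) (x : Coord n) : Matrix (Fin n) (Fin n) ℝ :=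
  mpd m S x - ((gam g m x).transpose * S x + S x * gam g m x)

lemma covDeriv_eq_cov (g : Coord n → Matrix (Fin n) (Fin n) ℝ)
    (T : Fin n → Fin n → Fin n → Fin n → Coord n → ℝ) (m i j k l : Fin n) (x : Coord n) :
    covDeriv g T m i j k l x = cov g m (fun y i j k l => T i j k l y) x i j k l := by
  simp only [covDeriv, cov, pd, rho, slot₁, slot₂, slot₃, slot₄, gam, Pi.sub_apply, Pi.add_apply,
    Finset.sum_add_distrib]

section Fields

variable {U : Set (Coord n)} {x : Coord n} {T S : Coord n → T4 n}
  {A : Coord n → Matrix (Fin n) (Fin n) ℝ}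

lemma Smooth4.dAt (hT : Smooth4 U T) (hU : IsOpen U) (hx : x ∈ U) (i j k l : Fin n) :
    DifferentiableAt ℝ (fun y => T y i j k l) x := diffAt_of_smooth (hT i j k l) hU hx

lemma Smooth4.add (hT : Smooth4 U T) (hS : Smooth4 U S) : Smooth4 U (fun y => T y + S y) :=
  fun i j k l => (hT i j k l).add (hS i j k l)
lemma Smooth4.sub (hT : Smooth4 U T) (hS : Smooth4 U S) : Smooth4 U (fun y => T y - S y) :=
  fun i j k l => (hT i j k l).sub (hS i j k l)
lemma Smooth4.pd (hU : IsOpen U) (hT : Smooth4 U T) (m : Fin n) : Smooth4 U (pd m T) :=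
  fun i j k l => contDiffOn_pderiv hU (hT i j k l) m

lemma Smooth4.slot₁ (hA : SmoothM U A) (hT : Smooth4 U T) : Smooth4 U (fun y => slot₁ (A y) (T y)) :=
  fun _ _ _ _ => ContDiffOn.sum fun _ _ => (hA _ _).mul (hT _ _ _ _)
lemma Smooth4.slot₂ (hA : SmoothM U A) (hT : Smooth4 U T) : Smooth4 U (fun y => slot₂ (A y) (T y)) :=
  fun _ _ _ _ => ContDiffOn.sum fun _ _ => (hA _ _).mul (hT _ _ _ _)
lemma Smooth4.slot₃ (hA : SmoothM U A) (hT : Smooth4 U T) : Smooth4 U (fun y => slot₃ (A y) (T y)) :=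
  fun _ _ _ _ => ContDiffOn.sum fun _ _ => (hA _ _).mul (hT _ _ _ _)
lemma Smooth4.slot₄ (hA : SmoothM U A) (hT : Smooth4 U T) : Smooth4 U (fun y => slot₄ (A y) (T y)) :=
  fun _ _ _ _ => ContDiffOn.sum fun _ _ => (hA _ _).mul (hT _ _ _ _)

lemma Smooth4.rho (hA : SmoothM U A) (hT : Smooth4 U T) : Smooth4 U (fun y => rho (A y) (T y)) :=
  (((hT.slot₁ hA).add (hT.slot₂ hA)).add (hT.slot₃ hA)).add (hT.slot₄ hA)

lemma Smooth4.act (hA : SmoothM U A) (hT : Smooth4 U T) : Smooth4 U (fun y => act (A y) (T y)) :=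
  (((hT.slot₄ hA).slot₃ hA).slot₂ hA).slot₁ hA

lemma contDiffOn_ip (hT : Smooth4 U T) (hS : Smooth4 U S) :
    ContDiffOn ℝ ∞ (fun y => ip (T y) (S y)) U :=
  ContDiffOn.sum fun _ _ => ContDiffOn.sum fun _ _ => ContDiffOn.sum fun _ _ =>
    ContDiffOn.sum fun _ _ => (hT _ _ _ _).mul (hS _ _ _ _)

lemma pd_add (hU : IsOpen U) (hx : x ∈ U) (hT : Smooth4 U T) (hS : Smooth4 U S) (m : Fin n) :
    pd m (fun y => T y + S y) x = pd m T x + pd m S x := by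
  ext i j k l
  exact pderiv_add m (hT.dAt hU hx i j k l) (hS.dAt hU hx i j k l)

lemma pd_sub (hU : IsOpen U) (hx : x ∈ U) (hT : Smooth4 U T) (hS : Smooth4 U S) (m : Fin n) :
    pd m (fun y => T y - S y) x = pd m T x - pd m S x := by
  ext i j k l
  exact pderiv_sub m (hT.dAt hU hx i j k l) (hS.dAt hU hx i j k l)

lemma pd_congr (hU : IsOpen U) (hx : x ∈ U) (h : Set.EqOn T S U) (m : Fin n) :
    pd m T x = pd m S x := by
  ext i j k l
  exact pderiv_congr hU hx (fun y hy => by simp [h hy]) m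

lemma pd_comm (hU : IsOpen U) (hx : x ∈ U) (hT : Smooth4 U T) (a b : Fin n) :
    pd a (pd b T) x = pd b (pd a T) x := by
  ext i j k l
  exact pderiv_comm hU (hT i j k l) hx a b

lemma pderiv_sum_mul {ι : Type*} [Fintype ι] (m : Fin n) {a t : ι → Coord n → ℝ}
    (ha : ∀ p, DifferentiableAt ℝ (a p) x) (ht : ∀ p, DifferentiableAt ℝ (t p) x) :
    pderiv m (fun y => ∑ p, a p y * t p y) x =
      ∑ p, pderiv m (a p) x * t p x + ∑ p, a p x * pderiv m (t p) x := by
  rw [pderiv_sum _ _ fun p _ => (ha p).fun_mul (ht p), ← Finset.sum_add_distrib]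
  exact Finset.sum_congr rfl fun p _ => pderiv_mul m (ha p) (ht p)

lemma pd_slot₁ (hU : IsOpen U) (hx : x ∈ U) (hA : SmoothM U A) (hT : Smooth4 U T) (m : Fin n) :
    pd m (fun y => slot₁ (A y) (T y)) x = slot₁ (mpd m A x) (T x) + slot₁ (A x) (pd m T x) := by
  ext i j k l
  exact pderiv_sum_mul m (fun p => hA.dAt hU hx p i) (fun p => hT.dAt hU hx p j k l)
lemma pd_slot₂ (hU : IsOpen U) (hx : x ∈ U) (hA : SmoothM U A) (hT : Smooth4 U T) (m : Fin n) :
    pd m (fun y => slot₂ (A y) (T y)) x = slot₂ (mpd m A x) (T x) + slot₂ (A x) (pd m T x) := by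
  ext i j k l
  exact pderiv_sum_mul m (fun p => hA.dAt hU hx p j) (fun p => hT.dAt hU hx i p k l)
lemma pd_slot₃ (hU : IsOpen U) (hx : x ∈ U) (hA : SmoothM U A) (hT : Smooth4 U T) (m : Fin n) :
    pd m (fun y => slot₃ (A y) (T y)) x = slot₃ (mpd m A x) (T x) + slot₃ (A x) (pd m T x) := by
  ext i j k l
  exact pderiv_sum_mul m (fun p => hA.dAt hU hx p k) (fun p => hT.dAt hU hx i j p l)
lemma pd_slot₄ (hU : IsOpen U) (hx : x ∈ U) (hA : SmoothM U A) (hT : Smooth4 U T) (m : Fin n) :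
    pd m (fun y => slot₄ (A y) (T y)) x = slot₄ (mpd m A x) (T x) + slot₄ (A x) (pd m T x) := by
  ext i j k l
  exact pderiv_sum_mul m (fun p => hA.dAt hU hx p l) (fun p => hT.dAt hU hx i j k p)

lemma pd_rho (hU : IsOpen U) (hx : x ∈ U) (hA : SmoothM U A) (hT : Smooth4 U T) (m : Fin n) :
    pd m (fun y => rho (A y) (T y)) x = rho (mpd m A x) (T x) + rho (A x) (pd m T x) := by
  have h1 := hT.slot₁ hA
  have h2 := hT.slot₂ hA
  have h3 := hT.slot₃ hA
  have h4 := hT.slot₄ hA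
  have : (fun y => rho (A y) (T y)) = fun y => slot₁ (A y) (T y) + slot₂ (A y) (T y) +
    slot₃ (A y) (T y) + slot₄ (A y) (T y) := rfl
  rw [this, pd_add hU hx ((h1.add h2).add h3) h4, pd_add hU hx (h1.add h2) h3,
    pd_add hU hx h1 h2, pd_slot₁ hU hx hA hT, pd_slot₂ hU hx hA hT, pd_slot₃ hU hx hA hT,
    pd_slot₄ hU hx hA hT]
  simp only [rho]; abel

lemma pderiv_ip (hU : IsOpen U) (hx : x ∈ U) (hT : Smooth4 U T) (hS : Smooth4 U S) (m : Fin n) :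
    pderiv m (fun y => ip (T y) (S y)) x = ip (pd m T x) (S x) + ip (T x) (pd m S x) := by
  have hd : ∀ i j k l, DifferentiableAt ℝ (fun y => T y i j k l * S y i j k l) x :=
    fun i j k l => (hT.dAt hU hx i j k l).fun_mul (hS.dAt hU hx i j k l)
  have hd1 : ∀ i j k, DifferentiableAt ℝ (fun y => ∑ l, T y i j k l * S y i j k l) x :=
    fun i j k => DifferentiableAt.fun_sum fun l _ => hd i j k l
  have hd2 : ∀ i j, DifferentiableAt ℝ (fun y => ∑ k, ∑ l, T y i j k l * S y i j k l) x :=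
    fun i j => DifferentiableAt.fun_sum fun k _ => hd1 i j k
  have hd3 : ∀ i, DifferentiableAt ℝ (fun y => ∑ j, ∑ k, ∑ l, T y i j k l * S y i j k l) x :=
    fun i => DifferentiableAt.fun_sum fun j _ => hd2 i j
  unfold ip
  rw [pderiv_sum _ _ fun i _ => hd3 i, ← Finset.sum_add_distrib]
  refine Finset.sum_congr rfl fun i _ => ?_
  rw [pderiv_sum _ _ fun j _ => hd2 i j, ← Finset.sum_add_distrib]
  refine Finset.sum_congr rfl fun j _ => ?_
  rw [pderiv_sum _ _ fun k _ => hd1 i j k, ← Finset.sum_add_distrib]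
  refine Finset.sum_congr rfl fun k _ => ?_
  exact pderiv_sum_mul m (fun l => hT.dAt hU hx i j k l) (fun l => hS.dAt hU hx i j k l)

lemma mpd_tr₁₃ (hU : IsOpen U) (hx : x ∈ U) (hA : SmoothM U A) (hT : Smooth4 U T) (m : Fin n) :
    mpd m (fun y => tr₁₃ (A y) (T y)) x = tr₁₃ (mpd m A x) (T x) + tr₁₃ (A x) (pd m T x) := by
  ext j l
  simp only [mpd_apply, tr₁₃, Matrix.add_apply]
  rw [pderiv_sum _ _ fun i _ => DifferentiableAt.fun_sum fun k _ =>
    (hA.dAt hU hx i k).fun_mul (hT.dAt hU hx i j k l), ← Finset.sum_add_distrib]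
  exact Finset.sum_congr rfl fun i _ =>
    pderiv_sum_mul m (fun k => hA.dAt hU hx i k) (fun k => hT.dAt hU hx i j k l)

lemma pderiv_tr₂ (hU : IsOpen U) (hx : x ∈ U) {S : Coord n → Matrix (Fin n) (Fin n) ℝ}
    (hA : SmoothM U A) (hS : SmoothM U S) (m : Fin n) :
    pderiv m (fun y => tr₂ (A y) (S y)) x = tr₂ (mpd m A x) (S x) + tr₂ (A x) (mpd m S x) := by
  simp only [tr₂]
  rw [pderiv_sum _ _ fun i _ => DifferentiableAt.fun_sum fun k _ =>
    (hA.dAt hU hx i k).fun_mul (hS.dAt hU hx i k), ← Finset.sum_add_distrib]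
  exact Finset.sum_congr rfl fun i _ =>
    pderiv_sum_mul m (fun k => hA.dAt hU hx i k) (fun k => hS.dAt hU hx i k)

lemma Smooth4.kulkarniNomizu {S R : Coord n → Matrix (Fin n) (Fin n) ℝ} (hS : SmoothM U S)
    (hR : SmoothM U R) : Smooth4 U (fun y => kulkarniNomizu (S y) (R y)) := fun i j k l =>
  ((((hS i k).mul (hR j l)).sub ((hS i l).mul (hR j k))).add ((hS j l).mul (hR i k))).sub
    ((hS j k).mul (hR i l))

lemma pd_kulkarniNomizu (hU : IsOpen U) (hx : x ∈ U) {S R : Coord n → Matrix (Fin n) (Fin n) ℝ}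
    (hS : SmoothM U S) (hR : SmoothM U R) (m : Fin n) :
    pd m (fun y => kulkarniNomizu (S y) (R y)) x =
      kulkarniNomizu (mpd m S x) (R x) + kulkarniNomizu (S x) (mpd m R x) := by
  ext i j k l
  have dS := fun i j => hS.dAt hU hx i j
  have dR := fun i j => hR.dAt hU hx i j
  have dm := fun i j k l => (dS i j).fun_mul (dR k l)
  simp only [pd, kulkarniNomizu, Pi.add_apply, mpd_apply]
  rw [pderiv_sub m (((dm i k j l).fun_sub (dm i l j k)).fun_add (dm j l i k)) (dm j k i l),
    pderiv_add m ((dm i k j l).fun_sub (dm i l j k)) (dm j l i k),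
    pderiv_sub m (dm i k j l) (dm i l j k), pderiv_mul m (dS _ _) (dR _ _),
    pderiv_mul m (dS _ _) (dR _ _), pderiv_mul m (dS _ _) (dR _ _), pderiv_mul m (dS _ _) (dR _ _)]
  ring

end Fields

/-! ### Leibniz rules and the Ricci identity for the Levi-Civita connection. -/

namespace MetricOn

variable {g : Coord n → Matrix (Fin n) (Fin n) ℝ} {U : Set (Coord n)} {x : Coord n}
  {T S : Coord n → T4 n}

lemma smooth_cov (hg : MetricOn g U) (hT : Smooth4 U T) (m : Fin n) : Smooth4 U (cov g m T) :=
  (hT.pd hg.isOpen m).sub (hT.rho (hg.smooth_gam m))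

lemma cov_sub (hg : MetricOn g U) (hx : x ∈ U) (hT : Smooth4 U T) (hS : Smooth4 U S) (m : Fin n) :
    cov g m (fun y => T y - S y) x = cov g m T x - cov g m S x := by
  simp only [cov, pd_sub hg.isOpen hx hT hS, rho_sub]; abel

/-- The Leibniz rule for the Kulkarni–Nomizu product with the metric. -/
lemma cov_kulkarniNomizu (hg : MetricOn g U) (hx : x ∈ U)
    {S : Coord n → Matrix (Fin n) (Fin n) ℝ} (hS : SmoothM U S) (m : Fin n) :
    cov g m (fun y => kulkarniNomizu (g y) (S y)) x = kulkarniNomizu (g x) (cov₂ g m S x) := by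
  rw [cov, pd_kulkarniNomizu hg.isOpen hx hg.smooth hS, kulkarniNomizu_rho, hg.compat hx, cov₂]
  ext i j k l
  simp only [Pi.add_apply, Pi.sub_apply, kulkarniNomizu, Matrix.sub_apply]
  ring

/-- Covariant differentiation commutes with contraction. -/
lemma cov₂_tr₁₃ (hg : MetricOn g U) (hx : x ∈ U) (hT : Smooth4 U T) (m : Fin n) :
    cov₂ g m (fun y => tr₁₃ (g y)⁻¹ (T y)) x = tr₁₃ (g x)⁻¹ (cov g m T x) := by
  rw [cov₂, mpd_tr₁₃ hg.isOpen hx hg.smooth_inv hT, cov, tr₁₃_sub, tr₁₃_rho, hg.mpd_inv_eq hx,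
    tr₁₃_neg_mat]
  abel

/-- The two terms of `∂g⁻¹` cancel the two Christoffel corrections of `cov₂` under the trace, by its
cyclicity. -/
lemma pderiv_tr₂_inv (hg : MetricOn g U) (hx : x ∈ U) {S : Coord n → Matrix (Fin n) (Fin n) ℝ}
    (hS : SmoothM U S) (m : Fin n) :
    pderiv m (fun y => tr₂ (g y)⁻¹ (S y)) x = tr₂ (g x)⁻¹ (cov₂ g m S x) := by
  rw [pderiv_tr₂ hg.isOpen hx hg.smooth_inv hS, hg.mpd_inv_eq hx, cov₂]
  simp only [tr₂_eq_trace, Matrix.transpose_sub, Matrix.transpose_add, Matrix.transpose_mul,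
    Matrix.transpose_transpose, mul_sub, mul_add, neg_mul, add_mul, Matrix.trace_sub,
    Matrix.trace_add, Matrix.trace_neg]
  rw [← Matrix.mul_assoc _ (S x).transpose, Matrix.trace_mul_comm (_ * _) (gam g m x)]
  simp only [Matrix.mul_assoc]
  ring

/-- The covariant derivative of the pairing of two tensors. -/
lemma pderiv_ip_act (hg : MetricOn g U) (hx : x ∈ U) (hT : Smooth4 U T) (hS : Smooth4 U S)
    (m : Fin n) :
    pderiv m (fun y => ip (T y) (act (g y)⁻¹ (S y))) x =
      ip (cov g m T x) (act (g x)⁻¹ (S x)) + ip (T x) (act (g x)⁻¹ (cov g m S x)) := by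
  have hi := hg.smooth_inv
  -- Raised indices are contravariant, so the connection acts on them through minus its transpose;
  -- by `ip_rho` this is absorbed by the correction term of the other factor.
  have key : pd m (fun y => act (g y)⁻¹ (S y)) x =
      act (g x)⁻¹ (cov g m S x) - rho (gam g m x).transpose (act (g x)⁻¹ (S x)) := by
    have : (fun y => act (g y)⁻¹ (S y)) =
      fun y => slot₁ (g y)⁻¹ (slot₂ (g y)⁻¹ (slot₃ (g y)⁻¹ (slot₄ (g y)⁻¹ (S y)))) := rfl
    rw [this, pd_slot₁ hg.isOpen hx hi (((hS.slot₄ hi).slot₃ hi).slot₂ hi),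
      pd_slot₂ hg.isOpen hx hi ((hS.slot₄ hi).slot₃ hi), pd_slot₃ hg.isOpen hx hi (hS.slot₄ hi),
      pd_slot₄ hg.isOpen hx hi hS, hg.mpd_inv_eq hx]
    simp only [act, cov, rho, sub_eq_add_neg, slot₁_add, slot₂_add, slot₃_add, slot₄_add,
      slot₁_neg, slot₂_neg, slot₃_neg, slot₄_neg, slot₁_neg_mat, slot₂_neg_mat, slot₃_neg_mat,
      slot₄_neg_mat, slot₁_add_mat, slot₂_add_mat, slot₃_add_mat, slot₄_add_mat, slot₂_slot₁,
      slot₃_slot₁, slot₄_slot₁, slot₃_slot₂, slot₄_slot₂, slot₄_slot₃, slot₁_slot₁, slot₂_slot₂,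
      slot₃_slot₃, slot₄_slot₄]
    abel
  rw [pderiv_ip hg.isOpen hx hT (hS.act hi), key, ip_sub_right,
    show cov g m T x = pd m T x - rho (gam g m x) (T x) from rfl, ip_sub_left, ip_rho]
  ring

/-- The Ricci identity. -/
lemma cov_comm (hg : MetricOn g U) (hx : x ∈ U) (hT : Smooth4 U T) (a b : Fin n) :
    cov g a (cov g b T) x - cov g b (cov g a T) x = - rho (curv g a b x) (T x) := by
  -- In this expansion everything except the `∂Γ` term and the double `rho` is symmetric in `a, b`;
  -- antisymmetrising leaves `dΓ` and a commutator, that is, the curvature.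
  have h : ∀ a b, cov g a (cov g b T) x = pd a (pd b T) x -
      (rho (mpd a (gam g b) x) (T x) + rho (gam g b x) (pd a T x)) -
      (rho (gam g a x) (pd b T x) - rho (gam g a x) (rho (gam g b x) (T x))) := by
    intro a b
    have : cov g b T = fun y => pd b T y - rho (gam g b y) (T y) := rfl
    rw [cov, this, pd_sub hg.isOpen hx (hT.pd hg.isOpen b) (hT.rho (hg.smooth_gam b)),
      pd_rho hg.isOpen hx (hg.smooth_gam b) hT, rho_sub]
  rw [h, h, pd_comm hg.isOpen hx hT a b, curv_eq, rho_add_mat, rho_sub_mat, ← rho_commutator]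
  abel

end MetricOn

/-! ### The Weyl tensor -/

/-- The curvature tensor as a field of arrays. -/
def riemF (g : Coord n → Matrix (Fin n) (Fin n) ℝ) (x : Coord n) : T4 n :=
  fun i j k l => riemann g i j k l x

/-- The Weyl tensor as a field of arrays. -/
def weylF (g : Coord n → Matrix (Fin n) (Fin n) ℝ) (x : Coord n) : T4 n :=
  fun i j k l => weyl g i j k l x

/-- Half the normalised scalar curvature, the trace of the Schouten tensor. -/
def schoutenTrace (g : Coord n → Matrix (Fin n) (Fin n) ℝ) (x : Coord n) : ℝ :=
  (1 / (2 * ((n : ℝ) - 1))) * scal g x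

/-- The Schouten tensor. -/
def schouten (g : Coord n → Matrix (Fin n) (Fin n) ℝ) (x : Coord n) :
    Matrix (Fin n) (Fin n) ℝ :=
  (1 / ((n : ℝ) - 2)) • (ricci g x - schoutenTrace g x • g x)

lemma ricci_eq_tr₁₃ (g : Coord n → Matrix (Fin n) (Fin n) ℝ) (x : Coord n) :
    ricci g x = tr₁₃ (g x)⁻¹ (riemF g x) := rfl

lemma scal_eq_tr₂ (g : Coord n → Matrix (Fin n) (Fin n) ℝ) (x : Coord n) :
    scal g x = tr₂ (g x)⁻¹ (ricci g x) := rfl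

/-- The scalar part and the trace-free Ricci part are both products with `g` and add up to a single
one. In this form the Schouten tensor alone accounts for the difference between `∇W` and `∇Rm`. -/
lemma weylF_eq (hn : 4 ≤ n) (g : Coord n → Matrix (Fin n) (Fin n) ℝ) (x : Coord n) :
    weylF g x = riemF g x - kulkarniNomizu (g x) (schouten g x) := by
  have h4 : (4 : ℝ) ≤ n := by exact_mod_cast hn
  have h0 : (n : ℝ) ≠ 0 := by positivity
  have h1 : (n : ℝ) - 1 ≠ 0 := by linarith
  have h2 : (n : ℝ) - 2 ≠ 0 := by linarith
  ext i j k l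
  simp only [weylF, weyl, riemF, Pi.sub_apply, kulkarniNomizu, schouten, schoutenTrace, ricciZero,
    Matrix.smul_apply, Matrix.sub_apply, smul_eq_mul]
  field_simp
  ring

lemma ricci_eq_schouten (hn : 4 ≤ n) (g : Coord n → Matrix (Fin n) (Fin n) ℝ) (x : Coord n) :
    ricci g x = ((n : ℝ) - 2) • schouten g x + schoutenTrace g x • g x := by
  have h4 : (4 : ℝ) ≤ n := by exact_mod_cast hn
  have h2 : (n : ℝ) - 2 ≠ 0 := by linarith
  rw [schouten, smul_smul, mul_one_div_cancel h2, one_smul, sub_add_cancel]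

section Permutations

variable (g : Coord n → Matrix (Fin n) (Fin n) ℝ) (m : Fin n) (T : Coord n → T4 n) (x : Coord n)
  (i j k l : Fin n)

/-- `cov` treats all slots alike and so commutes with permuting them; permutation symmetries of a
field thus pass to its covariant derivative. -/
lemma cov_swap₁₂ : cov g m (fun y i j k l => T y j i k l) x i j k l = cov g m T x j i k l := by
  simp only [cov, pd, rho, slot₁, slot₂, slot₃, slot₄, Pi.sub_apply, Pi.add_apply]; ring

lemma cov_swap₃₄ : cov g m (fun y i j k l => T y i j l k) x i j k l = cov g m T x i j l k := by
  simp only [cov, pd, rho, slot₁, slot₂, slot₃, slot₄, Pi.sub_apply, Pi.add_apply]; ring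

lemma cov_pair : cov g m (fun y i j k l => T y k l i j) x i j k l = cov g m T x k l i j := by
  simp only [cov, pd, rho, slot₁, slot₂, slot₃, slot₄, Pi.sub_apply, Pi.add_apply]; ring

lemma cov_neg : cov g m (fun y => - T y) x = - cov g m T x := by
  have : pd m (fun y => - T y) x = - pd m T x := by
    ext i j k l; exact pderiv_neg m
  rw [cov, cov, this, rho_neg]; abel

end Permutations

/-- The symmetries of an algebraic curvature tensor. -/
structure IsCurvatureLike (T : T4 n) : Prop where
  swap₁ : ∀ i j k l, T i j k l = - T j i k l
  swap₂ : ∀ i j k l, T i j k l = - T i j l k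
  pair : ∀ i j k l, T i j k l = T k l i j
  cyclic : ∀ i j k l, T i j k l + T j l k i + T l i k j = 0

lemma IsCurvatureLike.sub {T S : T4 n} (hT : IsCurvatureLike T) (hS : IsCurvatureLike S) :
    IsCurvatureLike (T - S) where
  swap₁ i j k l := by simp only [Pi.sub_apply]; linarith [hT.swap₁ i j k l, hS.swap₁ i j k l]
  swap₂ i j k l := by simp only [Pi.sub_apply]; linarith [hT.swap₂ i j k l, hS.swap₂ i j k l]
  pair i j k l := by simp only [Pi.sub_apply]; linarith [hT.pair i j k l, hS.pair i j k l]
  cyclic i j k l := by simp only [Pi.sub_apply]; linarith [hT.cyclic i j k l, hS.cyclic i j k l]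

lemma isCurvatureLike_kulkarniNomizu {S R : Matrix (Fin n) (Fin n) ℝ} (hS : ∀ i j, S i j = S j i)
    (hR : ∀ i j, R i j = R j i) : IsCurvatureLike (kulkarniNomizu S R) where
  swap₁ i j k l := by simp only [kulkarniNomizu]; ring
  swap₂ i j k l := by simp only [kulkarniNomizu]; ring
  pair i j k l := by
    simp only [kulkarniNomizu, hS k i, hS k j, hS l i, hS l j, hR k i, hR k j, hR l i, hR l j]; ring
  cyclic i j k l := by
    simp only [kulkarniNomizu, hS l i, hS l j, hS j i, hR l i, hR l j, hR j i]; ring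

/-! ### Bianchi identities, the Cotton tensor and the divergence of the Weyl tensor. -/

namespace MetricOn

variable {g : Coord n → Matrix (Fin n) (Fin n) ℝ} {U : Set (Coord n)} {x : Coord n}
  {T S : Coord n → T4 n}

lemma smooth_riemF (hg : MetricOn g U) : Smooth4 U (riemF g) := hg.smooth_riemann

lemma smooth_schoutenTrace (hg : MetricOn g U) : ContDiffOn ℝ ∞ (schoutenTrace g) U :=
  contDiffOn_const.mul hg.smooth_scal

lemma smooth_schouten (hg : MetricOn g U) : SmoothM U (schouten g) :=
  SmoothM.smul contDiffOn_const (hg.smooth_ricci.sub (SmoothM.smul hg.smooth_schoutenTrace hg.smooth))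

lemma smooth_weylF (hn : 4 ≤ n) (hg : MetricOn g U) : Smooth4 U (weylF g) := by
  rw [show weylF g = _ from funext fun x => weylF_eq hn g x]
  exact hg.smooth_riemF.sub (Smooth4.kulkarniNomizu hg.smooth hg.smooth_schouten)

lemma schouten_symm (hg : MetricOn g U) (hx : x ∈ U) (i j : Fin n) :
    schouten g x i j = schouten g x j i := by
  simp only [schouten, Matrix.smul_apply, Matrix.sub_apply, hg.ricci_symm hx i j, hg.symm hx i j]

lemma isCurvatureLike_riemF (hg : MetricOn g U) (hx : x ∈ U) : IsCurvatureLike (riemF g x) where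
  swap₁ := riemann_swap₁
  swap₂ := hg.riemann_swap₂ hx
  pair := hg.riemann_pair hx
  cyclic := hg.riemann_cyclic hx

lemma isCurvatureLike_weylF (hn : 4 ≤ n) (hg : MetricOn g U) (hx : x ∈ U) :
    IsCurvatureLike (weylF g x) := by
  rw [weylF_eq hn]
  exact (hg.isCurvatureLike_riemF hx).sub
    (isCurvatureLike_kulkarniNomizu (hg.symm hx) (hg.schouten_symm hx))

lemma cov_congr (hg : MetricOn g U) (hx : x ∈ U) (h : Set.EqOn T S U) (m : Fin n) :
    cov g m T x = cov g m S x := by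
  rw [cov, cov, pd_congr hg.isOpen hx h, h hx]

lemma cov_antisymm₁₂ (hg : MetricOn g U) (hx : x ∈ U)
    (h : ∀ y ∈ U, ∀ i j k l, T y i j k l = - T y j i k l) (m i j k l : Fin n) :
    cov g m T x i j k l = - cov g m T x j i k l := by
  conv_lhs => rw [hg.cov_congr hx (S := fun y => - (fun i j k l => T y j i k l))
    (fun y hy => by ext i j k l; exact h y hy i j k l), cov_neg, Pi.neg_apply, Pi.neg_apply,
    Pi.neg_apply, Pi.neg_apply, cov_swap₁₂]

lemma cov_antisymm₃₄ (hg : MetricOn g U) (hx : x ∈ U)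
    (h : ∀ y ∈ U, ∀ i j k l, T y i j k l = - T y i j l k) (m i j k l : Fin n) :
    cov g m T x i j k l = - cov g m T x i j l k := by
  conv_lhs => rw [hg.cov_congr hx (S := fun y => - (fun i j k l => T y i j l k))
    (fun y hy => by ext i j k l; exact h y hy i j k l), cov_neg, Pi.neg_apply, Pi.neg_apply,
    Pi.neg_apply, Pi.neg_apply, cov_swap₃₄]

lemma cov_pair_symm (hg : MetricOn g U) (hx : x ∈ U)
    (h : ∀ y ∈ U, ∀ i j k l, T y i j k l = T y k l i j) (m i j k l : Fin n) :
    cov g m T x i j k l = cov g m T x k l i j := by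
  conv_lhs => rw [hg.cov_congr hx (S := fun y => (fun i j k l => T y k l i j))
    (fun y hy => by ext i j k l; exact h y hy i j k l), cov_pair]

lemma cov₂_symm (hg : MetricOn g U) (hx : x ∈ U) {S : Coord n → Matrix (Fin n) (Fin n) ℝ}
    (h : ∀ y ∈ U, ∀ i j, S y i j = S y j i) (m i j : Fin n) :
    cov₂ g m S x i j = cov₂ g m S x j i := by
  have hS : (S x).transpose = S x := by ext a b; exact h x hx b a
  have h1 : ((gam g m x).transpose * S x + S x * gam g m x).transpose =
      (gam g m x).transpose * S x + S x * gam g m x := by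
    simp only [Matrix.transpose_add, Matrix.transpose_mul, Matrix.transpose_transpose, hS]
    abel
  have h2 : mpd m S x i j = mpd m S x j i :=
    pderiv_congr hg.isOpen hx (fun y hy => h y hy i j) m
  rw [cov₂, Matrix.sub_apply, Matrix.sub_apply, h2]
  congr 1
  conv_lhs => rw [← h1]
  rfl

/-- Separates the covariant derivative of the endomorphism `R(∂_b, ∂_c)`, to which `curv_bianchi`
applies, from the corrections in the first two slots, which cancel in the cyclic sum because `Γ` is
symmetric and `R` is skew. -/
lemma cov_riemF (hg : MetricOn g U) (hx : x ∈ U) (a b c k l : Fin n) :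
    cov g a (riemF g) x b c k l = (g x * (mpd a (curv g b c) x +
      (gam g a x * curv g b c x - curv g b c x * gam g a x))) k l -
      ∑ p, (christoffel g p a b x * riemann g p c k l x +
        christoffel g p a c x * riemann g b p k l x) := by
  have h1 : pd a (riemF g) x b c k l = mpd a (fun y => g y * curv g b c y) x k l := rfl
  have h3 : slot₃ (gam g a x) (riemF g x) b c k l =
      ((gam g a x).transpose * g x * curv g b c x) k l := by
    rw [Matrix.mul_assoc, Matrix.mul_apply]; rfl
  have h4 : slot₄ (gam g a x) (riemF g x) b c k l = (g x * curv g b c x * gam g a x) k l := by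
    rw [Matrix.mul_apply]
    exact Finset.sum_congr rfl fun p _ => mul_comm _ _
  have h12 : slot₁ (gam g a x) (riemF g x) b c k l + slot₂ (gam g a x) (riemF g x) b c k l =
      ∑ p, (christoffel g p a b x * riemann g p c k l x +
        christoffel g p a c x * riemann g b p k l x) := by
    rw [Finset.sum_add_distrib]; rfl
  have h5 : (g x * (mpd a (curv g b c) x +
      (gam g a x * curv g b c x - curv g b c x * gam g a x))) =
      mpd a (fun y => g y * curv g b c y) x - (gam g a x).transpose * g x * curv g b c x -
      g x * curv g b c x * gam g a x := by
    rw [mpd_mul hg.isOpen hx hg.smooth (hg.smooth_curv b c), hg.compat hx]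
    noncomm_ring
  rw [h5, ← h12]
  simp only [cov, rho, Pi.sub_apply, Pi.add_apply, Matrix.sub_apply, h1, h3, h4]
  ring

/-- The differential Bianchi identity. -/
lemma riemF_bianchi (hg : MetricOn g U) (hx : x ∈ U) (a b c k l : Fin n) :
    cov g a (riemF g) x b c k l + cov g b (riemF g) x c a k l + cov g c (riemF g) x a b k l = 0 := by
  have h := congrFun (congrFun (congrArg (fun M : Matrix (Fin n) (Fin n) ℝ => g x * M)
    (hg.curv_bianchi hx a b c)) k) l
  rw [Matrix.mul_add, Matrix.mul_add, Matrix.mul_zero, Matrix.add_apply, Matrix.add_apply,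
    Matrix.zero_apply] at h
  rw [hg.cov_riemF hx, hg.cov_riemF hx, hg.cov_riemF hx]
  have h2 : ∑ p, (christoffel g p a b x * riemann g p c k l x +
        christoffel g p a c x * riemann g b p k l x) + ∑ p, (christoffel g p b c x * riemann g p a k l x +
        christoffel g p b a x * riemann g c p k l x) + ∑ p, (christoffel g p c a x * riemann g p b k l x +
        christoffel g p c b x * riemann g a p k l x) = 0 := by
    rw [← Finset.sum_add_distrib, ← Finset.sum_add_distrib]
    refine Finset.sum_eq_zero fun p _ => ?_
    rw [hg.christoffel_symm hx p b a, hg.christoffel_symm hx p c a, hg.christoffel_symm hx p c b,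
      riemann_swap₁ c p, riemann_swap₁ b p, riemann_swap₁ a p]
    ring
  linarith

lemma contract_left (hg : MetricOn g U) (hx : x ∈ U) (X : Fin n → ℝ) (k : Fin n) :
    ∑ m, ∑ i, (g x)⁻¹ m i * (g x i k * X m) = X k := by
  have h : ∀ m, ∑ i, (g x)⁻¹ m i * (g x i k * X m) = if m = k then X m else 0 := by
    intro m
    have := congrFun (congrFun (hg.inv_mul hx) m) k
    rw [Matrix.mul_apply, Matrix.one_apply] at this
    simp only [← mul_assoc, ← Finset.sum_mul, this]
    split_ifs <;> simp
  simp [h]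

lemma contract_left' (hg : MetricOn g U) (hx : x ∈ U) (X : Fin n → ℝ) (k : Fin n) :
    ∑ m, ∑ i, (g x)⁻¹ m i * (g x m k * X i) = X k := by
  rw [Finset.sum_comm, ← hg.contract_left hx X k]
  exact Finset.sum_congr rfl fun _ _ => Finset.sum_congr rfl fun _ _ => by rw [hg.inv_symm hx]

lemma tr₂_metric (hg : MetricOn g U) (hx : x ∈ U) : tr₂ (g x)⁻¹ (g x) = n := by
  rw [tr₂_eq_trace, hg.transpose hx, hg.inv_mul hx]; simp

/-- The trace of `g` gives `n • S`, each of the two mixed terms contracts `g⁻¹` with `g` and removes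
one copy of `S`, and the last term gives the trace of `S`. -/
lemma tr₁₃_kulkarniNomizu (hg : MetricOn g U) (hx : x ∈ U) {S : Matrix (Fin n) (Fin n) ℝ} :
    tr₁₃ (g x)⁻¹ (kulkarniNomizu (g x) S) = ((n : ℝ) - 2) • S + tr₂ (g x)⁻¹ S • g x := by
  ext j l
  have e1 := hg.tr₂_metric hx
  have e2 := hg.contract_left' hx (fun k => S j k) l
  have e3 := hg.contract_left hx (fun i => S i l) j
  have h : tr₁₃ (g x)⁻¹ (kulkarniNomizu (g x) S) j l = tr₂ (g x)⁻¹ (g x) * S j l -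
      ∑ i, ∑ k, (g x)⁻¹ i k * (g x i l * S j k) + g x j l * tr₂ (g x)⁻¹ S -
      ∑ i, ∑ k, (g x)⁻¹ i k * (g x k j * S i l) := by
    simp only [tr₁₃, tr₂, kulkarniNomizu, Finset.sum_mul, Finset.mul_sum,
      ← Finset.sum_add_distrib, ← Finset.sum_sub_distrib]
    refine Finset.sum_congr rfl fun i _ => Finset.sum_congr rfl fun k _ => ?_
    rw [hg.symm hx j k]; ring
  rw [h, e1, e2, e3]
  simp only [Matrix.add_apply, Matrix.smul_apply, smul_eq_mul]
  ring

lemma tr₂_schouten (hn : 4 ≤ n) (hg : MetricOn g U) (hx : x ∈ U) :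
    tr₂ (g x)⁻¹ (schouten g x) = schoutenTrace g x := by
  have h4 : (4 : ℝ) ≤ n := by exact_mod_cast hn
  have h1 : (n : ℝ) - 1 ≠ 0 := by linarith
  have h2 : (n : ℝ) - 2 ≠ 0 := by linarith
  have h : tr₂ (g x)⁻¹ (schouten g x) =
      (1 / ((n : ℝ) - 2)) * (scal g x - schoutenTrace g x * tr₂ (g x)⁻¹ (g x)) := by
    rw [scal_eq_tr₂]
    simp only [tr₂, schouten, Matrix.smul_apply, Matrix.sub_apply, smul_eq_mul, Finset.mul_sum,
      ← Finset.sum_sub_distrib]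
    exact Finset.sum_congr rfl fun i _ => Finset.sum_congr rfl fun k _ => by ring
  rw [h, hg.tr₂_metric hx, schoutenTrace]
  field_simp
  ring

/-- The Schouten tensor is normalised exactly so that contracting `g ∧ P` returns the Ricci tensor.
-/
lemma tr₁₃_weylF (hn : 4 ≤ n) (hg : MetricOn g U) (hx : x ∈ U) :
    tr₁₃ (g x)⁻¹ (weylF g x) = 0 := by
  rw [weylF_eq hn, tr₁₃_sub, hg.tr₁₃_kulkarniNomizu hx, ← ricci_eq_tr₁₃, hg.tr₂_schouten hn hx,
    ← ricci_eq_schouten hn, sub_self]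

lemma cov₂_ricci (hn : 4 ≤ n) (hg : MetricOn g U) (hx : x ∈ U) (m : Fin n) :
    cov₂ g m (ricci g) x =
      ((n : ℝ) - 2) • cov₂ g m (schouten g) x + pderiv m (schoutenTrace g) x • g x := by
  have h : ricci g = fun y => ((n : ℝ) - 2) • schouten g y + schoutenTrace g y • g y :=
    funext fun y => ricci_eq_schouten hn g y
  have sm1 : SmoothM U (fun y => ((n : ℝ) - 2) • schouten g y) :=
    SmoothM.smul contDiffOn_const hg.smooth_schouten
  have sm2 : SmoothM U (fun y => schoutenTrace g y • g y) :=
    SmoothM.smul hg.smooth_schoutenTrace hg.smooth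
  rw [h, cov₂, mpd_add hg.isOpen hx sm1 sm2,
    mpd_smul hg.isOpen hx contDiffOn_const hg.smooth_schouten, pderiv_const,
    mpd_smul hg.isOpen hx hg.smooth_schoutenTrace hg.smooth, hg.compat hx, cov₂]
  simp only [mul_add, add_mul, Matrix.mul_smul, Matrix.smul_mul, smul_sub, smul_add, zero_smul,
    zero_add]
  abel

/-- After the pair symmetry the derivative index `m` sits next to `k, l`, and the second Bianchi
identity in these three leaves two contractions of `∇R`, which are derivatives of the Ricci tensor.
-/
lemma contracted_bianchi (hg : MetricOn g U) (hx : x ∈ U) (j k l : Fin n) :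
    ∑ m, ∑ i, (g x)⁻¹ m i * cov g m (riemF g) x i j k l =
      cov₂ g k (ricci g) x l j - cov₂ g l (ricci g) x k j := by
  have hR : ricci g = fun y => tr₁₃ (g y)⁻¹ (riemF g y) := rfl
  rw [hR, hg.cov₂_tr₁₃ hx hg.smooth_riemF, hg.cov₂_tr₁₃ hx hg.smooth_riemF]
  simp only [tr₁₃, ← Finset.sum_sub_distrib]
  refine Finset.sum_congr rfl fun m _ => Finset.sum_congr rfl fun i _ => ?_
  have h1 := hg.cov_pair_symm hx (T := riemF g) (fun y hy => hg.riemann_pair hy) m i j k l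
  have h2 := hg.riemF_bianchi hx m k l i j
  have h3 := hg.cov_antisymm₁₂ hx (T := riemF g) (fun y hy => riemann_swap₁) k l m i j
  rw [h1, ← mul_sub]
  congr 1
  linarith

/-- Contract `contracted_bianchi` again: the left side becomes the divergence of the Ricci tensor,
the right side `d scal` minus the same divergence. Hence the factor `2`. -/
lemma divergence_ricci (hg : MetricOn g U) (hx : x ∈ U) (k : Fin n) :
    2 * ∑ m, ∑ i, (g x)⁻¹ m i * cov₂ g m (ricci g) x i k = pderiv k (scal g) x := by
  have hs : pderiv k (scal g) x = tr₂ (g x)⁻¹ (cov₂ g k (ricci g) x) :=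
    hg.pderiv_tr₂_inv hx hg.smooth_ricci k
  have hc := fun j l => hg.contracted_bianchi hx j k l
  have h1 : ∑ j, ∑ l, (g x)⁻¹ j l * ∑ m, ∑ i, (g x)⁻¹ m i * cov g m (riemF g) x i j k l =
      ∑ m, ∑ i, (g x)⁻¹ m i * cov₂ g m (ricci g) x i k := by
    have hR : ricci g = fun y => tr₁₃ (g y)⁻¹ (riemF g y) := rfl
    have h2 : ∀ m i, cov₂ g m (ricci g) x i k =
        ∑ j, ∑ l, (g x)⁻¹ j l * cov g m (riemF g) x i j k l := by
      intro m i
      rw [hR, hg.cov₂_tr₁₃ hx hg.smooth_riemF]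
      refine Finset.sum_congr rfl fun a _ => Finset.sum_congr rfl fun b _ => ?_
      rw [hg.cov_antisymm₁₂ hx (T := riemF g) (fun y hy => riemann_swap₁) m a i b k,
        hg.cov_antisymm₃₄ hx (T := riemF g) (fun y hy => hg.riemann_swap₂ hy) m i a b k, neg_neg]
    simp only [h2, Finset.mul_sum]
    calc _ = ∑ j, ∑ m, ∑ l, ∑ i, (g x)⁻¹ j l * ((g x)⁻¹ m i * cov g m (riemF g) x i j k l) :=
          Finset.sum_congr rfl fun _ _ => Finset.sum_comm
      _ = ∑ m, ∑ j, ∑ l, ∑ i, (g x)⁻¹ j l * ((g x)⁻¹ m i * cov g m (riemF g) x i j k l) :=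
          Finset.sum_comm
      _ = ∑ m, ∑ j, ∑ i, ∑ l, (g x)⁻¹ j l * ((g x)⁻¹ m i * cov g m (riemF g) x i j k l) :=
          Finset.sum_congr rfl fun _ _ => Finset.sum_congr rfl fun _ _ => Finset.sum_comm
      _ = ∑ m, ∑ i, ∑ j, ∑ l, (g x)⁻¹ j l * ((g x)⁻¹ m i * cov g m (riemF g) x i j k l) :=
          Finset.sum_congr rfl fun _ _ => Finset.sum_comm
      _ = _ := Finset.sum_congr rfl fun _ _ => Finset.sum_congr rfl fun _ _ =>
          Finset.sum_congr rfl fun _ _ => Finset.sum_congr rfl fun _ _ => by ring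
  simp only [hc, mul_sub, Finset.sum_sub_distrib] at h1
  have h3 : ∑ j, ∑ l, (g x)⁻¹ j l * cov₂ g k (ricci g) x l j = tr₂ (g x)⁻¹ (cov₂ g k (ricci g) x) := by
    rw [tr₂]
    refine Finset.sum_congr rfl fun a _ => Finset.sum_congr rfl fun b _ => ?_
    rw [hg.cov₂_symm hx (fun y hy => hg.ricci_symm hy)]
  have h4 : ∑ j, ∑ l, (g x)⁻¹ j l * cov₂ g l (ricci g) x k j =
      ∑ m, ∑ i, (g x)⁻¹ m i * cov₂ g m (ricci g) x i k := by
    rw [Finset.sum_comm]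
    refine Finset.sum_congr rfl fun a _ => Finset.sum_congr rfl fun b _ => ?_
    rw [hg.inv_symm hx, hg.cov₂_symm hx (fun y hy => hg.ricci_symm hy)]
  rw [h3, h4] at h1
  rw [hs]; linarith

/-- Insert `Ric = (n-2) P + (tr P) g` and `scal = 2(n-1) tr P` into `divergence_ricci`; the factor
`n - 2` divides out. -/
lemma divergence_schouten (hn : 4 ≤ n) (hg : MetricOn g U) (hx : x ∈ U) (k : Fin n) :
    ∑ m, ∑ i, (g x)⁻¹ m i * cov₂ g m (schouten g) x i k = pderiv k (schoutenTrace g) x := by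
  have h4 : (4 : ℝ) ≤ n := by exact_mod_cast hn
  have h1 : (n : ℝ) - 1 ≠ 0 := by linarith
  have h2 : (n : ℝ) - 2 ≠ 0 := by linarith
  have h := hg.divergence_ricci hx k
  have hJ : pderiv k (schoutenTrace g) x = (1 / (2 * ((n : ℝ) - 1))) * pderiv k (scal g) x :=
    pderiv_const_mul k _ (diffAt_of_smooth hg.smooth_scal hg.isOpen hx)
  simp only [hg.cov₂_ricci hn hx, Matrix.add_apply, Matrix.smul_apply, smul_eq_mul, mul_add,
    Finset.sum_add_distrib] at h
  have e1 : ∑ m, ∑ i, (g x)⁻¹ m i * (((n : ℝ) - 2) * cov₂ g m (schouten g) x i k) =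
      ((n : ℝ) - 2) * ∑ m, ∑ i, (g x)⁻¹ m i * cov₂ g m (schouten g) x i k := by
    simp only [Finset.mul_sum]
    exact Finset.sum_congr rfl fun _ _ => Finset.sum_congr rfl fun _ _ => by ring
  have e2 : ∑ m, ∑ i, (g x)⁻¹ m i * (pderiv m (schoutenTrace g) x * g x i k) =
      pderiv k (schoutenTrace g) x := by
    rw [← hg.contract_left hx (fun m => pderiv m (schoutenTrace g) x) k]
    exact Finset.sum_congr rfl fun _ _ => Finset.sum_congr rfl fun _ _ => by ring
  have e3 : pderiv k (scal g) x = 2 * ((n : ℝ) - 1) * pderiv k (schoutenTrace g) x := by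
    rw [hJ]; field_simp
  rw [e1, e2, e3] at h
  have : ((n : ℝ) - 2) * ((∑ m, ∑ i, (g x)⁻¹ m i * cov₂ g m (schouten g) x i k) -
      pderiv k (schoutenTrace g) x) = 0 := by linarith
  rcases mul_eq_zero.1 this with h' | h'
  · exact absurd h' h2
  · linarith

lemma cov_weylF (hn : 4 ≤ n) (hg : MetricOn g U) (hx : x ∈ U) (m : Fin n) :
    cov g m (weylF g) x =
      cov g m (riemF g) x - kulkarniNomizu (g x) (cov₂ g m (schouten g) x) := by
  rw [show weylF g = _ from funext fun x => weylF_eq hn g x,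
    hg.cov_sub hx hg.smooth_riemF (Smooth4.kulkarniNomizu hg.smooth hg.smooth_schouten),
    hg.cov_kulkarniNomizu hx hg.smooth_schouten]

/-- The divergence of the Weyl tensor is a multiple of the Cotton tensor. -/
lemma divergence_weylF (hn : 4 ≤ n) (hg : MetricOn g U) (hx : x ∈ U) (j k l : Fin n) :
    ∑ m, ∑ i, (g x)⁻¹ m i * cov g m (weylF g) x i j k l =
      ((n : ℝ) - 3) * (cov₂ g k (schouten g) x l j - cov₂ g l (schouten g) x k j) := by
  have hs := hg.cov₂_symm hx (fun y hy => hg.schouten_symm hy)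
  have h1 := hg.contracted_bianchi hx j k l
  simp only [hg.cov₂_ricci hn hx, Matrix.add_apply, Matrix.smul_apply, smul_eq_mul] at h1
  have e1 := hg.contract_left hx (fun m => cov₂ g m (schouten g) x j l) k
  have e2 := hg.contract_left hx (fun m => cov₂ g m (schouten g) x j k) l
  have e3 := hg.divergence_schouten hn hx k
  have e4 := hg.divergence_schouten hn hx l
  have h : ∑ m, ∑ i, (g x)⁻¹ m i * cov g m (weylF g) x i j k l =
      (∑ m, ∑ i, (g x)⁻¹ m i * cov g m (riemF g) x i j k l) -
      ((∑ m, ∑ i, (g x)⁻¹ m i * (g x i k * cov₂ g m (schouten g) x j l)) -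
      (∑ m, ∑ i, (g x)⁻¹ m i * (g x i l * cov₂ g m (schouten g) x j k)) +
      g x j l * (∑ m, ∑ i, (g x)⁻¹ m i * cov₂ g m (schouten g) x i k) -
      g x j k * (∑ m, ∑ i, (g x)⁻¹ m i * cov₂ g m (schouten g) x i l)) := by
    simp only [hg.cov_weylF hn hx, Pi.sub_apply, kulkarniNomizu, Finset.mul_sum,
      ← Finset.sum_add_distrib, ← Finset.sum_sub_distrib]
    exact Finset.sum_congr rfl fun _ _ => Finset.sum_congr rfl fun _ _ => by ring
  -- The Ricci terms bring the Cotton tensor with weight `n - 2`, the product with `g` takes away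
  -- one copy, and the trace terms cancel by `divergence_schouten`.
  rw [h, h1, e1, e2, e3, e4, hs k j l, hs l j k, hg.symm hx l j, hg.symm hx k j]
  ring

lemma divergence_eq (j k l : Fin n) :
    divergence g (weyl g) j k l x = - ∑ m, ∑ i, (g x)⁻¹ m i * cov g m (weylF g) x i j k l := by
  simp only [divergence, covDeriv_eq_cov]; rfl

/-- The bound on the dimension enters here: the factor `n - 3` is nonzero. -/
lemma cotton_eq_zero (hn : 4 ≤ n) (hg : MetricOn g U) (hx : x ∈ U)
    (hdiv : ∀ j k l, divergence g (weyl g) j k l x = 0) (j k l : Fin n) :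
    cov₂ g k (schouten g) x l j = cov₂ g l (schouten g) x k j := by
  have h4 : (4 : ℝ) ≤ n := by exact_mod_cast hn
  have h := hdiv j k l
  rw [divergence_eq, hg.divergence_weylF hn hx, neg_eq_zero, mul_eq_zero] at h
  rcases h with h | h <;> linarith

/-- A divergence-free Weyl tensor satisfies the differential Bianchi identity. -/
lemma weylF_bianchi (hn : 4 ≤ n) (hg : MetricOn g U) (hx : x ∈ U)
    (hdiv : ∀ j k l, divergence g (weyl g) j k l x = 0) (a b c k l : Fin n) :
    cov g a (weylF g) x b c k l + cov g b (weylF g) x c a k l + cov g c (weylF g) x a b k l = 0 := by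
  have h := hg.riemF_bianchi hx a b c k l
  have hc := fun j k l => hg.cotton_eq_zero hn hx hdiv j k l
  have hs := hg.cov₂_symm hx (fun y hy => hg.schouten_symm hy)
  simp only [hg.cov_weylF hn hx, Pi.sub_apply, kulkarniNomizu]
  -- With `∇P` symmetric in its first two indices, the terms `g ∧ ∇P` cancel in the cyclic sum, and
  -- the Bianchi identity of `Rm` passes to `W`.
  rw [hc l a c, hc k a c, hc l a b, hc k a b, hc l b c, hc k b c]
  linear_combination h

end MetricOn

/-! ### The Bochner formula for the Weyl tensor -/

/-- The second covariant derivative `∇²_{∂ₐ,∂ₘ} T`. -/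
def hess (g : Coord n → Matrix (Fin n) (Fin n) ℝ) (a m : Fin n) (T : Coord n → T4 n)
    (x : Coord n) : T4 n :=
  cov g a (cov g m T) x - ∑ p, christoffel g p a m x • cov g p T x

/-- The Laplace–Beltrami operator on functions. -/
def laplacian (g : Coord n → Matrix (Fin n) (Fin n) ℝ) (u : Coord n → ℝ) (x : Coord n) : ℝ :=
  ∑ a, ∑ m, (g x)⁻¹ a m * (pderiv a (pderiv m u) x - ∑ p, christoffel g p a m x * pderiv p u x)

/-- The squared norm `|W|²` of the Weyl tensor. -/
def weylNormSq (g : Coord n → Matrix (Fin n) (Fin n) ℝ) (x : Coord n) : ℝ :=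
  ip (weylF g x) (act (g x)⁻¹ (weylF g x))

/-- The squared norm `|∇W|²`. -/
def covWeylNormSq (g : Coord n → Matrix (Fin n) (Fin n) ℝ) (x : Coord n) : ℝ :=
  ∑ a, ∑ m, (g x)⁻¹ a m * ip (cov g m (weylF g) x) (act (g x)⁻¹ (cov g a (weylF g) x))

/-- The contraction `∑ₐ (R(eₐ,∂ᵢ)W)(eₐ,∂ⱼ,∂ₖ,∂ₗ)`, where `h` is the inverse metric. -/
def curvTerm (h : Matrix (Fin n) (Fin n) ℝ) (R W : T4 n) : T4 n :=
  fun i j k l => ∑ a, ∑ m, h a m * rho (h * Matrix.of (R a i)) W m j k l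

/-! ### Second covariant derivatives and the Laplacian of `|W|²`. -/

namespace MetricOn

variable {g : Coord n → Matrix (Fin n) (Fin n) ℝ} {U : Set (Coord n)} {x : Coord n}
  {T S : Coord n → T4 n}

lemma curv_eq_inv_mul (hg : MetricOn g U) (hx : x ∈ U) (i j : Fin n) :
    curv g i j x = (g x)⁻¹ * Matrix.of (riemF g x i j) := by
  have : Matrix.of (riemF g x i j) = g x * curv g i j x := rfl
  rw [this, ← Matrix.mul_assoc, hg.inv_mul hx, one_mul]

lemma ip_act_comm (hg : MetricOn g U) (hx : x ∈ U) (A B : T4 n) :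
    ip A (act (g x)⁻¹ B) = ip B (act (g x)⁻¹ A) := by
  rw [ip_comm, ip_act, hg.inv_transpose hx]

/-- The connection is torsion-free, so the Christoffel correction in `hess` is symmetric and the
Ricci identity survives unchanged. -/
lemma hess_comm (hg : MetricOn g U) (hx : x ∈ U) (hT : Smooth4 U T) (a m : Fin n) :
    hess g a m T x - hess g m a T x = - rho (curv g a m x) (T x) := by
  rw [← hg.cov_comm hx hT]
  simp only [hess, hg.christoffel_symm hx _ m a]
  abel

lemma contDiffOn_weylNormSq (hn : 4 ≤ n) (hg : MetricOn g U) :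
    ContDiffOn ℝ ∞ (weylNormSq g) U :=
  contDiffOn_ip (hg.smooth_weylF hn) ((hg.smooth_weylF hn).act hg.smooth_inv)

lemma pderiv_weylNormSq (hn : 4 ≤ n) (hg : MetricOn g U) (hx : x ∈ U) (m : Fin n) :
    pderiv m (weylNormSq g) x = 2 * ip (cov g m (weylF g) x) (act (g x)⁻¹ (weylF g x)) := by
  rw [show weylNormSq g = fun y => ip (weylF g y) (act (g y)⁻¹ (weylF g y)) from rfl,
    hg.pderiv_ip_act hx (hg.smooth_weylF hn) (hg.smooth_weylF hn),
    hg.ip_act_comm hx (weylF g x)]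
  ring

/-- Since `∇g = 0`, each derivative of the pairing falls on one of its two arguments; the
first-order part of the Laplacian is what completes the iterated `cov` to `hess`. -/
lemma laplacian_weylNormSq (hn : 4 ≤ n) (hg : MetricOn g U) (hx : x ∈ U) :
    laplacian g (weylNormSq g) x = 2 * covWeylNormSq g x +
      2 * ip (∑ a, ∑ m, (g x)⁻¹ a m • hess g a m (weylF g) x) (act (g x)⁻¹ (weylF g x)) := by
  have hW := hg.smooth_weylF hn
  have h2 : ∀ a m, pderiv a (pderiv m (weylNormSq g)) x =
      2 * (ip (cov g a (cov g m (weylF g)) x) (act (g x)⁻¹ (weylF g x)) +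
        ip (cov g m (weylF g) x) (act (g x)⁻¹ (cov g a (weylF g) x))) := by
    intro a m
    rw [pderiv_congr hg.isOpen hx (fun y hy => hg.pderiv_weylNormSq hn hy m),
      pderiv_const_mul a 2 (diffAt_of_smooth (contDiffOn_ip (hg.smooth_cov hW m)
        (hW.act hg.smooth_inv)) hg.isOpen hx),
      hg.pderiv_ip_act hx (hg.smooth_cov hW m) hW]
  simp only [laplacian, covWeylNormSq, h2, hg.pderiv_weylNormSq hn hx, ip_sum_left, ip_smul_left,
    hess, ip_sub_left, Finset.mul_sum, ← Finset.sum_add_distrib]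
  refine Finset.sum_congr rfl fun a _ => Finset.sum_congr rfl fun m _ => ?_
  have : ∑ p, christoffel g p a m x * (2 * ip (cov g p (weylF g) x) (act (g x)⁻¹ (weylF g x))) =
      2 * ∑ p, christoffel g p a m x * ip (cov g p (weylF g) x) (act (g x)⁻¹ (weylF g x)) := by
    rw [Finset.mul_sum]; exact Finset.sum_congr rfl fun p _ => by ring
  rw [this]; ring

/-- The index `m` is corrected along with the four tensor slots: `hess` is the covariant derivative
of the five-index tensor `∇T`, so linear identities for `∇T` can be differentiated. -/
lemma hess_apply (a m : Fin n) (i j k l : Fin n) : hess g a m T x i j k l =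
    pderiv a (fun y => cov g m T y i j k l) x - ∑ p, (christoffel g p a m x * cov g p T x i j k l +
      christoffel g p a i x * cov g m T x p j k l + christoffel g p a j x * cov g m T x i p k l +
      christoffel g p a k x * cov g m T x i j p l + christoffel g p a l x * cov g m T x i j k p) := by
  simp only [hess, cov, Pi.sub_apply, Finset.sum_apply, Pi.smul_apply, smul_eq_mul,
    Finset.sum_add_distrib]
  simp only [rho, slot₁, slot₂, slot₃, slot₄, Pi.add_apply, pd, cov, Pi.sub_apply, gam]
  ring

lemma hess_antisymm₁₂ (hg : MetricOn g U) (hx : x ∈ U)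
    (h : ∀ y ∈ U, ∀ i j k l, T y i j k l = - T y j i k l) (a m i j k l : Fin n) :
    hess g a m T x i j k l = - hess g a m T x j i k l := by
  have h1 := fun y (hy : y ∈ U) m => hg.cov_antisymm₁₂ hy h m
  have h2 := hg.cov_antisymm₁₂ hx (T := cov g m T) (fun y hy => h1 y hy m) a i j k l
  simp only [hess, Pi.sub_apply, Finset.sum_apply, Pi.smul_apply, smul_eq_mul, h2,
    h1 x hx _ i j k l, mul_neg, Finset.sum_neg_distrib]
  ring

/-- The partial derivatives cancel because `hb` holds throughout `U`, and every Christoffel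
correction is again a Bianchi sum, with one index replaced by `p`. -/
lemma hess_bianchi (hg : MetricOn g U) (hT : Smooth4 U T)
    (hb : ∀ y ∈ U, ∀ a b c k l,
      cov g a T y b c k l + cov g b T y c a k l + cov g c T y a b k l = 0)
    (hx : x ∈ U) (a m i j k l : Fin n) :
    hess g a m T x i j k l + hess g a i T x j m k l + hess g a j T x m i k l = 0 := by
  have dA := fun m i j k l => (hg.smooth_cov hT m).dAt hg.isOpen hx i j k l
  have h0 : pderiv a (fun y => cov g m T y i j k l) x + pderiv a (fun y => cov g i T y j m k l) x +
      pderiv a (fun y => cov g j T y m i k l) x = 0 := by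
    rw [← pderiv_add a (dA _ _ _ _ _) (dA _ _ _ _ _),
      ← pderiv_add a ((dA _ _ _ _ _).fun_add (dA _ _ _ _ _)) (dA _ _ _ _ _),
      pderiv_congr hg.isOpen hx (f₂ := fun _ => 0) (fun y hy => hb y hy m i j k l), pderiv_const]
  simp only [hess_apply]
  have h1 : ∀ p q r : ℝ, p + q + r = 0 →
      pderiv a (fun y => cov g m T y i j k l) x - p +
      (pderiv a (fun y => cov g i T y j m k l) x - q) +
      (pderiv a (fun y => cov g j T y m i k l) x - r) = 0 := fun p q r h => by linarith
  apply h1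
  rw [← Finset.sum_add_distrib, ← Finset.sum_add_distrib]
  refine Finset.sum_eq_zero fun p _ => ?_
  linear_combination christoffel g p a m x * hb x hx p i j k l +
    christoffel g p a i x * hb x hx m p j k l + christoffel g p a j x * hb x hx m i p k l +
    christoffel g p a k x * hb x hx m i j p l + christoffel g p a l x * hb x hx m i j k p

/-- Contraction commutes with `∇`, so this is the covariant derivative of a vanishing divergence. -/
lemma hess_divergence (hg : MetricOn g U) (hT : Smooth4 U T)
    (hd : ∀ y ∈ U, ∀ j k l, ∑ m, ∑ i, (g y)⁻¹ m i * cov g m T y i j k l = 0)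
    (hx : x ∈ U) (a j k l : Fin n) :
    ∑ m, ∑ i, (g x)⁻¹ m i * hess g a m T x i j k l = 0 := by
  -- The two indices to be contracted become matrix indices and `pderiv_tr₂_inv` applies with the
  -- other three frozen; the corrections for those three are again divergences and vanish.
  let N : Fin n → Fin n → Fin n → Coord n → Matrix (Fin n) (Fin n) ℝ :=
    fun j k l y => Matrix.of fun m i => cov g m T y i j k l
  have hN : ∀ j k l, SmoothM U (N j k l) := fun j k l m i => hg.smooth_cov hT m i j k l
  have hD : ∀ y ∈ U, ∀ j k l, tr₂ (g y)⁻¹ (N j k l y) = 0 := hd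
  have h1 := hg.pderiv_tr₂_inv hx (hN j k l) a
  rw [pderiv_congr hg.isOpen hx (f₂ := fun _ => 0) (fun y hy => hD y hy j k l), pderiv_const] at h1
  have h2 : ∀ m i, hess g a m T x i j k l = cov₂ g a (N j k l) x m i -
      ∑ p, (christoffel g p a j x * N p k l x m i + christoffel g p a k x * N j p l x m i +
        christoffel g p a l x * N j k p x m i) := by
    intro m i
    rw [hess_apply, cov₂]
    simp only [Matrix.sub_apply, Matrix.add_apply, Matrix.mul_apply, Matrix.transpose_apply,
      mpd_apply, N, Matrix.of_apply, gam, Finset.sum_add_distrib]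
    rw [show ∑ q, cov g m T x q j k l * christoffel g q a i x =
      ∑ q, christoffel g q a i x * cov g m T x q j k l from
        Finset.sum_congr rfl fun _ _ => mul_comm _ _]
    ring
  have h3 : ∑ m, ∑ i, (g x)⁻¹ m i * hess g a m T x i j k l = tr₂ (g x)⁻¹ (cov₂ g a (N j k l) x) -
      ∑ p, (christoffel g p a j x * tr₂ (g x)⁻¹ (N p k l x) +
        christoffel g p a k x * tr₂ (g x)⁻¹ (N j p l x) +
        christoffel g p a l x * tr₂ (g x)⁻¹ (N j k p x)) := by
    simp only [h2, tr₂, mul_sub, Finset.sum_sub_distrib]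
    congr 1
    simp only [Finset.mul_sum, ← Finset.sum_add_distrib]
    rw [Finset.sum_comm' (t' := Finset.univ) (s' := fun _ => Finset.univ) (by simp)]
    conv_rhs => rw [Finset.sum_comm]
    rw [Finset.sum_comm]
    refine Finset.sum_congr rfl fun m _ => ?_
    rw [Finset.sum_comm]
    exact Finset.sum_congr rfl fun p _ => Finset.sum_congr rfl fun i _ => by ring
  rw [h3, ← h1]
  simp [hD x hx]

/-- The rough Laplacian of a divergence-free Weyl tensor is a curvature term. -/
lemma trace_hess_weylF (hn : 4 ≤ n) (hg : MetricOn g U)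
    (hdiv : ∀ y ∈ U, ∀ j k l, divergence g (weyl g) j k l y = 0) (hx : x ∈ U) (i j k l : Fin n) :
    (∑ a, ∑ m, (g x)⁻¹ a m • hess g a m (weylF g) x) i j k l =
      - curvTerm (g x)⁻¹ (riemF g x) (weylF g x) i j k l +
        curvTerm (g x)⁻¹ (riemF g x) (weylF g x) j i k l := by
  have hW := hg.smooth_weylF hn
  have anti := hg.hess_antisymm₁₂ hx (T := weylF g)
    (fun y hy => (hg.isCurvatureLike_weylF hn hy).swap₁)
  have bian := hg.hess_bianchi hW (fun y hy => hg.weylF_bianchi hn hy (hdiv y hy)) hx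
  have divg := hg.hess_divergence hW (fun y hy j k l => by
    have := hdiv y hy j k l
    rwa [divergence_eq, neg_eq_zero] at this) hx
  -- Commuting the two derivatives leaves `∇ᵢ` of the divergence of `W`, which vanishes, and the
  -- curvature term.
  have key : ∀ i j k l, ∑ a, ∑ m, (g x)⁻¹ a m * hess g a i (weylF g) x m j k l =
      - curvTerm (g x)⁻¹ (riemF g x) (weylF g x) i j k l := by
    intro i j k l
    have h0 : ∀ a m, hess g a i (weylF g) x m j k l = hess g i a (weylF g) x m j k l -
        rho (curv g a i x) (weylF g x) m j k l := by
      intro a m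
      have := congrFun (congrFun (congrFun (congrFun (hg.hess_comm hx hW a i) m) j) k) l
      simp only [Pi.sub_apply, Pi.neg_apply] at this
      linarith
    simp only [h0, mul_sub, Finset.sum_sub_distrib, divg i j k l, curvTerm,
      hg.curv_eq_inv_mul hx, zero_sub]
  rw [← key i j k l]
  have := key j i k l
  rw [show curvTerm (g x)⁻¹ (riemF g x) (weylF g x) j i k l =
    - ∑ a, ∑ m, (g x)⁻¹ a m * hess g a j (weylF g) x m i k l by rw [this, neg_neg]]
  simp only [Finset.sum_apply, Pi.smul_apply, smul_eq_mul, ← Finset.sum_neg_distrib,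
    ← Finset.sum_add_distrib]
  refine Finset.sum_congr rfl fun a _ => Finset.sum_congr rfl fun m _ => ?_
  -- The Bianchi identity trades `∇ₐ∇ₘ W_{ij}` for `∇ₐ∇ᵢ W_{mj} - ∇ₐ∇ⱼ W_{mi}`, and `key` treats
  -- both.
  linear_combination (g x)⁻¹ a m * (bian a m i j k l - anti a i j m k l)

end MetricOn

lemma ip_antisymmetrize {A B : T4 n} (hB : ∀ i j k l, B i j k l = - B j i k l) :
    ip (fun i j k l => - A i j k l + A j i k l) B = -2 * ip A B := by
  have h1 : (fun i j k l => - A i j k l + A j i k l) = -A + fun i j k l => A j i k l := by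
    ext; simp
  have h2 : ip (fun i j k l => A j i k l) B = - ip A B := by
    rw [ip_swap₁₂, ← ip_neg_right]
    congr 1
    ext i j k l
    exact hB j i k l
  rw [h1, ip_add_left, ip_neg_left, h2]; ring

section ActSwaps

variable (A : Matrix (Fin n) (Fin n) ℝ) (T : T4 n)

lemma act_swap₁₂ : act A (fun i j k l => T j i k l) = fun i j k l => act A T j i k l := by
  have h1 : ∀ T : T4 n, slot₁ A (slot₂ A (fun i j k l => T j i k l)) =
      fun i j k l => slot₁ A (slot₂ A T) j i k l := by
    intro T
    rw [← slot₂_slot₁]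
    rfl
  exact h1 (slot₃ A (slot₄ A T))

lemma act_swap₁₃ : act A (fun i j k l => T k j i l) = fun i j k l => act A T k j i l := by
  have h1 : ∀ T : T4 n, slot₁ A (slot₃ A (fun i j k l => T k j i l)) =
      fun i j k l => slot₁ A (slot₃ A T) k j i l := by
    intro T
    rw [← slot₃_slot₁]
    rfl
  rw [act, ← slot₃_slot₂, act, ← slot₃_slot₂]
  exact h1 (slot₂ A (slot₄ A T))

lemma act_swap₂₄ : act A (fun i j k l => T i l k j) = fun i j k l => act A T i l k j := by
  have h : (fun i j k l => T i l k j) = fun i j k l =>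
    (fun i j k l => (fun i j k l => (fun i j k l => (fun i j k l => T j i k l) i j l k) k j i l)
      i j l k) j i k l := rfl
  rw [h, act_swap₁₂, act_swap₃₄, act_swap₁₃, act_swap₃₄, act_swap₁₂]

end ActSwaps

/-- Each symmetry is a linear relation between permuted copies of `T`, and `act` commutes with
permutations of the slots. -/
lemma IsCurvatureLike.act {T : T4 n} (hT : IsCurvatureLike T) (A : Matrix (Fin n) (Fin n) ℝ) :
    IsCurvatureLike (act A T) where
  swap₁ i j k l := by
    have h : T = -(fun i j k l => T j i k l) := by ext i j k l; exact hT.swap₁ i j k l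
    have := congrArg (WeylBochner.act A) h
    rw [act_neg, act_swap₁₂ A T] at this
    exact congrFun (congrFun (congrFun (congrFun this i) j) k) l
  swap₂ i j k l := by
    have h : T = -(fun i j k l => T i j l k) := by ext i j k l; exact hT.swap₂ i j k l
    have := congrArg (WeylBochner.act A) h
    rw [act_neg, act_swap₃₄ A T] at this
    exact congrFun (congrFun (congrFun (congrFun this i) j) k) l
  pair i j k l := by
    have h : T = (fun i j k l => (fun i j k l => T k j i l) i l k j) := by
      ext i j k l; exact hT.pair i j k l
    have := congrArg (WeylBochner.act A) h
    rw [act_swap₂₄ A (fun i j k l => T k j i l), act_swap₁₃ A T] at this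
    exact congrFun (congrFun (congrFun (congrFun this i) j) k) l
  cyclic i j k l := by
    have h : T + (fun i j k l => (fun i j k l => T i l k j) j i k l) +
        (fun i j k l => (fun i j k l => T j i k l) i l k j) = 0 := by
      ext i j k l; exact hT.cyclic i j k l
    have := congrArg (WeylBochner.act A) h
    rw [act_add, act_add, act_zero, act_swap₁₂ A (fun i j k l => T i l k j), act_swap₂₄ A T,
      act_swap₂₄ A (fun i j k l => T j i k l), act_swap₁₂ A T] at this
    exact congrFun (congrFun (congrFun (congrFun this i) j) k) l

/-- The Bochner formula for a divergence-free Weyl tensor. -/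
lemma MetricOn.bochner {g : Coord n → Matrix (Fin n) (Fin n) ℝ} {U : Set (Coord n)} {x : Coord n}
    (hn : 4 ≤ n) (hg : MetricOn g U)
    (hdiv : ∀ y ∈ U, ∀ j k l, divergence g (weyl g) j k l y = 0) (hx : x ∈ U) :
    laplacian g (weylNormSq g) x = 2 * covWeylNormSq g x -
      4 * ip (curvTerm (g x)⁻¹ (riemF g x) (weylF g x)) (act (g x)⁻¹ (weylF g x)) := by
  have h : (∑ a, ∑ m, (g x)⁻¹ a m • hess g a m (weylF g) x) = fun i j k l =>
      - curvTerm (g x)⁻¹ (riemF g x) (weylF g x) i j k l +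
        curvTerm (g x)⁻¹ (riemF g x) (weylF g x) j i k l := by
    ext i j k l; exact hg.trace_hess_weylF hn hdiv hx i j k l
  rw [hg.laplacian_weylNormSq hn hx, h,
    ip_antisymmetrize ((hg.isCurvatureLike_weylF hn hx).act _).swap₁]
  ring

/-! ### Commutators of skew-symmetric matrices -/

section Commutator

lemma sum_normSq_eq_trace {ι : Type*} [Fintype ι] (M : Matrix ι ι ℂ) :
    ((∑ i, ∑ j, Complex.normSq (M i j) : ℝ) : ℂ) = (M.conjTranspose * M).trace := by
  simp only [Matrix.trace, Matrix.diag, Matrix.mul_apply, Matrix.conjTranspose_apply]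
  push_cast
  rw [Finset.sum_comm]
  exact Finset.sum_congr rfl fun _ _ => Finset.sum_congr rfl fun _ _ => by
    rw [Complex.normSq_eq_conj_mul_self]; rfl

variable {ι : Type*} [Fintype ι] [DecidableEq ι]

/-- The hypothesis says that the positive and the negative `ν c` carry equal sums of squares, as for
a spectrum symmetric about `0`. If `ν a` and `ν b` have the same sign, the other sign contributes as
much again, so the sum is at least `2 (ν a ^ 2 + ν b ^ 2)`. For opposite signs the bound is
immediate. -/
lemma sq_add_le_sum_sq_of_odd {ν : ι → ℝ} (hodd : ∑ c, ν c * |ν c| = 0) {a b : ι} (hab : a ≠ b) :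
    (ν a + ν b) ^ 2 ≤ ∑ c, ν c ^ 2 := by
  have two : ∀ f : ι → ℝ, (∀ c, 0 ≤ f c) → f a + f b ≤ ∑ c, f c := fun f hf => by
    rw [← Finset.sum_pair hab]
    exact Finset.sum_le_sum_of_subset_of_nonneg (Finset.subset_univ _) fun _ _ _ => hf _
  have hsq := two (fun c => ν c ^ 2) fun c => sq_nonneg _
  by_cases hs : ν a * ν b ≤ 0
  · nlinarith
  · push Not at hs
    rcases lt_or_ge 0 (ν a) with ha | ha
    · have hb : 0 < ν b := by
        by_contra hb
        nlinarith
      -- This function is `2 ν²` where `ν` is positive and `0` elsewhere, while its sum is still the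
      -- sum of the `ν²`.
      have h := two (fun c => ν c ^ 2 + ν c * |ν c|) fun c => by
        rcases abs_cases (ν c) with ⟨h, _⟩ | ⟨h, _⟩ <;> rw [h] <;> nlinarith [sq_nonneg (ν c)]
      rw [Finset.sum_add_distrib, hodd, abs_of_pos ha, abs_of_pos hb] at h
      nlinarith [sq_nonneg (ν a - ν b)]
    · have ha' : ν a < 0 := lt_of_le_of_ne ha (by rintro h; simp [h] at hs)
      have hb : ν b < 0 := by
        by_contra hb
        nlinarith
      have h := two (fun c => ν c ^ 2 - ν c * |ν c|) fun c => by
        rcases abs_cases (ν c) with ⟨h, _⟩ | ⟨h, _⟩ <;> rw [h] <;> nlinarith [sq_nonneg (ν c)]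
      rw [Finset.sum_sub_distrib, hodd, abs_of_neg ha', abs_of_neg hb] at h
      nlinarith [sq_nonneg (ν a - ν b)]

/-- A congruence rather than a conjugation; the Frobenius norm is kept because `U.transpose` is
unitary along with `U`. -/
lemma sum_normSq_transpose_conj {U : Matrix ι ι ℂ} (hU : U * U.conjTranspose = 1)
    (M : Matrix ι ι ℂ) :
    ∑ i, ∑ j, Complex.normSq ((U.transpose * M * U) i j) = ∑ i, ∑ j, Complex.normSq (M i j) := by
  have h2 : U.transpose.conjTranspose * U.transpose = 1 := by
    have := congrArg Matrix.transpose hU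
    rwa [Matrix.transpose_mul, Matrix.transpose_one] at this
  have h : ((∑ i, ∑ j, Complex.normSq ((U.transpose * M * U) i j) : ℝ) : ℂ) =
      ((∑ i, ∑ j, Complex.normSq (M i j) : ℝ) : ℂ) := by
    rw [sum_normSq_eq_trace, sum_normSq_eq_trace, Matrix.conjTranspose_mul,
      Matrix.conjTranspose_mul]
    calc (U.conjTranspose * (M.conjTranspose * U.transpose.conjTranspose) *
          (U.transpose * M * U)).trace
        = (U.conjTranspose * (M.conjTranspose * (U.transpose.conjTranspose * U.transpose) * M) *
          U).trace := by simp only [Matrix.mul_assoc]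
      _ = (U.conjTranspose * (M.conjTranspose * M) * U).trace := by rw [h2, mul_one]
      _ = (U * U.conjTranspose * (M.conjTranspose * M)).trace := by
          rw [Matrix.trace_mul_comm, Matrix.mul_assoc]
      _ = _ := by rw [hU, one_mul]
  exact_mod_cast h

/-- `‖[X, L]‖ ≤ ‖X‖ ‖L‖` for the Frobenius norms of real skew-symmetric matrices. -/
lemma frobenius_commutator_le {L X : Matrix ι ι ℝ} (hL : L.transpose = -L)
    (hX : X.transpose = -X) :
    ∑ i, ∑ j, (X * L - L * X) i j ^ 2 ≤ (∑ i, ∑ j, L i j ^ 2) * ∑ i, ∑ j, X i j ^ 2 := by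
  set Lc : Matrix ι ι ℂ := L.map Complex.ofReal with hLc
  set Xc : Matrix ι ι ℂ := X.map Complex.ofReal with hXc
  -- `iL` is Hermitian with real spectrum `ν`; the reality of `L` survives as `A.transpose = -A`.
  set A : Matrix ι ι ℂ := Complex.I • Lc with hAdef
  have hLt : Lc.transpose = -Lc := by
    ext i j
    have := congrFun (congrFun hL i) j
    simp only [Matrix.transpose_apply, Matrix.neg_apply] at this
    simp [hLc, this]
  have hXt : Xc.transpose = -Xc := by
    ext i j
    have := congrFun (congrFun hX i) j
    simp only [Matrix.transpose_apply, Matrix.neg_apply] at this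
    simp [hXc, this]
  have hA : A.IsHermitian := by
    ext i j
    have := congrFun (congrFun hL i) j
    simp only [Matrix.transpose_apply, Matrix.neg_apply] at this
    simp [hAdef, hLc, this]
  have hAt : A.transpose = -A := by rw [hAdef, Matrix.transpose_smul, hLt, smul_neg]
  set U : Matrix ι ι ℂ := (hA.eigenvectorUnitary : Matrix ι ι ℂ) with hUdef
  have hU1 : U * U.conjTranspose = 1 := Unitary.coe_mul_star_self hA.eigenvectorUnitary
  have hU2 : U.conjTranspose * U = 1 := Unitary.coe_star_mul_self hA.eigenvectorUnitary
  set ν : ι → ℝ := hA.eigenvalues with hν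
  set D : Matrix ι ι ℂ := Matrix.diagonal (fun i => (ν i : ℂ)) with hD
  have hspec : A = U * D * U.conjTranspose := by
    have := hA.spectral_theorem
    rw [Unitary.conjStarAlgAut_apply] at this
    exact this
  have hAU : A * U = U * D := by
    conv_lhs => rw [hspec]
    rw [Matrix.mul_assoc, hU2, mul_one]
  have hUA : U.transpose * A = -(D * U.transpose) := by
    have := congrArg Matrix.transpose hAU
    rw [Matrix.transpose_mul, Matrix.transpose_mul, hAt, mul_neg, hD,
      Matrix.diagonal_transpose] at this
    rw [hD, ← this, neg_neg]
  -- the spectrum is symmetric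
  have hodd : ∑ c, ν c * |ν c| = 0 := by
    -- `G` is unitary with `G D = -D G`, so `G a b ≠ 0` only if `ν a = -ν b`. The numbers `|G a b|²`
    -- have all row and column sums `1` and carry the sum of the odd function `ν |ν|` to its
    -- negative.
    set G : Matrix ι ι ℂ := U.transpose * U with hG
    have hGG : G.conjTranspose * G = 1 := by
      have h2 : U.transpose.conjTranspose * U.transpose = 1 := by
        have := congrArg Matrix.transpose hU1
        rwa [Matrix.transpose_mul, Matrix.transpose_one] at this
      rw [hG, Matrix.conjTranspose_mul, Matrix.mul_assoc, ← Matrix.mul_assoc _ U.transpose, h2,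
        one_mul, hU2]
    have hGG' : G * G.conjTranspose = 1 := mul_eq_one_comm.1 hGG
    have hGD : G * D = -(D * G) := by
      rw [hG, Matrix.mul_assoc, ← hAU, ← Matrix.mul_assoc, hUA, neg_mul, Matrix.mul_assoc]
    have hcol : ∀ b, ∑ a, Complex.normSq (G a b) = 1 := by
      intro b
      have := congrFun (congrFun hGG b) b
      simp only [Matrix.mul_apply, Matrix.conjTranspose_apply, Matrix.one_apply_eq] at this
      have h' : ((∑ a, Complex.normSq (G a b) : ℝ) : ℂ) = 1 := by
        rw [← this]; push_cast
        exact Finset.sum_congr rfl fun _ _ => by rw [Complex.normSq_eq_conj_mul_self]; rfl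
      exact_mod_cast h'
    have hrow : ∀ a, ∑ b, Complex.normSq (G a b) = 1 := by
      intro a
      have := congrFun (congrFun hGG' a) a
      simp only [Matrix.mul_apply, Matrix.conjTranspose_apply, Matrix.one_apply_eq] at this
      have h' : ((∑ b, Complex.normSq (G a b) : ℝ) : ℂ) = 1 := by
        rw [← this]; push_cast
        exact Finset.sum_congr rfl fun _ _ => by
          rw [Complex.normSq_eq_conj_mul_self, mul_comm]; rfl
      exact_mod_cast h'
    have hent : ∀ a b, ν a * |ν a| * Complex.normSq (G a b) =
        -(ν b * |ν b| * Complex.normSq (G a b)) := by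
      intro a b
      have := congrFun (congrFun hGD a) b
      rw [hD, Matrix.mul_diagonal, Matrix.neg_apply, Matrix.diagonal_mul] at this
      have h0 : ((ν a + ν b : ℝ) : ℂ) * G a b = 0 := by push_cast; linear_combination this
      rcases mul_eq_zero.1 h0 with h | h
      · have : ν a = -ν b := by
          have : ν a + ν b = 0 := by exact_mod_cast h
          linarith
        rw [this, abs_neg]; ring
      · simp [h]
    have e1 : ∑ a, ν a * |ν a| = ∑ a, ∑ b, ν a * |ν a| * Complex.normSq (G a b) := by
      refine Finset.sum_congr rfl fun a _ => ?_
      rw [← Finset.mul_sum, hrow, mul_one]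
    have e2 : ∑ b, ν b * |ν b| = ∑ a, ∑ b, ν b * |ν b| * Complex.normSq (G a b) := by
      rw [Finset.sum_comm]
      refine Finset.sum_congr rfl fun b _ => ?_
      rw [← Finset.mul_sum, hcol, mul_one]
    have e3 : ∑ a, ν a * |ν a| = - ∑ b, ν b * |ν b| := by
      rw [e2, ← Finset.sum_neg_distrib, ← e2, e1]
      refine Finset.sum_congr rfl fun a _ => ?_
      rw [← Finset.sum_neg_distrib]
      exact Finset.sum_congr rfl fun b _ => hent a b
    linarith
  -- The congruence keeps `Y` skew, so its diagonal vanishes and only `a ≠ b` matters, and it turns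
  -- the commutator into `Y D + D Y`, with entries `(ν a + ν b) Y a b` up to a unit factor.
  set Y : Matrix ι ι ℂ := U.transpose * Xc * U with hY
  have hYt : Y.transpose = -Y := by
    rw [hY, Matrix.transpose_mul, Matrix.transpose_mul, hXt, Matrix.transpose_transpose]
    simp [Matrix.mul_assoc]
  have hYaa : ∀ a, Y a a = 0 := by
    intro a
    have := congrFun (congrFun hYt a) a
    simp only [Matrix.transpose_apply, Matrix.neg_apply] at this
    exact self_eq_neg.1 this
  have hLA : Lc = -(Complex.I • A) := by
    rw [hAdef, smul_smul, Complex.I_mul_I]; simp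
  have hcomm : U.transpose * (Xc * Lc - Lc * Xc) * U = -(Complex.I • (Y * D + D * Y)) := by
    rw [hLA, hY]
    calc _ = -(Complex.I • (U.transpose * Xc * (A * U) - U.transpose * A * (Xc * U))) := by
          simp only [mul_neg, neg_mul, mul_sub, sub_mul, Matrix.mul_smul, Matrix.smul_mul,
            Matrix.mul_assoc, smul_sub]
          abel
      _ = _ := by
          rw [hAU, hUA]
          simp only [Matrix.mul_assoc, neg_mul, sub_neg_eq_add]
  have hYn : ∑ i, ∑ j, Complex.normSq (Y i j) = ∑ i, ∑ j, X i j ^ 2 := by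
    rw [hY, sum_normSq_transpose_conj hU1]
    exact Finset.sum_congr rfl fun _ _ => Finset.sum_congr rfl fun _ _ => by
      simp [hXc, Complex.normSq_ofReal, sq]
  have hLn : ∑ i, ∑ j, L i j ^ 2 = ∑ c, ν c ^ 2 := by
    have h1 : ∑ i, ∑ j, L i j ^ 2 = ∑ i, ∑ j, Complex.normSq (A i j) :=
      Finset.sum_congr rfl fun _ _ => Finset.sum_congr rfl fun _ _ => by
        simp [hAdef, hLc, Complex.normSq_ofReal, sq]
    have h2 := sum_normSq_eq_trace A
    rw [hA.eq, hspec] at h2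
    have h3 : (U * D * U.conjTranspose * (U * D * U.conjTranspose)).trace = (D * D).trace := by
      rw [show U * D * U.conjTranspose * (U * D * U.conjTranspose) =
        U * (D * (U.conjTranspose * U) * D) * U.conjTranspose by simp only [Matrix.mul_assoc],
        hU2, mul_one, Matrix.trace_mul_comm, ← Matrix.mul_assoc, hU2, one_mul]
    rw [h3, ← hspec, hD, Matrix.diagonal_mul_diagonal, Matrix.trace_diagonal] at h2
    rw [h1]
    have : ((∑ i, ∑ j, Complex.normSq (A i j) : ℝ) : ℂ) = ((∑ c, ν c ^ 2 : ℝ) : ℂ) := by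
      rw [h2]; push_cast
      exact Finset.sum_congr rfl fun _ _ => by ring
    exact_mod_cast this
  have hCn : ∑ i, ∑ j, (X * L - L * X) i j ^ 2 =
      ∑ a, ∑ b, (ν a + ν b) ^ 2 * Complex.normSq (Y a b) := by
    have h1 : ∑ i, ∑ j, (X * L - L * X) i j ^ 2 =
        ∑ i, ∑ j, Complex.normSq ((Xc * Lc - Lc * Xc) i j) := by
      have : Xc * Lc - Lc * Xc = (X * L - L * X).map Complex.ofReal := by
        ext i j
        simp [hXc, hLc, Matrix.mul_apply]
      rw [this]
      exact Finset.sum_congr rfl fun _ _ => Finset.sum_congr rfl fun _ _ => by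
        rw [Matrix.map_apply, Complex.normSq_ofReal, sq]
    rw [h1, ← sum_normSq_transpose_conj hU1, hcomm]
    refine Finset.sum_congr rfl fun a _ => Finset.sum_congr rfl fun b _ => ?_
    rw [Matrix.neg_apply, Matrix.smul_apply, Matrix.add_apply, hD, Matrix.mul_diagonal,
      Matrix.diagonal_mul, Complex.normSq_neg, smul_eq_mul, Complex.normSq_mul, Complex.normSq_I,
      one_mul, show Y a b * (ν b : ℂ) + (ν a : ℂ) * Y a b = ((ν a + ν b : ℝ) : ℂ) * Y a b by
        push_cast; ring, Complex.normSq_mul, Complex.normSq_ofReal, sq]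
  rw [hCn, hLn, ← hYn, Finset.mul_sum]
  refine Finset.sum_le_sum fun a _ => ?_
  rw [Finset.mul_sum]
  refine Finset.sum_le_sum fun b _ => ?_
  by_cases hab : a = b
  · subst hab; simp [hYaa]
  · exact mul_le_mul_of_nonneg_right (sq_add_le_sum_sq_of_odd hodd hab) (Complex.normSq_nonneg _)

end Commutator

/-! ### Sums of lowest eigenvalues -/

/-- The dual form of the sum of the `k` smallest entries. It does not mention the order, so it can
be evaluated on an unordered family of eigenvalues. -/
lemma exists_sum_take_eq {l : List ℝ} (hl : l.Pairwise (· ≤ ·)) {k : ℕ} (hk : 0 < k)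
    (hkl : k ≤ l.length) :
    ∃ t : ℝ, (l.take k).sum = k * t - (l.map fun x => max (t - x) 0).sum := by
  have hlt : k - 1 < l.length := by omega
  -- The `k`-th smallest entry, since indices start at `0`: the positive part is `t - x` before
  -- position `k` and zero from there on.
  refine ⟨l[k - 1], ?_⟩
  set t := l[k - 1] with ht
  rw [List.pairwise_iff_getElem] at hl
  have hle : ∀ i (hi : i < l.length), i ≤ k - 1 → l[i] ≤ t := by
    intro i hi hik
    rcases hik.lt_or_eq with h | h
    · exact hl i (k - 1) hi hlt h
    · simp [ht, h]
  have hge : ∀ i (hi : i < l.length), k ≤ i → t ≤ l[i] := fun i hi hik =>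
    hl (k - 1) i hlt hi (by omega)
  have h1 : ((l.take k).map fun x => max (t - x) 0) = (l.take k).map fun x => t - x := by
    refine List.map_congr_left fun x hx => ?_
    obtain ⟨i, hi, rfl⟩ := List.mem_iff_getElem.1 hx
    simp only [List.length_take, lt_min_iff] at hi
    rw [List.getElem_take]
    exact max_eq_left (by linarith [hle i hi.2 (by omega)])
  have h2 : ((l.drop k).map fun x => max (t - x) 0) = (l.drop k).map fun x => 0 := by
    refine List.map_congr_left fun x hx => ?_
    obtain ⟨i, hi, rfl⟩ := List.mem_iff_getElem.1 hx
    simp only [List.length_drop] at hi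
    rw [List.getElem_drop]
    exact max_eq_right (by linarith [hge (k + i) (by omega) (by omega)])
  have h3 : ∀ l' : List ℝ, (l'.map fun x => t - x).sum = l'.length * t - l'.sum := by
    intro l'
    induction l' with
    | nil => simp
    | cons a s ih => simp only [List.map_cons, List.sum_cons, ih, List.length_cons]; push_cast; ring
  conv_rhs => rw [← List.take_append_drop k l, List.map_append, List.sum_append, h1, h2, h3]
  simp [min_eq_left hkl]

/-- If `0 ≤ H ≤ (tr H / k)` as quadratic forms, then `tr (S H)` is bounded below by the sum of the
`k` lowest eigenvalues of `S`. -/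
lemma trace_mul_ge_sum_lowest {ι : Type*} [Fintype ι] [DecidableEq ι] {S H : Matrix ι ι ℝ}
    (hS : S.IsHermitian) {k : ℕ} (hk : 0 < k) {c : ℝ} (htr : H.trace = k * c)
    (h0 : ∀ v : ι → ℝ, 0 ≤ v ⬝ᵥ H.mulVec v) (h1 : ∀ v : ι → ℝ, v ⬝ᵥ H.mulVec v ≤ c * (v ⬝ᵥ v)) :
    c * ((S.charpoly.roots.sort (· ≤ ·)).take k).sum ≤ (S * H).trace := by
  set U : Matrix ι ι ℝ := (hS.eigenvectorUnitary : Matrix ι ι ℝ) with hU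
  have hU1 : U * U.transpose = 1 := Unitary.coe_mul_star_self hS.eigenvectorUnitary
  have hU2 : U.transpose * U = 1 := Unitary.coe_star_mul_self hS.eigenvectorUnitary
  set lam : ι → ℝ := hS.eigenvalues with hlam
  have hspec : S = U * Matrix.diagonal lam * U.transpose := by
    have := hS.spectral_theorem
    rw [Unitary.conjStarAlgAut_apply] at this
    exact this
  set K : Matrix ι ι ℝ := U.transpose * H * U with hK
  have ha : ∀ a, K a a = U.transpose a ⬝ᵥ H.mulVec (U.transpose a) := by
    intro a
    rw [hK, Matrix.mul_assoc, Matrix.mul_apply]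
    rfl
  have hone : ∀ a, U.transpose a ⬝ᵥ U.transpose a = 1 := by
    intro a
    have := congrFun (congrFun hU2 a) a
    rwa [Matrix.one_apply_eq] at this
  have ha0 : ∀ a, 0 ≤ K a a := fun a => by rw [ha]; exact h0 _
  have hac : ∀ a, K a a ≤ c := fun a => by
    rw [ha]; exact (h1 _).trans (by rw [hone, mul_one])
  have hsum : ∑ a, K a a = k * c := by
    rw [← htr, show ∑ a, K a a = K.trace from rfl, hK, Matrix.trace_mul_comm, ← Matrix.mul_assoc,
      hU1, one_mul]
  have hSH : (S * H).trace = ∑ a, lam a * K a a := by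
    conv_lhs => rw [hspec, Matrix.mul_assoc, Matrix.trace_mul_comm, ← Matrix.mul_assoc]
    rw [← hK, Matrix.trace_mul_comm]
    simp [Matrix.trace, Matrix.diagonal_mul]
  have hroots : S.charpoly.roots = Finset.univ.val.map lam := hS.roots_charpoly_eq_eigenvalues
  set l := S.charpoly.roots.sort (· ≤ ·) with hl
  have hlm : (l : Multiset ℝ) = Finset.univ.val.map lam := by rw [hl, Multiset.sort_eq, hroots]
  have hlen : l.length = Fintype.card ι := by
    have := congrArg Multiset.card hlm
    simpa using this
  have hc0 : 0 ≤ c := by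
    have : 0 ≤ (k : ℝ) * c := hsum ▸ Finset.sum_nonneg fun a _ => ha0 a
    have hk' : (0 : ℝ) < k := by exact_mod_cast hk
    exact nonneg_of_mul_nonneg_right this hk'
  rcases hc0.eq_or_lt with hc | hc
  · have : ∀ a, K a a = 0 := fun a => le_antisymm (hc ▸ hac a) (ha0 a)
    rw [hSH, ← hc]; simp [this]
  -- There are at least `k` eigenvalues because `k * c` is a sum of `card ι` diagonal entries, each
  -- at most `c`.
  have hkl : k ≤ l.length := by
    rw [hlen]
    have h2 : ∑ a, K a a ≤ ∑ _a : ι, c := Finset.sum_le_sum fun a _ => hac a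
    rw [hsum, Finset.sum_const, nsmul_eq_mul, Finset.card_univ] at h2
    have := le_of_mul_le_mul_right h2 hc
    exact_mod_cast this
  obtain ⟨t, ht⟩ := exists_sum_take_eq (l := l) (Multiset.pairwise_sort _ _) hk hkl
  have hmap : (l.map fun x => max (t - x) 0).sum = ∑ a, max (t - lam a) 0 := by
    have : ((l.map fun x => max (t - x) 0 : List ℝ) : Multiset ℝ) =
        Finset.univ.val.map fun a => max (t - lam a) 0 := by
      rw [← Multiset.map_coe, hlm, Multiset.map_map]; rfl
    have := congrArg Multiset.sum this
    rwa [Multiset.sum_coe] at this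
  rw [ht, hmap, hSH]
  -- Linear programming duality term by term, from `0 ≤ K a a ≤ c`; summed with `∑ K a a = k * c` it
  -- gives `c` times the expression of `exists_sum_take_eq`.
  have hterm : ∀ a, t * K a a - c * max (t - lam a) 0 ≤ lam a * K a a := by
    intro a
    rcases le_total t (lam a) with h | h
    · rw [max_eq_right (by linarith)]; nlinarith [ha0 a]
    · rw [max_eq_left (by linarith)]; nlinarith [ha0 a, hac a]
  have := Finset.sum_le_sum fun a (_ : a ∈ Finset.univ) => hterm a
  rw [Finset.sum_sub_distrib, ← Finset.mul_sum, ← Finset.mul_sum, hsum] at this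
  linarith

/-! ### The curvature term of the Bochner formula in an orthonormal basis -/

lemma sum_pairs {f : Fin n → Fin n → ℝ} (hs : ∀ a b, f a b = f b a) (h0 : ∀ a, f a a = 0) :
    ∑ a, ∑ b, f a b = 2 * ∑ p : Pairs n, f p.1.1 p.1.2 := by
  classical
  have h1 : ∑ p : Pairs n, f p.1.1 p.1.2 = ∑ a, ∑ b, if a < b then f a b else 0 := by
    rw [← Finset.sum_product', Finset.univ_product_univ, ← Finset.sum_filter,
      Finset.sum_subtype (p := fun q : Fin n × Fin n => q.1 < q.2) (Finset.univ.filter _) (by simp)]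
  have h2 : ∑ a, ∑ b, (if a < b then f a b else 0) = ∑ a, ∑ b, if b < a then f a b else 0 := by
    rw [Finset.sum_comm]
    exact Finset.sum_congr rfl fun a _ => Finset.sum_congr rfl fun b _ => by rw [hs b a]
  rw [two_mul]
  conv_rhs => rw [h1]; lhs; rw [h2]
  rw [← Finset.sum_add_distrib]
  refine Finset.sum_congr rfl fun a _ => ?_
  rw [← Finset.sum_add_distrib]
  refine Finset.sum_congr rfl fun b _ => ?_
  rcases lt_trichotomy a b with h | h | h
  · simp [h, h.not_gt]
  · subst h; simp [h0]
  · simp [h, h.not_gt]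

/-- The basis element of the skew-symmetric matrices with indices `a`, `b`. -/
def skewE (a b : Fin n) : Matrix (Fin n) (Fin n) ℝ := Matrix.single a b 1 - Matrix.single b a 1

lemma skewE_swap (a b : Fin n) : skewE a b = - skewE b a := by simp [skewE]

lemma skewE_apply (a b c d : Fin n) : skewE a b c d =
    (if a = c ∧ b = d then 1 else 0) - (if b = c ∧ a = d then 1 else 0) := by
  simp [skewE, Matrix.single_apply]

lemma sum_pairs_skewE {X : Matrix (Fin n) (Fin n) ℝ} (hX : ∀ a b, X a b = - X b a) :
    ∑ p : Pairs n, X p.1.1 p.1.2 • skewE p.1.1 p.1.2 = X := by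
  ext c d
  rw [Matrix.sum_apply]
  have h := sum_pairs (f := fun a b => X a b * skewE a b c d)
    (fun a b => by rw [hX a b, skewE_swap a b, Matrix.neg_apply]; ring)
    (fun a => by simp [skewE])
  have h2 : ∑ a, ∑ b, X a b * skewE a b c d = X c d - X d c := by
    simp only [skewE_apply, mul_sub, Finset.sum_sub_distrib, ite_and, mul_ite, mul_one, mul_zero]
    simp
  simp only [Matrix.smul_apply, smul_eq_mul]
  linarith [hX d c]

section RhoLinear

lemma rho_smul_mat (c : ℝ) (A : Matrix (Fin n) (Fin n) ℝ) (T : T4 n) :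
    rho (c • A) T = c • rho A T := by
  ext; simp [rho, slot₁, slot₂, slot₃, slot₄, Finset.mul_sum, mul_assoc, mul_add]

lemma rho_sum_mat {ι : Type*} (s : Finset ι) (F : ι → Matrix (Fin n) (Fin n) ℝ) (T : T4 n) :
    rho (∑ a ∈ s, F a) T = ∑ a ∈ s, rho (F a) T := by
  classical
  induction s using Finset.induction_on with
  | empty => ext; simp [rho, slot₁, slot₂, slot₃, slot₄]
  | insert a s ha ih => rw [Finset.sum_insert ha, Finset.sum_insert ha, rho_add_mat, ih]

end RhoLinear

/-- The symmetries of a curvature tensor apart from the first Bianchi identity. -/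
structure HasPairSymm (T : T4 n) : Prop where
  swap₁ : ∀ i j k l, T i j k l = - T j i k l
  swap₂ : ∀ i j k l, T i j k l = - T i j l k
  pair : ∀ i j k l, T i j k l = T k l i j

lemma IsCurvatureLike.hasPairSymm {T : T4 n} (h : IsCurvatureLike T) : HasPairSymm T :=
  ⟨h.swap₁, h.swap₂, h.pair⟩

lemma HasPairSymm.rho {T : T4 n} (h : HasPairSymm T) (A : Matrix (Fin n) (Fin n) ℝ) :
    HasPairSymm (rho A T) where
  swap₁ i j k l := by
    simp only [WeylBochner.rho, slot₁, slot₂, slot₃, slot₄, Pi.add_apply,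
      ← Finset.sum_add_distrib, ← Finset.sum_neg_distrib]
    refine Finset.sum_congr rfl fun p _ => ?_
    rw [h.swap₁ p j, h.swap₁ i p, h.swap₁ i j p l, h.swap₁ i j k p]; ring
  swap₂ i j k l := by
    simp only [WeylBochner.rho, slot₁, slot₂, slot₃, slot₄, Pi.add_apply,
      ← Finset.sum_add_distrib, ← Finset.sum_neg_distrib]
    refine Finset.sum_congr rfl fun p _ => ?_
    rw [h.swap₂ p j, h.swap₂ i p, h.swap₂ i j p l, h.swap₂ i j k p]; ring
  pair i j k l := by
    simp only [WeylBochner.rho, slot₁, slot₂, slot₃, slot₄, Pi.add_apply,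
      ← Finset.sum_add_distrib]
    refine Finset.sum_congr rfl fun p _ => ?_
    rw [h.pair p j, h.pair i p, h.pair i j p l, h.pair i j k p]; ring

lemma ip_pair (T S : T4 n) :
    ip T S = ip (fun i j k l => T k l i j) (fun i j k l => S k l i j) :=
  (ip_swap₁₃ T S).trans <| (ip_swap₁₂ _ _).trans <| (ip_swap₃₄ _ _).trans <|
    (ip_swap₁₃ _ _).trans <| (ip_swap₃₄ _ _).trans (ip_swap₁₂ _ _)

/-- The symmetries of both tensors permute the slots, so all four contribute equally. -/
lemma ip_rho_eq_slot₁ (A : Matrix (Fin n) (Fin n) ℝ) {W X : T4 n} (hW : HasPairSymm W)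
    (hX : HasPairSymm X) : ip (rho A W) X = 4 * ip (slot₁ A W) X := by
  have h2 : ip (slot₂ A W) X = ip (slot₁ A W) X := by
    rw [ip_swap₁₂, ← neg_neg (ip (slot₁ A W) X), ← ip_neg_left, ← ip_neg_right]
    congr 1
    · ext i j k l
      simp only [slot₂, slot₁, Pi.neg_apply, ← Finset.sum_neg_distrib]
      exact Finset.sum_congr rfl fun p _ => by rw [hW.swap₁ j p]; ring
    · ext i j k l; exact hX.swap₁ j i k l
  have h3 : ip (slot₃ A W) X = ip (slot₁ A W) X := by
    rw [ip_pair]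
    congr 1
    · ext i j k l
      exact Finset.sum_congr rfl fun p _ => by rw [hW.pair p j]
    · ext i j k l; exact hX.pair k l i j
  have h4 : ip (slot₄ A W) X = ip (slot₃ A W) X := by
    rw [ip_swap₃₄, ← neg_neg (ip (slot₃ A W) X), ← ip_neg_left, ← ip_neg_right]
    congr 1
    · ext i j k l
      simp only [slot₄, slot₃, Pi.neg_apply, ← Finset.sum_neg_distrib]
      exact Finset.sum_congr rfl fun p _ => by rw [hW.swap₂ i j l p]; ring
    · ext i j k l; exact hX.swap₂ i j l k
  rw [rho, ip_add_left, ip_add_left, ip_add_left, h4, h3, h2]; ring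

lemma slot₁_skewE (a i p j k l : Fin n) (W : T4 n) : slot₁ (skewE a i) W p j k l =
    (if i = p then W a j k l else 0) - (if a = p then W i j k l else 0) := by
  simp only [slot₁, skewE_apply, sub_mul, Finset.sum_sub_distrib, ite_and, ite_mul, one_mul,
    zero_mul]
  simp

/-- Converts sums over `so(n)` into the contraction that occurs in the Bochner formula. The factor
`8` is four equal slots times the two nonzero entries of `skewE a i`, which contribute equally as
`X` is skew in `a, i`. -/
lemma sum_ip_rho_skewE {W : T4 n} (hW : HasPairSymm W) {X : Fin n → Fin n → T4 n}
    (hX : ∀ a i, HasPairSymm (X a i)) (hXs : ∀ a i, X a i = - X i a) :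
    ∑ a, ∑ i, ip (rho (skewE a i) W) (X a i) =
      -8 * ip (fun i j k l => ∑ a, X a i a j k l) W := by
  set f : Fin n → Fin n → ℝ := fun a i => ∑ j, ∑ k, ∑ l, W i j k l * X a i a j k l with hf
  have h1 : ∀ a i, ip (slot₁ (skewE a i) W) (X a i) = - f i a - f a i := by
    intro a i
    simp only [ip, slot₁_skewE, sub_mul, ite_mul, zero_mul, Finset.sum_sub_distrib]
    congr 1
    · have : ∀ p, (∑ j, ∑ k, ∑ l, if i = p then W a j k l * X a i p j k l else 0) =
          if i = p then ∑ j, ∑ k, ∑ l, W a j k l * X a i p j k l else 0 := by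
        intro p; split_ifs <;> simp
      simp only [this, Finset.sum_ite_eq, Finset.mem_univ, if_true]
      simp only [hf, hXs a i, Pi.neg_apply, mul_neg, Finset.sum_neg_distrib]
    · have : ∀ p, (∑ j, ∑ k, ∑ l, if a = p then W i j k l * X a i p j k l else 0) =
          if a = p then ∑ j, ∑ k, ∑ l, W i j k l * X a i p j k l else 0 := by
        intro p; split_ifs <;> simp
      simp only [this, Finset.sum_ite_eq, Finset.mem_univ, if_true, hf]
  have h2 : ip (fun i j k l => ∑ a, X a i a j k l) W = ∑ a, ∑ i, f a i := by
    simp only [ip, hf, Finset.sum_mul]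
    rw [Finset.sum_comm (s := Finset.univ) (t := Finset.univ)
      (f := fun a i => ∑ j, ∑ k, ∑ l, W i j k l * X a i a j k l)]
    refine Finset.sum_congr rfl fun i _ => ?_
    calc _ = ∑ j, ∑ k, ∑ a, ∑ l, X a i a j k l * W i j k l :=
          Finset.sum_congr rfl fun _ _ => Finset.sum_congr rfl fun _ _ => Finset.sum_comm
      _ = ∑ j, ∑ a, ∑ k, ∑ l, X a i a j k l * W i j k l :=
          Finset.sum_congr rfl fun _ _ => Finset.sum_comm
      _ = ∑ a, ∑ j, ∑ k, ∑ l, X a i a j k l * W i j k l := Finset.sum_comm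
      _ = _ := by simp only [mul_comm]
  have h3 : ∑ a, ∑ i, f i a = ∑ a, ∑ i, f a i := Finset.sum_comm
  simp only [fun a i => ip_rho_eq_slot₁ (skewE a i) hW (hX a i), h1, mul_sub, mul_neg,
    Finset.sum_sub_distrib, Finset.sum_neg_distrib, ← Finset.mul_sum]
  rw [h2, h3]; ring

/-- The Gram matrix of the derivatives of `W` by the elements of `so(n)`. -/
def soGram (W : T4 n) : Matrix (Pairs n) (Pairs n) ℝ :=
  fun p q => ip (rho (skewE p.1.1 p.1.2) W) (rho (skewE q.1.1 q.1.2) W)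

/-- The matrix of an algebraic curvature tensor as a bilinear form on `Λ²`. -/
def pairForm (R : T4 n) : Matrix (Pairs n) (Pairs n) ℝ :=
  fun p q => R p.1.1 p.1.2 q.1.1 q.1.2

lemma curvTerm_one (R W : T4 n) :
    curvTerm 1 R W = fun i j k l => ∑ a, rho (Matrix.of (R a i)) W a j k l := by
  ext i j k l
  simp [curvTerm, Matrix.one_apply]

/-- Expand the skew matrix `Rm(e_a, e_i)` in the basis `skewE`: the trace is a sum over `a < i`,
which is half of the full sum in `sum_ip_rho_skewE`. Hence `-4` from `-8`. -/
lemma trace_pairForm_mul_soGram {R W : T4 n} (hR : HasPairSymm R) (hW : HasPairSymm W) :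
    (pairForm R * soGram W).trace = -4 * ip (curvTerm 1 R W) W := by
  have hRa : ∀ a i, (Matrix.of (R a i)) = - Matrix.of (R i a) := fun a i => by
    ext k l; exact hR.swap₁ a i k l
  have h1 := sum_ip_rho_skewE hW (X := fun a i => rho (Matrix.of (R a i)) W)
    (fun a i => hW.rho _) (fun a i => by rw [hRa a i, rho_neg_mat])
  have h2 := sum_pairs (f := fun a i => ip (rho (skewE a i) W) (rho (Matrix.of (R a i)) W))
    (fun a i => by rw [hRa a i, skewE_swap a i, rho_neg_mat, rho_neg_mat, ip_neg_left,
      ip_neg_right, neg_neg])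
    (fun a => by
      have : skewE a a = (0 : Matrix (Fin n) (Fin n) ℝ) := by simp [skewE]
      rw [this, show (0 : Matrix (Fin n) (Fin n) ℝ) = (0 : ℝ) • 0 by simp, rho_smul_mat, zero_smul,
        ip_zero_left])
  have h3 : (pairForm R * soGram W).trace =
      ∑ p : Pairs n, ip (rho (skewE p.1.1 p.1.2) W) (rho (Matrix.of (R p.1.1 p.1.2)) W) := by
    simp only [Matrix.trace, Matrix.diag, Matrix.mul_apply]
    refine Finset.sum_congr rfl fun p _ => ?_
    rw [← sum_pairs_skewE (X := Matrix.of (R p.1.1 p.1.2)) (hR.swap₂ p.1.1 p.1.2), rho_sum_mat,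
      ip_sum_right]
    refine Finset.sum_congr rfl fun q _ => ?_
    rw [rho_smul_mat, ip_smul_right, ip_comm]; rfl
  rw [h3, curvTerm_one]
  linarith

/-- The Casimir operator of `so(n)` on Weyl tensors. In `sum_ip_rho_skewE` with `X a i = rho (skewE
a i) W` the contraction collapses to `-(n-1) W`: trace-freeness removes the trace terms and the
first Bianchi identity combines the permuted copies. -/
lemma trace_soGram {W : T4 n} (hW : IsCurvatureLike W) (ht : tr₁₃ 1 W = 0) :
    (soGram W).trace = 4 * ((n : ℝ) - 1) * ip W W := by
  have hs := hW.hasPairSymm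
  have h1 := sum_ip_rho_skewE hs (X := fun a i => rho (skewE a i) W)
    (fun a i => hs.rho _) (fun a i => by rw [skewE_swap a i, rho_neg_mat])
  have h2 := sum_pairs (f := fun a i => ip (rho (skewE a i) W) (rho (skewE a i) W))
    (fun a i => by rw [skewE_swap a i, rho_neg_mat, ip_neg_left, ip_neg_right, neg_neg])
    (fun a => by
      have : skewE a a = (0 : Matrix (Fin n) (Fin n) ℝ) := by simp [skewE]
      rw [this, show (0 : Matrix (Fin n) (Fin n) ℝ) = (0 : ℝ) • 0 by simp, rho_smul_mat, zero_smul,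
        ip_zero_left])
  have htr : ∀ j l, ∑ a, W a j a l = 0 := by
    intro j l
    have := congrFun (congrFun ht j) l
    simpa [tr₁₃, Matrix.one_apply] using this
  have h0 : ∀ k l, ∑ a, W a a k l = 0 := fun k l =>
    Finset.sum_eq_zero fun a _ => by linarith [hW.swap₁ a a k l]
  have htr' : ∀ j k, ∑ a, W a j k a = 0 := fun j k => by
    rw [← neg_eq_zero, ← htr j k, ← Finset.sum_neg_distrib]
    exact Finset.sum_congr rfl fun a _ => by rw [hW.swap₂ a j k a, neg_neg]
  have h3 : (fun i j k l => ∑ a, rho (skewE a i) W a j k l) = (-((n : ℝ) - 1)) • W := by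
    ext i j k l
    have e1 : ∑ a, slot₁ (skewE a i) W a j k l = W i j k l - n * W i j k l := by
      simp [slot₁_skewE, Finset.sum_sub_distrib]
    have e2 : ∑ a, slot₂ (skewE a i) W a j k l = - W j i k l := by
      simp only [slot₂, skewE_apply, sub_mul, Finset.sum_sub_distrib, ite_and, ite_mul, one_mul,
        zero_mul]
      by_cases h : i = j <;> simp [h, h0]
    have e3 : ∑ a, slot₃ (skewE a i) W a j k l = - W k j i l := by
      simp only [slot₃, skewE_apply, sub_mul, Finset.sum_sub_distrib, ite_and, ite_mul, one_mul,
        zero_mul]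
      by_cases h : i = k <;> simp [h, htr]
    have e4 : ∑ a, slot₄ (skewE a i) W a j k l = - W l j k i := by
      simp only [slot₄, skewE_apply, sub_mul, Finset.sum_sub_distrib, ite_and, ite_mul, one_mul,
        zero_mul]
      by_cases h : i = l <;> simp [h, htr']
    simp only [rho, Pi.add_apply, Finset.sum_add_distrib, e1, e2, e3, e4, Pi.smul_apply,
      smul_eq_mul]
    linarith [hW.cyclic i j k l, hW.pair k j i l, hW.swap₁ l i k j, hW.swap₁ l j k i,
      hW.swap₁ j i k l]
  rw [h3, ip_smul_left] at h1
  have h4 : (soGram W).trace = ∑ p : Pairs n, ip (rho (skewE p.1.1 p.1.2) W)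
    (rho (skewE p.1.1 p.1.2) W) := rfl
  rw [h4]
  linarith

lemma ip_add_self_le (A B : T4 n) : ip (A + B) (A + B) ≤ 2 * ip A A + 2 * ip B B := by
  have h := ip_self_nonneg (A - B)
  rw [ip_sub_left, ip_sub_right, ip_sub_right, ip_comm B A] at h
  rw [ip_add_left, ip_add_right, ip_add_right, ip_comm B A]
  linarith

/-- For fixed `k, l` the entries of `W` form a skew matrix `X`, and the action on the first two
slots is the commutator `X L - L X`. -/
lemma ip_slot₁₂_le {L : Matrix (Fin n) (Fin n) ℝ} (hL : L.transpose = -L) {W : T4 n}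
    (hW : ∀ i j k l, W i j k l = - W j i k l) :
    ip (slot₁ L W + slot₂ L W) (slot₁ L W + slot₂ L W) ≤ (∑ i, ∑ j, L i j ^ 2) * ip W W := by
  have hr : ∀ T : T4 n, ip T T = ∑ k, ∑ l, ∑ i, ∑ j, T i j k l ^ 2 := by
    intro T
    rw [ip_pair]
    simp only [ip, sq]
  have hL' : ∀ i j, L i j = - L j i := fun i j => by
    simpa using congrFun (congrFun hL j) i
  rw [hr, hr, Finset.mul_sum]
  refine Finset.sum_le_sum fun k _ => ?_
  rw [Finset.mul_sum]
  refine Finset.sum_le_sum fun l _ => ?_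
  obtain ⟨X, hXW⟩ : ∃ X : Matrix (Fin n) (Fin n) ℝ, ∀ i j, X i j = W i j k l := ⟨_, fun _ _ => rfl⟩
  have hX : X.transpose = -X := by
    ext i j
    rw [Matrix.transpose_apply, Matrix.neg_apply, hXW, hXW, hW j i k l]
  have h := frobenius_commutator_le hL hX
  simp only [hXW] at h
  refine le_trans (le_of_eq ?_) h
  refine Finset.sum_congr rfl fun i _ => Finset.sum_congr rfl fun j _ => ?_
  congr 1
  rw [Matrix.sub_apply, Matrix.mul_apply, Matrix.mul_apply, Pi.add_apply, Pi.add_apply,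
    Pi.add_apply, Pi.add_apply, slot₁, slot₂, ← Finset.sum_add_distrib, ← Finset.sum_sub_distrib]
  refine Finset.sum_congr rfl fun p _ => ?_
  rw [hL' p i, hXW, hXW]; ring

/-- The slots `1, 2` and the slots `3, 4` contribute vectors of equal norm, by the pair symmetry;
adding two such vectors costs the factor `4`. -/
lemma ip_rho_self_le {L : Matrix (Fin n) (Fin n) ℝ} (hL : L.transpose = -L) {W : T4 n}
    (hW : HasPairSymm W) :
    ip (rho L W) (rho L W) ≤ 4 * (∑ i, ∑ j, L i j ^ 2) * ip W W := by
  have h1 := ip_slot₁₂_le hL hW.swap₁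
  have h2 : ip (slot₃ L W + slot₄ L W) (slot₃ L W + slot₄ L W) =
      ip (slot₁ L W + slot₂ L W) (slot₁ L W + slot₂ L W) := by
    rw [ip_pair]
    have : (fun i j k l => (slot₃ L W + slot₄ L W) k l i j) = slot₁ L W + slot₂ L W := by
      ext i j k l
      simp only [Pi.add_apply, slot₁, slot₂, slot₃, slot₄, ← Finset.sum_add_distrib]
      exact Finset.sum_congr rfl fun p _ => by rw [hW.pair p j, hW.pair i p]
    rw [this]
  have h3 : rho L W = (slot₁ L W + slot₂ L W) + (slot₃ L W + slot₄ L W) := by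
    rw [rho]; abel
  rw [h3]
  refine (ip_add_self_le _ _).trans ?_
  rw [h2]
  linarith

lemma dotProduct_soGram (W : T4 n) (v : Pairs n → ℝ) :
    v ⬝ᵥ (soGram W).mulVec v = ip (rho (∑ p, v p • skewE p.1.1 p.1.2) W)
      (rho (∑ p, v p • skewE p.1.1 p.1.2) W) := by
  simp only [rho_sum_mat, rho_smul_mat, ip_sum_left, ip_sum_right, ip_smul_left, ip_smul_right,
    dotProduct, Matrix.mulVec, soGram, Finset.mul_sum]
  exact Finset.sum_congr rfl fun _ _ => Finset.sum_congr rfl fun _ _ => by rw [ip_comm]; ring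

lemma sum_smul_skewE_apply (v : Pairs n → ℝ) (p : Pairs n) :
    (∑ q, v q • skewE q.1.1 q.1.2 : Matrix (Fin n) (Fin n) ℝ) p.1.1 p.1.2 = v p := by
  rw [Matrix.sum_apply, Finset.sum_eq_single p]
  · have := p.2.ne
    simp [skewE_apply, this]
  · intro q _ hq
    have h1 : ¬ (q.1.1 = p.1.1 ∧ q.1.2 = p.1.2) := fun h => hq (Subtype.ext (Prod.ext h.1 h.2))
    have h2 : ¬ (q.1.2 = p.1.1 ∧ q.1.1 = p.1.2) := fun h => by
      have e1 := q.2; have e2 := p.2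
      rw [h.1, h.2] at e1
      exact absurd e1 e2.not_gt
    simp [skewE_apply, h1, h2]
  · simp

/-- The Frobenius norm counts every pair twice, so `‖L‖² = 2 |v|²` and the constant is `8`. Compared
with `trace_soGram`, the trace is `(n-1)/2` times this bound, which is where the number of
eigenvalues comes from. -/
lemma dotProduct_soGram_le {W : T4 n} (hW : HasPairSymm W) (v : Pairs n → ℝ) :
    v ⬝ᵥ (soGram W).mulVec v ≤ 8 * ip W W * (v ⬝ᵥ v) := by
  set L : Matrix (Fin n) (Fin n) ℝ := ∑ p, v p • skewE p.1.1 p.1.2 with hLdef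
  have hL : L.transpose = -L := by
    rw [hLdef, Matrix.transpose_sum, ← Finset.sum_neg_distrib]
    refine Finset.sum_congr rfl fun p _ => ?_
    rw [Matrix.transpose_smul, ← smul_neg, ← skewE_swap, skewE, Matrix.transpose_sub,
      Matrix.transpose_single, Matrix.transpose_single, skewE]
  have hL' : ∀ i j, L i j = - L j i := fun i j => by
    simpa using congrFun (congrFun hL j) i
  have h1 : ∑ i, ∑ j, L i j ^ 2 = 2 * (v ⬝ᵥ v) := by
    rw [sum_pairs (f := fun i j => L i j ^ 2) (fun i j => by rw [hL' i j]; ring)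
      (fun i => by have := hL' i i; have : L i i = 0 := by linarith
                   simp [this])]
    congr 1
    simp only [dotProduct]
    exact Finset.sum_congr rfl fun p _ => by rw [hLdef, sum_smul_skewE_apply, sq]
  rw [dotProduct_soGram]
  refine (ip_rho_self_le hL hW).trans (le_of_eq ?_)
  rw [h1]; ring

/-- The estimate of the curvature term by the sum of the lowest eigenvalues. -/
lemma curvTerm_estimate (hn : 4 ≤ n) {R W : T4 n} (hR : IsCurvatureLike R)
    (hW : IsCurvatureLike W) (ht : tr₁₃ 1 W = 0) :
    4 * ((n : ℝ) - 1) * ip W W / ((n - 1) / 2 : ℕ) *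
      (((pairForm R).charpoly.roots.sort (· ≤ ·)).take ((n - 1) / 2)).sum ≤
      -4 * ip (curvTerm 1 R W) W := by
  set k : ℕ := (n - 1) / 2 with hk
  have hk0 : 0 < k := by omega
  have hk0' : (0 : ℝ) < k := by exact_mod_cast hk0
  have hk2 : 2 * (k : ℝ) ≤ n - 1 := by
    have : 2 * k + 1 ≤ n := by omega
    have : (2 * (k : ℝ) + 1) ≤ n := by exact_mod_cast this
    linarith
  rw [← trace_pairForm_mul_soGram hR.hasPairSymm hW.hasPairSymm]
  -- The constant `c` is the trace of the Gram matrix divided by `k`; it dominates `8 |W|²` exactly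
  -- because `2 k ≤ n - 1`.
  refine trace_mul_ge_sum_lowest ?_ hk0 ?_ ?_ ?_
  · ext p q
    exact hR.pair _ _ _ _
  · rw [trace_soGram hW ht]; field_simp
  · intro v
    rw [dotProduct_soGram]; exact ip_self_nonneg _
  · intro v
    refine (dotProduct_soGram_le hW.hasPairSymm v).trans ?_
    refine mul_le_mul_of_nonneg_right ?_ (Finset.sum_nonneg fun _ _ => mul_self_nonneg _)
    rw [le_div_iff₀ hk0']
    nlinarith [ip_self_nonneg W]

/-! ### Passing to an orthonormal basis -/

lemma rho_act {A A' B : Matrix (Fin n) (Fin n) ℝ} (h : A' * B = B * A) (W : T4 n) :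
    rho A (act B W) = act B (rho A' W) := by
  simp only [rho, act, slot₁_add, slot₂_add, slot₃_add, slot₄_add, slot₂_slot₁, slot₃_slot₁,
    slot₄_slot₁, slot₃_slot₂, slot₄_slot₂, slot₄_slot₃, slot₁_slot₁, slot₂_slot₂, slot₃_slot₃,
    slot₄_slot₄, h]

/-- The action of a matrix on three indices, as a linear map. -/
def act₃ (B : Matrix (Fin n) (Fin n) ℝ) :
    (Fin n → Fin n → Fin n → ℝ) →ₗ[ℝ] (Fin n → Fin n → Fin n → ℝ) where
  toFun t := fun j k l => ∑ b, B b j * ∑ c, B c k * ∑ d, B d l * t b c d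
  map_add' s t := by ext; simp [mul_add, Finset.sum_add_distrib]
  map_smul' c t := by ext; simp [Finset.mul_sum, mul_left_comm]

lemma act_eq_act₃ (B : Matrix (Fin n) (Fin n) ℝ) (T : T4 n) (i : Fin n) :
    act B T i = ∑ p, B p i • act₃ B (T p) := by
  ext j k l
  simp only [Finset.sum_apply, Pi.smul_apply, smul_eq_mul]
  rfl

lemma of_act_apply (B : Matrix (Fin n) (Fin n) ℝ) (R : T4 n) (a i : Fin n) :
    Matrix.of (act B R a i) =
      ∑ p, ∑ q, (B p a * B q i) • (B.transpose * Matrix.of (R p q) * B) := by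
  ext k l
  simp only [Matrix.sum_apply, Matrix.smul_apply, smul_eq_mul, Matrix.mul_assoc]
  simp only [Matrix.of_apply, act, slot₁, slot₂, slot₃, slot₄, Matrix.mul_apply,
    Matrix.transpose_apply, Finset.mul_sum]
  refine Finset.sum_congr rfl fun _ _ => Finset.sum_congr rfl fun _ _ =>
    Finset.sum_congr rfl fun _ _ => Finset.sum_congr rfl fun _ _ => by ring

/-- Naturality of the curvature term: if `B * B.transpose` is the inverse metric, passing to the
frame `B` makes every contraction Euclidean, so that `curvTerm_estimate` applies. -/
lemma curvTerm_act (B : Matrix (Fin n) (Fin n) ℝ) (R W : T4 n) :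
    act B (curvTerm (B * B.transpose) R W) = curvTerm 1 (act B R) (act B W) := by
  set h := B * B.transpose with hh
  set Z : Fin n → Fin n → T4 n := fun a i => rho (h * Matrix.of (R a i)) W with hZ
  have hV : ∀ i, curvTerm h R W i = ∑ a, ∑ m, h a m • Z a i m := by
    intro i
    ext j k l
    simp only [curvTerm, Finset.sum_apply, Pi.smul_apply, smul_eq_mul]
    rfl
  have hr : ∀ a i, rho (Matrix.of (act B R a i)) (act B W) =
      ∑ p, ∑ q, (B p a * B q i) • act B (Z p q) := by
    intro a i
    rw [rho_act (A' := ∑ p, ∑ q, (B p a * B q i) • (h * Matrix.of (R p q)))]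
    · simp only [rho_sum_mat, rho_smul_mat, act_sum, act_smul, hZ]
    · simp only [of_act_apply, Finset.sum_mul, Finset.mul_sum, hh, Matrix.smul_mul,
        Matrix.mul_smul, Matrix.mul_assoc]
  ext i j k l
  rw [act_eq_act₃]
  simp only [hV, map_sum, map_smul, curvTerm_one, hr]
  simp only [Finset.sum_apply, Pi.smul_apply, smul_eq_mul, act_eq_act₃]
  have hhm : ∀ a m, h a m = ∑ c, B a c * B m c := fun a m => by
    rw [hh, Matrix.mul_apply]; rfl
  simp only [hhm, Finset.sum_mul, Finset.mul_sum]
  -- reorder `q, p, m, c` to `c, p, q, m`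
  calc _ = ∑ q, ∑ p, ∑ c, ∑ m, B q i * (B p c * B m c * (act₃ B) (Z p q m) j k l) :=
        Finset.sum_congr rfl fun _ _ => Finset.sum_congr rfl fun _ _ => Finset.sum_comm
    _ = ∑ q, ∑ c, ∑ p, ∑ m, B q i * (B p c * B m c * (act₃ B) (Z p q m) j k l) :=
        Finset.sum_congr rfl fun _ _ => Finset.sum_comm
    _ = ∑ c, ∑ q, ∑ p, ∑ m, B q i * (B p c * B m c * (act₃ B) (Z p q m) j k l) :=
        Finset.sum_comm
    _ = ∑ c, ∑ p, ∑ q, ∑ m, B q i * (B p c * B m c * (act₃ B) (Z p q m) j k l) :=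
        Finset.sum_congr rfl fun _ _ => Finset.sum_comm
    _ = _ := Finset.sum_congr rfl fun _ _ => Finset.sum_congr rfl fun _ _ =>
        Finset.sum_congr rfl fun _ _ => Finset.sum_congr rfl fun _ _ => by ring

/-- The second compound matrix. -/
def compound₂ (B : Matrix (Fin n) (Fin n) ℝ) : Matrix (Pairs n) (Pairs n) ℝ :=
  fun p q => B p.1.1 q.1.1 * B p.1.2 q.1.2 - B p.1.1 q.1.2 * B p.1.2 q.1.1

/-- On skew arrays, stored by their entries with `a < b`, the second compound is the action of `A`
on both indices. -/
lemma sum_compound₂ (A : Matrix (Fin n) (Fin n) ℝ) {X : Fin n → Fin n → ℝ}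
    (hX : ∀ a b, X a b = - X b a) (p : Pairs n) :
    ∑ q, compound₂ A q p * X q.1.1 q.1.2 = ∑ a, A a p.1.1 * ∑ b, A b p.1.2 * X a b := by
  have h := sum_pairs (f := fun a b => (A a p.1.1 * A b p.1.2 - A a p.1.2 * A b p.1.1) * X a b)
    (fun a b => by rw [hX a b]; ring) (fun a => by ring)
  have h2 : ∑ a, ∑ b, (A a p.1.1 * A b p.1.2 - A a p.1.2 * A b p.1.1) * X a b =
      2 * ∑ a, ∑ b, A a p.1.1 * (A b p.1.2 * X a b) := by
    have h3 : ∑ a, ∑ b, A a p.1.2 * A b p.1.1 * X a b =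
        - ∑ a, ∑ b, A a p.1.1 * (A b p.1.2 * X a b) := by
      rw [Finset.sum_comm]
      simp only [← Finset.sum_neg_distrib]
      exact Finset.sum_congr rfl fun a _ => Finset.sum_congr rfl fun b _ => by rw [hX b a]; ring
    simp only [sub_mul, Finset.sum_sub_distrib, h3]
    rw [two_mul, sub_neg_eq_add]
    congr 1
    exact Finset.sum_congr rfl fun a _ => Finset.sum_congr rfl fun b _ => by ring
  simp only [Finset.mul_sum]
  simp only [compound₂]
  linarith

/-- A case of the Cauchy–Binet formula, the functoriality of `Λ²`. -/
lemma compound₂_mul_transpose (B : Matrix (Fin n) (Fin n) ℝ) :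
    compound₂ (B * B.transpose) = compound₂ B * (compound₂ B).transpose := by
  ext p q
  rw [Matrix.mul_apply]
  have h := sum_compound₂ B.transpose (X := fun a b => B q.1.1 a * B q.1.2 b - B q.1.1 b * B q.1.2 a)
    (fun a b => by ring) p
  have h2 : ∀ r, compound₂ B p r = compound₂ B.transpose r p := fun r => by
    simp only [compound₂, Matrix.transpose_apply]; ring
  simp only [h2, Matrix.transpose_apply]
  simp only [← h2]
  rw [show ∑ r, compound₂ B p r * compound₂ B q r = ∑ r : Pairs n, compound₂ B.transpose r p *
    (B q.1.1 r.1.1 * B q.1.2 r.1.2 - B q.1.1 r.1.2 * B q.1.2 r.1.1) from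
    Finset.sum_congr rfl fun r _ => by rw [h2]; rfl, h]
  simp only [compound₂, Matrix.mul_apply, Matrix.transpose_apply, Finset.sum_mul, Finset.mul_sum]
  rw [Finset.sum_comm, Finset.sum_comm (f := fun x i => B p.1.1 i * B q.1.2 i * _),
    ← Finset.sum_sub_distrib]
  refine Finset.sum_congr rfl fun a _ => ?_
  rw [← Finset.sum_sub_distrib]
  exact Finset.sum_congr rfl fun b _ => by ring

lemma pairForm_act (B : Matrix (Fin n) (Fin n) ℝ) {R : T4 n} (hR : HasPairSymm R) :
    pairForm (act B R) = (compound₂ B).transpose * pairForm R * compound₂ B := by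
  ext p q
  have h1 : ∀ a b, ∑ r, compound₂ B r q * R a b r.1.1 r.1.2 =
      slot₃ B (slot₄ B R) a b q.1.1 q.1.2 := fun a b => sum_compound₂ B (hR.swap₂ a b) q
  have hs : ∀ a b k l, slot₃ B (slot₄ B R) a b k l = - slot₃ B (slot₄ B R) b a k l := by
    intro a b k l
    simp only [slot₃, slot₄, hR.swap₁ a b, mul_neg, Finset.sum_neg_distrib]
  have h2 := sum_compound₂ B (X := fun a b => slot₃ B (slot₄ B R) a b q.1.1 q.1.2)
    (fun a b => hs a b _ _) p
  rw [Matrix.mul_assoc, Matrix.mul_apply]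
  refine Eq.trans (Eq.trans ?_ h2.symm) ?_
  · rfl
  · refine Finset.sum_congr rfl fun r _ => ?_
    rw [Matrix.transpose_apply, ← h1, Matrix.mul_apply]
    congr 1
    exact Finset.sum_congr rfl fun s _ => mul_comm _ _

/-! ### Orthonormal frames: eigenvalues, norms and the Bochner inequality. -/

namespace MetricOn

variable {g : Coord n → Matrix (Fin n) (Fin n) ℝ} {U : Set (Coord n)} {x : Coord n}

/-- `B` is an orthogonal matrix diagonalising `g⁻¹`, times the square roots of the eigenvalues. Its
columns are the components of an orthonormal frame. -/
lemma exists_frame (hg : MetricOn g U) (hx : x ∈ U) :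
    ∃ B : Matrix (Fin n) (Fin n) ℝ, (g x)⁻¹ = B * B.transpose ∧ IsUnit B.det := by
  have hp := (hg.posDef x hx).inv
  set V : Matrix (Fin n) (Fin n) ℝ := (hp.isHermitian.eigenvectorUnitary : Matrix (Fin n) (Fin n) ℝ)
    with hV
  set lam := hp.isHermitian.eigenvalues with hlam
  have hspec : (g x)⁻¹ = V * Matrix.diagonal lam * V.transpose := by
    have := hp.isHermitian.spectral_theorem
    rw [Unitary.conjStarAlgAut_apply] at this
    exact this
  have h : (g x)⁻¹ = (V * Matrix.diagonal fun i => Real.sqrt (lam i)) *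
      (V * Matrix.diagonal fun i => Real.sqrt (lam i)).transpose := by
    rw [Matrix.transpose_mul, Matrix.diagonal_transpose, Matrix.mul_assoc,
      ← Matrix.mul_assoc (Matrix.diagonal _), Matrix.diagonal_mul_diagonal, ← Matrix.mul_assoc]
    conv_lhs => rw [hspec]
    congr 3
    ext i
    exact (Real.mul_self_sqrt (hp.eigenvalues_pos i).le).symm
  refine ⟨_, h, ?_⟩
  have hd := hp.det_pos
  rw [h, Matrix.det_mul, Matrix.det_transpose] at hd
  exact IsUnit.mk0 _ fun h0 => by rw [h0] at hd; simp at hd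

/-- In the coordinate basis the operator is `Λ²(g⁻¹)` times the form of `Rm`, in general not
symmetric. With `C = compound₂ B` it is `C Cᵀ R`, which has the characteristic polynomial of the
symmetric matrix `Cᵀ R C` of `Rm` in the frame. -/
lemma charpoly_curvatureOperator (hg : MetricOn g U) (hx : x ∈ U) {B : Matrix (Fin n) (Fin n) ℝ}
    (hB : (g x)⁻¹ = B * B.transpose) :
    (curvatureOperator g x).charpoly = (pairForm (act B (riemF g x))).charpoly := by
  have hR := (hg.isCurvatureLike_riemF hx).hasPairSymm
  have h1 : curvatureOperator g x = compound₂ (g x)⁻¹ * pairForm (riemF g x) := by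
    ext p q
    have h := sum_compound₂ (g x)⁻¹ (X := riemF g x q.1.1 q.1.2) (hR.swap₂ q.1.1 q.1.2) p
    rw [Matrix.mul_apply]
    have h2 : ∀ r, compound₂ (g x)⁻¹ p r = compound₂ (g x)⁻¹ r p := fun r => by
      simp only [compound₂, hg.inv_symm hx p.1.1, hg.inv_symm hx p.1.2]; ring
    rw [show ∑ r, compound₂ (g x)⁻¹ p r * pairForm (riemF g x) r q =
      ∑ r, compound₂ (g x)⁻¹ r p * riemF g x q.1.1 q.1.2 r.1.1 r.1.2 from
        Finset.sum_congr rfl fun r _ => by rw [h2, pairForm, hR.pair], h]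
    simp only [curvatureOperator, Finset.mul_sum]
    refine Finset.sum_congr rfl fun a _ => Finset.sum_congr rfl fun b _ => ?_
    rw [hg.inv_symm hx p.1.1 a, hg.inv_symm hx p.1.2 b, mul_assoc]; rfl
  rw [h1, hB, compound₂_mul_transpose, Matrix.mul_assoc, Matrix.charpoly_mul_comm,
    ← pairForm_act B hR]

lemma ip_act_frame {h B : Matrix (Fin n) (Fin n) ℝ} (hB : h = B * B.transpose) (S T : T4 n) :
    ip S (act h T) = ip (act B S) (act B T) := by
  rw [hB, ← act_act, ip_act]

lemma weylNormSq_nonneg (hg : MetricOn g U) (hx : x ∈ U) : 0 ≤ weylNormSq g x := by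
  obtain ⟨B, hB, -⟩ := hg.exists_frame hx
  rw [weylNormSq, ip_act_frame hB]
  exact ip_self_nonneg _

lemma act_injective {B : Matrix (Fin n) (Fin n) ℝ} (hB : IsUnit B.det) {T : T4 n}
    (h : act B T = 0) : T = 0 := by
  rw [← act_one T, ← Matrix.mul_nonsing_inv B hB, ← act_act, h, act_zero]

lemma weylF_eq_zero (hg : MetricOn g U) (hx : x ∈ U) (h : weylNormSq g x = 0) :
    weylF g x = 0 := by
  obtain ⟨B, hB, hu⟩ := hg.exists_frame hx
  rw [weylNormSq, ip_act_frame hB] at h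
  exact act_injective hu (eq_zero_of_ip_self _ h)

lemma covWeylNormSq_eq_sum {B : Matrix (Fin n) (Fin n) ℝ}
    (hB : (g x)⁻¹ = B * B.transpose) :
    covWeylNormSq g x = ∑ c, ip (act B (∑ m, B m c • cov g m (weylF g) x))
      (act B (∑ m, B m c • cov g m (weylF g) x)) := by
  have hhm : ∀ a m, (g x)⁻¹ a m = ∑ c, B a c * B m c := fun a m => by
    rw [hB, Matrix.mul_apply]; rfl
  simp only [covWeylNormSq, ip_act_frame hB, act_sum, act_smul, ip_sum_left, ip_sum_right,
    ip_smul_left, ip_smul_right]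
  simp only [hhm, Finset.sum_mul, Finset.mul_sum]
  calc _ = ∑ a, ∑ c, ∑ m, B a c * B m c * ip (act B (cov g m (weylF g) x))
          (act B (cov g a (weylF g) x)) := Finset.sum_congr rfl fun _ _ => Finset.sum_comm
    _ = ∑ c, ∑ a, ∑ m, B a c * B m c * ip (act B (cov g m (weylF g) x))
          (act B (cov g a (weylF g) x)) := Finset.sum_comm
    _ = ∑ c, ∑ m, ∑ a, B a c * B m c * ip (act B (cov g m (weylF g) x))
          (act B (cov g a (weylF g) x)) := Finset.sum_congr rfl fun _ _ => Finset.sum_comm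
    _ = _ := Finset.sum_congr rfl fun _ _ => Finset.sum_congr rfl fun _ _ =>
        Finset.sum_congr rfl fun _ _ => by rw [ip_comm]; ring

lemma covWeylNormSq_nonneg (hg : MetricOn g U) (hx : x ∈ U) : 0 ≤ covWeylNormSq g x := by
  obtain ⟨B, hB, -⟩ := hg.exists_frame hx
  rw [covWeylNormSq_eq_sum hB]
  exact Finset.sum_nonneg fun _ _ => ip_self_nonneg _

/-- As a sum of squares the norm controls `∇_{e_c} W` for every frame vector `e_c`; the inverse of
`B` returns to the coordinate directions. -/
lemma cov_weylF_eq_zero (hg : MetricOn g U) (hx : x ∈ U) (h : covWeylNormSq g x = 0) (m : Fin n) :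
    cov g m (weylF g) x = 0 := by
  obtain ⟨B, hB, hu⟩ := hg.exists_frame hx
  rw [covWeylNormSq_eq_sum hB, Finset.sum_eq_zero_iff_of_nonneg fun _ _ => ip_self_nonneg _] at h
  have h1 : ∀ c, ∑ m, B m c • cov g m (weylF g) x = 0 := fun c =>
    act_injective hu (eq_zero_of_ip_self _ (h c (Finset.mem_univ c)))
  have h2 : ∑ c, B⁻¹ c m • ∑ p, B p c • cov g p (weylF g) x = 0 := by simp [h1]
  simp only [Finset.smul_sum, smul_smul] at h2
  rw [Finset.sum_comm] at h2
  have h3 : ∀ p, ∑ c, B⁻¹ c m * B p c = if p = m then 1 else 0 := fun p => by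
    have := congrFun (congrFun (Matrix.mul_nonsing_inv B hu) p) m
    rw [Matrix.mul_apply, Matrix.one_apply] at this
    rw [← this]
    exact Finset.sum_congr rfl fun _ _ => mul_comm _ _
  simpa only [← Finset.sum_smul, h3, ite_smul, one_smul, zero_smul, Finset.sum_ite_eq',
    Finset.mem_univ, if_true] using h2

/-- The Bochner inequality. -/
lemma bochner_inequality (hn : 4 ≤ n) (hg : MetricOn g U)
    (hdiv : ∀ y ∈ U, ∀ j k l, divergence g (weyl g) j k l y = 0) (hx : x ∈ U) :
    2 * covWeylNormSq g x + 4 * ((n : ℝ) - 1) * weylNormSq g x / ((n - 1) / 2 : ℕ) *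
      lowestEigenvalueSum g ((n - 1) / 2) x ≤ laplacian g (weylNormSq g) x := by
  obtain ⟨B, hB, hu⟩ := hg.exists_frame hx
  have hW := (hg.isCurvatureLike_weylF hn hx).act B
  have hR := (hg.isCurvatureLike_riemF hx).act B
  have ht : tr₁₃ 1 (act B (weylF g x)) = 0 := by
    rw [tr₁₃_act, mul_one, ← hB, hg.tr₁₃_weylF hn hx]; simp
  have h := curvTerm_estimate hn hR hW ht
  rw [hg.bochner hn hdiv hx, ip_act_frame hB]
  conv_rhs => rw [hB, curvTerm_act]
  rw [lowestEigenvalueSum, curvatureEigenvalues, hg.charpoly_curvatureOperator hx hB, weylNormSq,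
    ip_act_frame hB]
  linarith

end MetricOn

/-! ### The strong maximum principle -/

section SecondDerivative

variable {U : Set (Coord n)} {w : Coord n → ℝ} {q : Coord n}

lemma hasDerivAt_line {f : Coord n → ℝ} (v : Coord n) (t : ℝ)
    (hf : DifferentiableAt ℝ f (q + t • v)) :
    HasDerivAt (fun s : ℝ => f (q + s • v)) (∑ k, v k * pderiv k f (q + t • v)) t := by
  have h1 : HasDerivAt (fun s : ℝ => q + s • v) v t := by
    simpa using ((hasDerivAt_id t).smul_const v).const_add q
  have h2 := hf.hasFDerivAt.comp_hasDerivAt t h1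
  rwa [fderiv_eq_sum_pderiv] at h2

/-- Restrict to a line. If the second derivative were positive, the point would also be a local
minimum, so the restriction would be locally constant with zero second derivative. -/
lemma second_pderiv_nonpos_of_isLocalMax (hU : IsOpen U) (hw : ContDiffOn ℝ ∞ w U) (hq : q ∈ U)
    (hmax : IsLocalMax w q) (v : Coord n) :
    ∑ k, v k * ∑ a, v a * pderiv a (pderiv k w) q ≤ 0 := by
  set φ : ℝ → ℝ := fun s => w (q + s • v) with hφ
  have hcont : Continuous fun s : ℝ => q + s • v := by fun_prop
  have hev : ∀ᶠ t : ℝ in nhds 0, q + t • v ∈ U :=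
    hcont.continuousAt.preimage_mem_nhds (by simpa using hU.mem_nhds hq)
  have hd1 : ∀ᶠ t : ℝ in nhds 0, deriv φ t = ∑ k, v k * pderiv k w (q + t • v) :=
    hev.mono fun t ht => (hasDerivAt_line v t (diffAt_of_smooth hw hU ht)).deriv
  have hd2 : deriv (deriv φ) 0 = ∑ k, v k * ∑ a, v a * pderiv a (pderiv k w) q := by
    rw [Filter.EventuallyEq.deriv_eq hd1]
    have : HasDerivAt (fun t : ℝ => ∑ k, v k * pderiv k w (q + t • v))
        (∑ k, v k * ∑ a, v a * pderiv a (pderiv k w) (q + (0 : ℝ) • v)) 0 := by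
      refine HasDerivAt.fun_sum fun k _ => HasDerivAt.const_mul _ (hasDerivAt_line v 0 ?_)
      exact diffAt_of_smooth (contDiffOn_pderiv hU hw k) hU (by simpa using hq)
    simpa using this.deriv
  have hmax' : IsLocalMax φ 0 := by
    have h := hcont.continuousAt (x := 0)
    have : Filter.Tendsto (fun s : ℝ => q + s • v) (nhds 0) (nhds q) := by simpa [ContinuousAt] using h
    have h3 := this.eventually hmax
    refine h3.mono fun t ht => ?_
    simpa [hφ] using ht
  by_contra hpos
  push Not at hpos
  rw [← hd2] at hpos
  have hc : ContinuousAt φ 0 :=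
    (hasDerivAt_line v 0 (diffAt_of_smooth hw hU (by simpa using hq))).continuousAt
  have hmin := isLocalMin_of_deriv_deriv_pos hpos hmax'.deriv_eq_zero hc
  have heq : φ =ᶠ[nhds 0] fun _ => φ 0 := by
    filter_upwards [hmin, hmax'] with t h1 h2 using le_antisymm h2 h1
  have : deriv (deriv φ) 0 = 0 := by
    rw [heq.deriv.deriv_eq]; simp
  linarith

/-- At a critical point the first-order terms drop out, and `g⁻¹ = B Bᵀ` makes the Laplacian a sum
of second derivatives along the columns of `B`. -/
lemma MetricOn.laplacian_nonpos_of_isLocalMax {g : Coord n → Matrix (Fin n) (Fin n) ℝ}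
    (hg : MetricOn g U) (hw : ContDiffOn ℝ ∞ w U) (hq : q ∈ U) (hmax : IsLocalMax w q) :
    laplacian g w q ≤ 0 := by
  obtain ⟨B, hB, -⟩ := hg.exists_frame hq
  have h0 : ∀ p, pderiv p w q = 0 := fun p => by simp [pderiv, hmax.fderiv_eq_zero]
  have h1 : laplacian g w q = ∑ c, ∑ k, B k c * ∑ a, B a c * pderiv a (pderiv k w) q := by
    have hhm : ∀ a m, (g q)⁻¹ a m = ∑ c, B a c * B m c := fun a m => by
      rw [hB, Matrix.mul_apply]; rfl
    simp only [laplacian, h0, mul_zero, Finset.sum_const_zero, sub_zero, hhm, Finset.sum_mul,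
      Finset.mul_sum]
    calc _ = ∑ a, ∑ c, ∑ k, B a c * B k c * pderiv a (pderiv k w) q :=
          Finset.sum_congr rfl fun _ _ => Finset.sum_comm
      _ = ∑ c, ∑ a, ∑ k, B a c * B k c * pderiv a (pderiv k w) q := Finset.sum_comm
      _ = ∑ c, ∑ k, ∑ a, B a c * B k c * pderiv a (pderiv k w) q :=
          Finset.sum_congr rfl fun _ _ => Finset.sum_comm
      _ = _ := Finset.sum_congr rfl fun _ _ => Finset.sum_congr rfl fun _ _ =>
          Finset.sum_congr rfl fun _ _ => by ring
  rw [h1]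
  refine Finset.sum_nonpos fun c _ => ?_
  simpa using second_pderiv_nonpos_of_isLocalMax hg.isOpen hw hq hmax (WithLp.toLp 2 fun k => B k c)

end SecondDerivative

section Barrier

variable (c : Coord n) (α : ℝ)

/-- The function `exp(-α |x - c|²)`. -/
def barrier (x : Coord n) : ℝ := Real.exp (-α * ∑ k, (x k - c k) ^ 2)

lemma contDiff_barrier : ContDiff ℝ ∞ (barrier c α) := by
  unfold barrier
  fun_prop

lemma pderiv_coord (k a : Fin n) (x : Coord n) :
    pderiv k (fun y : Coord n => y a) x = if a = k then 1 else 0 := by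
  have h : HasFDerivAt (fun y : Coord n => y a) (EuclideanSpace.proj a : Coord n →L[ℝ] ℝ) x :=
    (EuclideanSpace.proj a : Coord n →L[ℝ] ℝ).hasFDerivAt
  simp [pderiv, h.fderiv]

lemma pderiv_barrier (k : Fin n) (x : Coord n) :
    pderiv k (barrier c α) x = -2 * α * ((x k - c k) * barrier c α x) := by
  have hq : DifferentiableAt ℝ (fun y : Coord n => -α * ∑ k, (y k - c k) ^ 2) x := by fun_prop
  have h1 : pderiv k (barrier c α) x =
      barrier c α x * pderiv k (fun y : Coord n => -α * ∑ k, (y k - c k) ^ 2) x := by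
    simp only [pderiv]
    unfold barrier
    rw [fderiv_exp hq]
    simp
  have hc : ∀ a, DifferentiableAt ℝ (fun y : Coord n => y a - c a) x := fun a => by fun_prop
  have h3 : ∀ a, pderiv k (fun y : Coord n => y a - c a) x = if a = k then 1 else 0 := fun a => by
    rw [pderiv_sub k (by fun_prop) (by fun_prop), pderiv_const, pderiv_coord, sub_zero]
  rw [h1, pderiv_const_mul k _ (by fun_prop), pderiv_sum _ k fun a _ => by fun_prop]
  simp only [sq]
  rw [Finset.sum_congr rfl fun a _ => pderiv_mul k (hc a) (hc a)]
  simp only [h3, ite_mul, one_mul, zero_mul, mul_ite, mul_one, mul_zero, Finset.sum_add_distrib,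
    Finset.sum_ite_eq', Finset.mem_univ, if_true]
  ring

lemma pderiv_pderiv_barrier (a k : Fin n) (x : Coord n) :
    pderiv a (pderiv k (barrier c α)) x = barrier c α x *
      (4 * α ^ 2 * ((x a - c a) * (x k - c k)) - 2 * α * (if k = a then 1 else 0)) := by
  have hb : DifferentiableAt ℝ (barrier c α) x :=
    (contDiff_barrier c α).differentiable (by simp) x
  have hc : DifferentiableAt ℝ (fun y : Coord n => y k - c k) x := by fun_prop
  rw [show pderiv k (barrier c α) = fun y => -2 * α * ((y k - c k) * barrier c α y) from
    funext fun y => pderiv_barrier c α k y, pderiv_const_mul a _ (hc.fun_mul hb),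
    pderiv_mul a hc hb, pderiv_barrier, pderiv_sub a (by fun_prop) (by fun_prop), pderiv_const,
    pderiv_coord]
  ring

/-- Written so that the coefficient of `α ^ 2` is the quadratic form `g⁻¹` at `x - c`, positive away
from the centre, against a term linear in `α`. -/
lemma laplacian_barrier (g : Coord n → Matrix (Fin n) (Fin n) ℝ) (x : Coord n) :
    laplacian g (barrier c α) x = barrier c α x *
      (4 * α ^ 2 * (∑ a, ∑ m, (g x)⁻¹ a m * ((x a - c a) * (x m - c m))) -
        2 * α * ∑ a, ∑ m, (g x)⁻¹ a m *
          ((if m = a then 1 else 0) - ∑ p, christoffel g p a m x * (x p - c p))) := by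
  simp only [laplacian, pderiv_pderiv_barrier, pderiv_barrier, Finset.mul_sum,
    ← Finset.sum_sub_distrib]
  refine Finset.sum_congr rfl fun a _ => Finset.sum_congr rfl fun m _ => ?_
  have : ∑ p, christoffel g p a m x * (-2 * α * ((x p - c p) * barrier c α x)) =
      -2 * α * barrier c α x * ∑ p, christoffel g p a m x * (x p - c p) := by
    rw [Finset.mul_sum]; exact Finset.sum_congr rfl fun _ _ => by ring
  rw [this]; ring

end Barrier

/-! ### Hopf's barrier argument. -/

namespace MetricOn

variable {g : Coord n → Matrix (Fin n) (Fin n) ℝ} {U : Set (Coord n)} {u : Coord n → ℝ}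

lemma laplacian_add_mul (hg : MetricOn g U) {v : Coord n → ℝ} (hu : ContDiffOn ℝ ∞ u U)
    (hv : ContDiffOn ℝ ∞ v U) (ε : ℝ) {x : Coord n} (hx : x ∈ U) :
    laplacian g (fun y => u y + ε * v y) x = laplacian g u x + ε * laplacian g v x := by
  have hv' : ContDiffOn ℝ ∞ (fun y => ε * v y) U := contDiffOn_const.mul hv
  have h1 : ∀ p, ∀ y ∈ U, pderiv p (fun y => u y + ε * v y) y = pderiv p u y + ε * pderiv p v y := by
    intro p y hy
    rw [pderiv_add p (diffAt_of_smooth hu hg.isOpen hy) (diffAt_of_smooth hv' hg.isOpen hy),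
      pderiv_const_mul p ε (diffAt_of_smooth hv hg.isOpen hy)]
  have h2 : ∀ a p, pderiv a (pderiv p (fun y => u y + ε * v y)) x =
      pderiv a (pderiv p u) x + ε * pderiv a (pderiv p v) x := by
    intro a p
    have d1 := diffAt_of_smooth (contDiffOn_pderiv hg.isOpen hu p) hg.isOpen hx
    have d2 := diffAt_of_smooth (contDiffOn_pderiv hg.isOpen hv p) hg.isOpen hx
    rw [pderiv_congr hg.isOpen hx (h1 p), pderiv_add a d1 (d2.const_mul ε),
      pderiv_const_mul a ε d2]
  simp only [laplacian, h2, h1 _ x hx, Finset.mul_sum, ← Finset.sum_add_distrib]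
  refine Finset.sum_congr rfl fun a _ => Finset.sum_congr rfl fun m _ => ?_
  simp only [mul_add, Finset.sum_add_distrib]
  have : ∑ p, christoffel g p a m x * (ε * pderiv p v x) =
      ε * ∑ p, christoffel g p a m x * pderiv p v x := by
    rw [Finset.mul_sum]; exact Finset.sum_congr rfl fun _ _ => by ring
  rw [this]; ring

lemma inv_form_pos (hg : MetricOn g U) {x : Coord n} (hx : x ∈ U) {v : Fin n → ℝ} (hv : v ≠ 0) :
    0 < ∑ a, ∑ m, (g x)⁻¹ a m * (v a * v m) := by
  have h := (hg.posDef x hx).inv.dotProduct_mulVec_pos hv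
  simp only [star_trivial, dotProduct, Matrix.mulVec, Finset.mul_sum] at h
  refine lt_of_lt_of_eq h ?_
  exact Finset.sum_congr rfl fun _ _ => Finset.sum_congr rfl fun _ _ => by ring

/-- A barrier with positive Laplacian away from its centre. -/
lemma exists_barrier (hg : MetricOn g U) {K : Set (Coord n)} (hK : IsCompact K) (hKU : K ⊆ U)
    {c : Coord n} (hc : c ∉ K) : ∃ α > 0, ∀ x ∈ K, 0 < laplacian g (barrier c α) x := by
  rcases K.eq_empty_or_nonempty with rfl | hne
  · exact ⟨1, one_pos, by simp⟩
  set P : Coord n → ℝ := fun x => ∑ a, ∑ m, (g x)⁻¹ a m * ((x a - c a) * (x m - c m)) with hP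
  set Q : Coord n → ℝ := fun x => ∑ a, ∑ m, (g x)⁻¹ a m *
    ((if m = a then 1 else 0) - ∑ p, christoffel g p a m x * (x p - c p)) with hQ
  have hcoord : ∀ a, ContinuousOn (fun x : Coord n => x a - c a) U := fun a =>
    Continuous.continuousOn (by fun_prop)
  have hPc : ContinuousOn P U := continuousOn_finsetSum _ fun a _ => continuousOn_finsetSum _
    fun m _ => (hg.smooth_inv a m).continuousOn.mul ((hcoord a).mul (hcoord m))
  have hQc : ContinuousOn Q U := continuousOn_finsetSum _ fun a _ => continuousOn_finsetSum _
    fun m _ => (hg.smooth_inv a m).continuousOn.mul (continuousOn_const.sub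
      (continuousOn_finsetSum _ fun p _ =>
        (hg.smooth_christoffel p a m).continuousOn.mul (hcoord p)))
  obtain ⟨x₁, hx₁, hmin⟩ := hK.exists_isMinOn hne (hPc.mono hKU)
  obtain ⟨x₂, hx₂, hmax⟩ := hK.exists_isMaxOn hne (hQc.mono hKU)
  have hP1 : 0 < P x₁ := by
    refine hg.inv_form_pos (hKU hx₁) (v := fun a => x₁ a - c a) fun h => hc ?_
    have : x₁ = c := by
      ext a; exact sub_eq_zero.1 (congrFun h a)
    exact this ▸ hx₁
  -- With `P x₁` the minimum of `P` and `Q x₂` the maximum of `Q` on `K`, this makes `α P` at least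
  -- `|Q x₂| + 1`, so the quadratic term wins.
  refine ⟨(|Q x₂| + 1) / P x₁, by positivity, fun x hx => ?_⟩
  set α := (|Q x₂| + 1) / P x₁ with hα
  have hα0 : 0 < α := by positivity
  have h1 : α * P x₁ = |Q x₂| + 1 := by rw [hα]; field_simp
  have h2 : P x₁ ≤ P x := hmin hx
  have h3 : Q x ≤ Q x₂ := hmax hx
  rw [laplacian_barrier]
  refine mul_pos (Real.exp_pos _) ?_
  change 0 < 4 * α ^ 2 * P x - 2 * α * Q x
  have h4 : |Q x₂| + 1 ≤ α * P x := h1 ▸ mul_le_mul_of_nonneg_left h2 hα0.le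
  have h5 : Q x₂ ≤ |Q x₂| := le_abs_self _
  have h6 : 0 < 2 * (α * P x) - Q x := by linarith [abs_nonneg (Q x₂)]
  have : 4 * α ^ 2 * P x - 2 * α * Q x = 2 * α * (2 * (α * P x) - Q x) := by ring
  rw [this]; positivity

/-- The Hopf strong maximum principle. -/
theorem strong_maximum_principle (hg : MetricOn g U) (hu : ContDiffOn ℝ ∞ u U)
    (hlap : ∀ x ∈ U, 0 ≤ laplacian g u x) {M : ℝ} (hM : ∀ x ∈ U, u x ≤ M) {x₀ : Coord n}
    (hx₀ : x₀ ∈ U) (h₀ : u x₀ = M) : ∀ᶠ x in nhds x₀, u x = M := by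
  obtain ⟨R, hR, hRU⟩ := Metric.isOpen_iff.1 hg.isOpen x₀ hx₀
  by_contra hcon
  have hfreq : ∃ y₁ ∈ Metric.ball x₀ (R / 4), u y₁ ≠ M := by
    by_contra h
    push Not at h
    exact hcon (Filter.eventually_of_mem (Metric.ball_mem_nhds x₀ (by positivity)) h)
  obtain ⟨y₁, hy₁, hy₁M⟩ := hfreq
  -- The maximum set near `x₀`. Its point `z` nearest to `y₁` makes the open ball of radius `r`
  -- about `y₁` miss `K`; the radius `R / 4` keeps that ball within distance `R / 2` of `x₀`.
  set K : Set (Coord n) := Metric.closedBall x₀ (R / 2) ∩ u ⁻¹' {M} with hKdef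
  have hcbU : Metric.closedBall x₀ (R / 2) ⊆ U :=
    (Metric.closedBall_subset_ball (by linarith)).trans hRU
  have hcont : ContinuousOn u U := hu.continuousOn
  have hKclosed : IsClosed K :=
    (hcont.mono hcbU).preimage_isClosed_of_isClosed Metric.isClosed_closedBall isClosed_singleton
  have hKc : IsCompact K :=
    (isCompact_closedBall x₀ (R / 2)).of_isClosed_subset hKclosed Set.inter_subset_left
  have hx₀K : x₀ ∈ K := ⟨Metric.mem_closedBall_self (by positivity), h₀⟩
  obtain ⟨z, hzK, hzd⟩ := hKc.exists_infDist_eq_dist ⟨x₀, hx₀K⟩ y₁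
  set r := dist y₁ z with hr
  have hle : ∀ y ∈ K, r ≤ dist y₁ y := fun y hy => hzd ▸ Metric.infDist_le_dist_of_mem hy
  have hr4 : r < R / 4 := (hle x₀ hx₀K).trans_lt (Metric.mem_ball.1 hy₁)
  have hr0 : 0 < r := dist_pos.2 fun h => hy₁M (h ▸ hzK.2)
  have hzx : dist z x₀ < R / 2 := by
    have := dist_triangle z y₁ x₀
    rw [dist_comm z y₁] at this
    linarith [Metric.mem_ball.1 hy₁]
  -- The ball with half the radius is internally tangent at `z`, so by strict convexity its closure
  -- meets `K` only at `z`.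
  set c : Coord n := midpoint ℝ y₁ z with hc
  set ρ := r / 2 with hρ
  have hcz : dist c z = ρ := by
    rw [hc, dist_midpoint_right]; simp [hρ, hr]; ring
  have hcy : dist c y₁ = ρ := by
    rw [hc, dist_midpoint_left]; simp [hρ, hr]; ring
  -- `u < M` on the smaller closed ball except at `z`
  have hlt : ∀ y ∈ Metric.closedBall c ρ, y ≠ z → u y < M := by
    intro y hy hyz
    have hy' : dist y c ≤ ρ := hy
    have hyy : dist y y₁ ≤ r := by
      have := dist_triangle y c y₁
      rw [hcy] at this; linarith
    have hyx : dist y x₀ ≤ R / 2 := by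
      have := dist_triangle y y₁ x₀
      linarith [Metric.mem_ball.1 hy₁]
    refine lt_of_le_of_ne (hM y (hcbU hyx)) fun hyM => hyz ?_
    have hge : r ≤ dist y₁ y := hle y ⟨hyx, hyM⟩
    have h1 : dist y₁ y = r := le_antisymm (by rwa [dist_comm]) hge
    have h2 : dist y₁ c + dist c y = dist y₁ y := by
      refine le_antisymm ?_ (dist_triangle _ _ _)
      rw [dist_comm y₁ c, hcy, h1, dist_comm c y]; linarith
    have h3 : dist c y = ρ := by
      rw [dist_comm y₁ c, hcy, h1] at h2; linarith
    have h4 : dist y₁ y = dist y₁ z := h1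
    have hmid : c = midpoint ℝ y₁ y := by
      apply eq_midpoint_of_dist_eq_half
      · rw [dist_comm, hcy, h1]
      · rw [h3, h1]
    rw [hc] at hmid
    exact ((midpoint_eq_midpoint_iff_vsub_eq_vsub ℝ).1 hmid |> fun h => by
      exact sub_eq_zero.1 (by simpa using h.symm))
  -- The first bound keeps `c` out of the ball about `z`, as `exists_barrier` requires; the second
  -- keeps that ball inside the domain.
  set ρ' := min (ρ / 2) (R / 2 - dist z x₀) with hρ'
  have hρ'0 : 0 < ρ' := lt_min (by positivity) (by linarith)
  have hBU : Metric.closedBall z ρ' ⊆ U := by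
    intro y hy
    apply hcbU
    have := dist_triangle y z x₀
    have h2 : dist y z ≤ ρ' := hy
    have h3 := min_le_right (ρ / 2) (R / 2 - dist z x₀)
    rw [Metric.mem_closedBall]; linarith
  have hcB : c ∉ Metric.closedBall z ρ' := by
    intro h
    have h2 : dist c z ≤ ρ' := h
    have h3 := min_le_left (ρ / 2) (R / 2 - dist z x₀)
    rw [hcz] at h2; linarith
  obtain ⟨α, hα, hbar⟩ := hg.exists_barrier (isCompact_closedBall z ρ') hBU hcB
  have hsum : ∀ y : Coord n, ∑ k, (y k - c k) ^ 2 = dist y c ^ 2 := by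
    intro y
    rw [EuclideanSpace.dist_eq, Real.sq_sqrt (Finset.sum_nonneg fun _ _ => sq_nonneg _)]
    exact Finset.sum_congr rfl fun k _ => by rw [Real.dist_eq, sq_abs]
  have hbv : ∀ y, barrier c α y = Real.exp (-α * dist y c ^ 2) := fun y => by
    rw [barrier, hsum]
  have hbc : Continuous (barrier c α) := (contDiff_barrier c α).continuous
  -- the margin on the part of the sphere inside the small ball
  obtain ⟨δ, hδ, hδu⟩ : ∃ δ > 0, ∀ y ∈ Metric.sphere z ρ' ∩ Metric.closedBall c ρ, u y ≤ M - δ := by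
    have hcomp : IsCompact (Metric.sphere z ρ' ∩ Metric.closedBall c ρ) :=
      (isCompact_sphere z ρ').inter_right Metric.isClosed_closedBall
    rcases (Metric.sphere z ρ' ∩ Metric.closedBall c ρ).eq_empty_or_nonempty with he | hne
    · exact ⟨1, one_pos, by simp [he]⟩
    · obtain ⟨y, hy, hymax⟩ := hcomp.exists_isMaxOn hne (hcont.mono
        (Set.inter_subset_left.trans (Metric.sphere_subset_closedBall.trans hBU)))
      have hyz : y ≠ z := by
        rintro rfl
        have h2 : dist y y = ρ' := hy.1
        rw [dist_self] at h2; linarith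
      refine ⟨M - u y, by linarith [hlt y hy.2 hyz], fun y' hy' => ?_⟩
      have : u y' ≤ u y := hymax hy'
      linarith
  -- The perturbation is at most `δ / 2`, hence below the margin `δ`, yet its Laplacian is positive,
  -- which is impossible at an interior maximum of `w`.
  set w : Coord n → ℝ := fun y => u y + δ / 2 * barrier c α y with hw
  have hbs : ContDiffOn ℝ ∞ (barrier c α) U := (contDiff_barrier c α).contDiffOn
  have hws : ContDiffOn ℝ ∞ w U := hu.add (contDiffOn_const.mul hbs)
  obtain ⟨q, hqB, hqmax⟩ := (isCompact_closedBall z ρ').exists_isMaxOn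
    ⟨z, Metric.mem_closedBall_self hρ'0.le⟩ (hws.continuousOn.mono hBU)
  have hqz : w z ≤ w q := hqmax (Metric.mem_closedBall_self hρ'0.le)
  have hwz : w z = M + δ / 2 * Real.exp (-α * ρ ^ 2) := by
    have : u z = M := hzK.2
    simp only [hw, hbv, this]
    rw [dist_comm, hcz]
  -- On the boundary sphere `w < w z`: inside the ball about `c` by the margin `δ`, outside it
  -- because the barrier is smaller there than at `z`.
  have hq_in : dist q z < ρ' := by
    refine lt_of_le_of_ne hqB fun hqs => ?_
    have hwq : w q = u q + δ / 2 * Real.exp (-α * dist q c ^ 2) := by simp only [hw, hbv]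
    by_cases hqc : dist q c ≤ ρ
    · have h1 := hδu q ⟨hqs, hqc⟩
      have h2 : Real.exp (-α * dist q c ^ 2) ≤ 1 := Real.exp_le_one_iff.2 (by
        have := sq_nonneg (dist q c); nlinarith)
      have h3 := Real.exp_pos (-α * ρ ^ 2)
      have h4 : δ / 2 * Real.exp (-α * dist q c ^ 2) ≤ δ / 2 * 1 :=
        mul_le_mul_of_nonneg_left h2 (by linarith)
      have h5 : 0 < δ / 2 * Real.exp (-α * ρ ^ 2) := by positivity
      linarith
    · push Not at hqc
      have h1 := hM q (hBU hqB)
      have h2 : Real.exp (-α * dist q c ^ 2) < Real.exp (-α * ρ ^ 2) := by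
        apply Real.exp_lt_exp.2
        have : ρ ^ 2 < dist q c ^ 2 := by
          apply pow_lt_pow_left₀ hqc (by positivity) (by norm_num)
        nlinarith
      have h4 : δ / 2 * Real.exp (-α * dist q c ^ 2) < δ / 2 * Real.exp (-α * ρ ^ 2) :=
        mul_lt_mul_of_pos_left h2 (by linarith)
      linarith
  have hqU : q ∈ U := hBU hqB
  have hlocal : IsLocalMax w q := by
    have : Metric.closedBall z ρ' ∈ nhds q :=
      Filter.mem_of_superset (Metric.isOpen_ball.mem_nhds hq_in) Metric.ball_subset_closedBall
    exact hqmax.isLocalMax this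
  have h1 := hg.laplacian_nonpos_of_isLocalMax hws hqU hlocal
  rw [hw, hg.laplacian_add_mul hu hbs _ hqU] at h1
  have h2 := hbar q hqB
  have h3 := hlap q hqU
  have : 0 < δ / 2 * laplacian g (barrier c α) q := by positivity
  linarith

end MetricOn

/-! ### Change of coordinates -/

/-- The Jacobian matrix of a map between coordinate spaces. -/
def jac (F : Coord n → Coord n) (x : Coord n) : Matrix (Fin n) (Fin n) ℝ :=
  fun a i => pderiv i (fun y => F y a) x

section ChainRule

variable {F : Coord n → Coord n} {U V : Set (Coord n)} {x : Coord n}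

lemma contDiffOn_coord (hF : ContDiffOn ℝ ∞ F V) (a : Fin n) :
    ContDiffOn ℝ ∞ (fun y => F y a) V :=
  contDiffOn_euclidean.1 hF a

lemma smooth_jac (hV : IsOpen V) (hF : ContDiffOn ℝ ∞ F V) : SmoothM V (jac F) :=
  fun a i => contDiffOn_pderiv hV (contDiffOn_coord hF a) i

lemma fderiv_coord (hF : DifferentiableAt ℝ F x) (a : Fin n) (v : Coord n) :
    fderiv ℝ (fun y => F y a) x v = fderiv ℝ F x v a := by
  have h : HasFDerivAt (fun y => F y a)
      ((EuclideanSpace.proj a : Coord n →L[ℝ] ℝ).comp (fderiv ℝ F x)) x :=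
    (EuclideanSpace.proj a : Coord n →L[ℝ] ℝ).hasFDerivAt.comp x hF.hasFDerivAt
  rw [h.fderiv]; rfl

lemma pderiv_comp {f : Coord n → ℝ} (hF : DifferentiableAt ℝ F x)
    (hf : DifferentiableAt ℝ f (F x)) (i : Fin n) :
    pderiv i (fun y => f (F y)) x = ∑ a, jac F x a i * pderiv a f (F x) := by
  have h := fderiv_comp x hf hF
  have h' : fderiv ℝ (fun y => f (F y)) x = (fderiv ℝ f (F x)).comp (fderiv ℝ F x) := h
  rw [pderiv, h', ContinuousLinearMap.comp_apply, fderiv_eq_sum_pderiv]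
  refine Finset.sum_congr rfl fun a _ => ?_
  rw [jac, pderiv.eq_def i, fderiv_coord hF]

lemma mpd_comp {ι κ : Type*} {A : Coord n → Matrix ι κ ℝ} (hU : IsOpen U) (hV : IsOpen V)
    (hF : ContDiffOn ℝ ∞ F V) (hA : SmoothM U A) (hx : x ∈ V) (hFx : F x ∈ U) (i : Fin n) :
    mpd i (fun y => A (F y)) x = ∑ a, jac F x a i • mpd a A (F x) := by
  ext p q
  simp only [mpd, Matrix.sum_apply, Matrix.smul_apply, smul_eq_mul]
  exact pderiv_comp ((hF.contDiffAt (hV.mem_nhds hx)).differentiableAt (by simp))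
    (hA.dAt hU hFx p q) i

lemma SmoothM.comp {ι κ : Type*} {A : Coord n → Matrix ι κ ℝ} (hA : SmoothM U A)
    (hF : ContDiffOn ℝ ∞ F V) (h : Set.MapsTo F V U) : SmoothM V (fun y => A (F y)) :=
  fun p q => (hA p q).comp hF h

lemma mpd_jac_symm (hV : IsOpen V) (hF : ContDiffOn ℝ ∞ F V) (hx : x ∈ V) (i j a : Fin n) :
    mpd i (jac F) x a j = mpd j (jac F) x a i :=
  pderiv_comm hV (contDiffOn_coord hF a) hx i j

end ChainRule

/-- The metric `g'` on `V` is the pullback of the metric `g` on `U` by the local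
diffeomorphism `F`. -/
structure IsPullback (g' g : Coord n → Matrix (Fin n) (Fin n) ℝ) (F : Coord n → Coord n)
    (V U : Set (Coord n)) : Prop where
  source : MetricOn g' V
  target : MetricOn g U
  smooth : ContDiffOn ℝ ∞ F V
  mapsTo : Set.MapsTo F V U
  eq : ∀ x ∈ V, g' x = (jac F x).transpose * g (F x) * jac F x

/-! ### Naturality of the connection, the curvature and the Weyl tensor. -/

namespace IsPullback

variable {g' g : Coord n → Matrix (Fin n) (Fin n) ℝ} {F : Coord n → Coord n}
  {V U : Set (Coord n)} {x : Coord n}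

lemma isUnit (h : IsPullback g' g F V U) (hx : x ∈ V) : IsUnit (jac F x).det := by
  have h1 := h.source.det_ne hx
  rw [h.eq x hx, Matrix.det_mul] at h1
  exact (right_ne_zero_of_mul h1).isUnit

lemma jac_inv_transpose (h : IsPullback g' g F V U) (hx : x ∈ V) :
    jac F x * (g' x)⁻¹ * (jac F x).transpose = (g (F x))⁻¹ := by
  have hu := h.isUnit hx
  have hut : IsUnit (jac F x).transpose.det := by rwa [Matrix.det_transpose]
  rw [h.eq x hx, Matrix.mul_inv_rev, Matrix.mul_inv_rev, ← Matrix.mul_assoc,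
    Matrix.mul_nonsing_inv _ hu, one_mul, Matrix.mul_assoc, Matrix.nonsing_inv_mul _ hut, mul_one]

/-- The pullback of the connection matrix, before the change of frame. -/
def pullGam (g : Coord n → Matrix (Fin n) (Fin n) ℝ) (F : Coord n → Coord n) (i : Fin n)
    (x : Coord n) : Matrix (Fin n) (Fin n) ℝ :=
  ∑ a, jac F x a i • gam g a (F x)

/-- The transformation law of Christoffel symbols, by uniqueness: the matrices `C i` solving this
equation are torsion-free, because second derivatives of `F` commute, and metric for `g'`; so
`eq_gam` identifies them. -/
lemma jac_mul_gam (h : IsPullback g' g F V U) (hx : x ∈ V) (i : Fin n) :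
    jac F x * gam g' i x = pullGam g F i x * jac F x + mpd i (jac F) x := by
  have hu := h.isUnit hx
  have hV := h.source.isOpen
  have hFx := h.mapsTo hx
  have hJ := smooth_jac hV h.smooth
  have hG := h.target.smooth.comp h.smooth h.mapsTo
  set C : Fin n → Matrix (Fin n) (Fin n) ℝ := fun i =>
    (jac F x)⁻¹ * (pullGam g F i x * jac F x + mpd i (jac F) x) with hC
  have hJC : ∀ i, jac F x * C i = pullGam g F i x * jac F x + mpd i (jac F) x := fun i => by
    simp only [hC]
    rw [← Matrix.mul_assoc, Matrix.mul_nonsing_inv _ hu, one_mul]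
  have hsymm : ∀ k i j, C i k j = C j k i := by
    intro k i j
    simp only [hC, Matrix.mul_apply (M := (jac F x)⁻¹)]
    refine Finset.sum_congr rfl fun p _ => ?_
    congr 1
    rw [Matrix.add_apply, Matrix.add_apply, mpd_jac_symm hV h.smooth hx i j p]
    congr 1
    simp only [pullGam, Matrix.mul_apply, Matrix.sum_apply, Matrix.smul_apply, smul_eq_mul,
      Finset.sum_mul]
    rw [Finset.sum_comm]
    refine Finset.sum_congr rfl fun a _ => Finset.sum_congr rfl fun b _ => ?_
    simp only [gam, h.target.christoffel_symm hFx p b a]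
    ring
  have hcomp : ∀ i, mpd i g' x = (C i).transpose * g' x + g' x * C i := by
    intro i
    have hGd : mpd i (fun y => g (F y)) x =
        (pullGam g F i x).transpose * g (F x) + g (F x) * pullGam g F i x := by
      rw [mpd_comp h.target.isOpen hV h.smooth h.target.smooth hx hFx]
      simp only [h.target.compat hFx, pullGam, Matrix.transpose_sum, Matrix.transpose_smul,
        Finset.sum_mul, Finset.mul_sum, Matrix.smul_mul, Matrix.mul_smul, smul_add,
        Finset.sum_add_distrib]
    rw [mpd_congr hV hx (fun y hy => h.eq y hy), mpd_mul hV hx (hJ.transpose.mul hG) hJ,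
      mpd_mul hV hx hJ.transpose hG, hGd, mpd_transpose, h.eq x hx]
    have h1 : (C i).transpose * (jac F x).transpose =
        (pullGam g F i x * jac F x + mpd i (jac F) x).transpose := by
      rw [← Matrix.transpose_mul, hJC]
    have h2 : (C i).transpose * ((jac F x).transpose * g (F x) * jac F x) =
        ((C i).transpose * (jac F x).transpose) * g (F x) * jac F x := by noncomm_ring
    have h3 : (jac F x).transpose * g (F x) * jac F x * C i =
        (jac F x).transpose * g (F x) * (jac F x * C i) := by noncomm_ring
    rw [h2, h3, h1, hJC, Matrix.transpose_add, Matrix.transpose_mul]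
    noncomm_ring
  rw [← h.source.eq_gam hx C hsymm hcomp i, hJC]

lemma mpd_pullGam (h : IsPullback g' g F V U) (hx : x ∈ V) (i j : Fin n) :
    mpd i (pullGam g F j) x = ∑ a, mpd i (jac F) x a j • gam g a (F x) +
      ∑ a, ∑ b, (jac F x a i * jac F x b j) • mpd a (gam g b) (F x) := by
  have hV := h.source.isOpen
  have hJ := smooth_jac hV h.smooth
  have hG := fun a => (h.target.smooth_gam a).comp h.smooth h.mapsTo
  have : pullGam g F j = fun y => ∑ a, jac F y a j • gam g a (F y) := rfl
  rw [this, mpd_sum _ hV hx fun a _ => SmoothM.smul (hJ a j) (hG a), Finset.sum_comm (γ := Fin n),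
    ← Finset.sum_add_distrib]
  refine Finset.sum_congr rfl fun a _ => ?_
  rw [mpd_smul hV hx (hJ a j) (hG a),
    mpd_comp h.target.isOpen hV h.smooth (h.target.smooth_gam a) hx (h.mapsTo hx), Finset.smul_sum]
  congr 1
  exact Finset.sum_congr rfl fun b _ => by rw [smul_smul, mul_comm]

lemma smooth_pullGam (h : IsPullback g' g F V U) (i : Fin n) : SmoothM V (pullGam g F i) :=
  SmoothM.sum _ fun a _ => SmoothM.smul (smooth_jac h.source.isOpen h.smooth a i)
    ((h.target.smooth_gam a).comp h.smooth h.mapsTo)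

/-- The integrability condition of `dJ = J Γ' - (F*Γ) J`: equality of the mixed derivatives of `J`
intertwines the two curvatures. -/
lemma jac_mul_curv (h : IsPullback g' g F V U) (hx : x ∈ V) (i j : Fin n) :
    jac F x * curv g' i j x =
      (∑ a, ∑ b, (jac F x a i * jac F x b j) • curv g a b (F x)) * jac F x := by
  have hV := h.source.isOpen
  have hJ := smooth_jac hV h.smooth
  have hΓ := fun i => h.source.smooth_gam i
  have hA := fun i => h.smooth_pullGam i
  have h1 : ∀ i, ∀ y ∈ V, mpd i (jac F) y = jac F y * gam g' i y - pullGam g F i y * jac F y :=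
    fun i y hy => by rw [h.jac_mul_gam hy]; abel
  have h2 : ∀ i j, mpd i (mpd j (jac F)) x =
      (mpd i (jac F) x * gam g' j x + jac F x * mpd i (gam g' j) x) -
        (mpd i (pullGam g F j) x * jac F x + pullGam g F j x * mpd i (jac F) x) := by
    intro i j
    rw [mpd_congr hV hx (h1 j), mpd_sub hV hx (hJ.mul (hΓ j)) ((hA j).mul hJ),
      mpd_mul hV hx hJ (hΓ j), mpd_mul hV hx (hA j) hJ]
  have h3 : ∑ a, ∑ b, (jac F x a i * jac F x b j) • curv g a b (F x) =
      mpd i (pullGam g F j) x - mpd j (pullGam g F i) x +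
        (pullGam g F i x * pullGam g F j x - pullGam g F j x * pullGam g F i x) := by
    have hs : ∑ a, mpd i (jac F) x a j • gam g a (F x) =
        ∑ a, mpd j (jac F) x a i • gam g a (F x) :=
      Finset.sum_congr rfl fun a _ => by rw [mpd_jac_symm hV h.smooth hx]
    have hm : ∀ i j, pullGam g F i x * pullGam g F j x =
        ∑ a, ∑ b, (jac F x a i * jac F x b j) • (gam g a (F x) * gam g b (F x)) := by
      intro i j
      simp only [pullGam, Finset.sum_mul, Finset.mul_sum, Matrix.smul_mul, Matrix.mul_smul,
        smul_smul]
      rw [Finset.sum_comm]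
      exact Finset.sum_congr rfl fun a _ => Finset.sum_congr rfl fun b _ => by rw [mul_comm]
    have hc : ∀ X : Fin n → Fin n → Matrix (Fin n) (Fin n) ℝ,
        ∑ a, ∑ b, (jac F x a j * jac F x b i) • X a b =
          ∑ a, ∑ b, (jac F x a i * jac F x b j) • X b a := by
      intro X
      rw [Finset.sum_comm]
      exact Finset.sum_congr rfl fun a _ => Finset.sum_congr rfl fun b _ => by rw [mul_comm]
    rw [h.mpd_pullGam hx, h.mpd_pullGam hx, hs, hm, hm, hc, hc]
    simp only [curv_eq, smul_add, smul_sub, Finset.sum_add_distrib, Finset.sum_sub_distrib]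
    abel
  have h4 := mpd_comm hV hJ hx i j
  rw [h2, h2, h1 i x hx, h1 j x hx, ← sub_eq_zero] at h4
  rw [h3, curv_eq, ← sub_eq_zero, ← h4]
  noncomm_ring

lemma riemF_eq (h : IsPullback g' g F V U) (hx : x ∈ V) :
    riemF g' x = act (jac F x) (riemF g (F x)) := by
  have key : ∀ i j, Matrix.of (riemF g' x i j) = Matrix.of (act (jac F x) (riemF g (F x)) i j) := by
    intro i j
    rw [of_act_apply]
    have h1 : Matrix.of (riemF g' x i j) = g' x * curv g' i j x := rfl
    have h2 : ∀ a b, Matrix.of (riemF g (F x) a b) = g (F x) * curv g a b (F x) := fun _ _ => rfl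
    simp only [h1, h2]
    rw [h.eq x hx, Matrix.mul_assoc, h.jac_mul_curv hx]
    simp only [Finset.sum_mul, Finset.mul_sum, Matrix.smul_mul, Matrix.mul_smul, Matrix.mul_assoc]
  ext i j k l
  exact congrFun (congrFun (key i j) k) l

lemma ricci_eq (h : IsPullback g' g F V U) (hx : x ∈ V) :
    ricci g' x = (jac F x).transpose * ricci g (F x) * jac F x := by
  rw [ricci_eq_tr₁₃, h.riemF_eq hx, tr₁₃_act, h.jac_inv_transpose hx, ← ricci_eq_tr₁₃]

lemma scal_eq (h : IsPullback g' g F V U) (hx : x ∈ V) : scal g' x = scal g (F x) := by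
  rw [scal_eq_tr₂, scal_eq_tr₂, h.ricci_eq hx, tr₂_eq_trace, tr₂_eq_trace,
    ← h.jac_inv_transpose hx]
  simp only [Matrix.transpose_mul, Matrix.transpose_transpose]
  rw [← Matrix.mul_assoc, Matrix.trace_mul_comm, ← Matrix.mul_assoc,
    Matrix.trace_mul_comm (jac F x * (g' x)⁻¹ * (jac F x).transpose)]
  simp only [Matrix.mul_assoc]

lemma schouten_eq (h : IsPullback g' g F V U) (hx : x ∈ V) :
    schouten g' x = (jac F x).transpose * schouten g (F x) * jac F x := by
  have h1 : schoutenTrace g' x = schoutenTrace g (F x) := by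
    rw [schoutenTrace, schoutenTrace, h.scal_eq hx]
  rw [schouten, schouten, h1, h.ricci_eq hx, h.eq x hx]
  simp only [Matrix.mul_smul, Matrix.smul_mul, mul_sub, sub_mul]

lemma weylF_eq (hn : 4 ≤ n) (h : IsPullback g' g F V U) (hx : x ∈ V) :
    weylF g' x = act (jac F x) (weylF g (F x)) := by
  rw [WeylBochner.weylF_eq hn, WeylBochner.weylF_eq hn, sub_eq_add_neg, sub_eq_add_neg, act_add,
    act_neg, kulkarniNomizu_act, h.riemF_eq hx, h.schouten_eq hx, h.eq x hx]

/-- Moving the Jacobians across the pairing leaves `J g'⁻¹ Jᵀ`, which is the inverse of `g` at the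
image point. -/
lemma weylNormSq_eq (hn : 4 ≤ n) (h : IsPullback g' g F V U) (hx : x ∈ V) :
    weylNormSq g' x = weylNormSq g (F x) := by
  rw [weylNormSq, weylNormSq, h.weylF_eq hn hx, ip_act, act_act, act_act,
    ← Matrix.mul_assoc, h.jac_inv_transpose hx]

end IsPullback

/-! ### The metric of a Riemannian manifold in charts -/

section Charts

variable {M : Type*} [TopologicalSpace M] [ChartedSpace (Coord n) M]
  {φ ψ : OpenPartialHomeomorph M (Coord n)}

lemma isOpen_transition {M : Type*} [TopologicalSpace M]
    (φ ψ : OpenPartialHomeomorph M (Coord n)) : IsOpen (φ.target ∩ φ.symm ⁻¹' ψ.source) :=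
  φ.isOpen_inter_preimage_symm ψ.open_source

/-- The derivative of the inverse of a chart, as a map of the model space. -/
def dsymm (φ : OpenPartialHomeomorph M (Coord n)) (x : Coord n) : Coord n →L[ℝ] Coord n :=
  mfderiv (𝓡 n) (𝓡 n) φ.symm x

lemma mdifferentiableAt_symm (hφ : φ ∈ IsManifold.maximalAtlas (𝓡 n) ∞ M) {x : Coord n}
    (hx : x ∈ φ.target) : MDifferentiableAt (𝓡 n) (𝓡 n) φ.symm x :=
  (contMDiffAt_symm_of_mem_maximalAtlas hφ hx).mdifferentiableAt (by simp)

lemma mdifferentiableAt_chart (hφ : φ ∈ IsManifold.maximalAtlas (𝓡 n) ∞ M) {p : M}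
    (hp : p ∈ φ.source) : MDifferentiableAt (𝓡 n) (𝓡 n) φ p :=
  (contMDiffAt_of_mem_maximalAtlas hφ hp).mdifferentiableAt (by simp)

/-- The transition map between charts is smooth. -/
lemma contDiffOn_transition (hφ : φ ∈ IsManifold.maximalAtlas (𝓡 n) ∞ M)
    (hψ : ψ ∈ IsManifold.maximalAtlas (𝓡 n) ∞ M) :
    ContDiffOn ℝ ∞ (fun x => ψ (φ.symm x)) (φ.target ∩ φ.symm ⁻¹' ψ.source) := by
  rw [← contMDiffOn_iff_contDiffOn]
  exact (contMDiffOn_of_mem_maximalAtlas hψ).comp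
    ((contMDiffOn_symm_of_mem_maximalAtlas hφ).mono Set.inter_subset_left) fun x hx => hx.2

lemma dsymm_transition (hφ : φ ∈ IsManifold.maximalAtlas (𝓡 n) ∞ M)
    (hψ : ψ ∈ IsManifold.maximalAtlas (𝓡 n) ∞ M) {x : Coord n}
    (hx : x ∈ φ.target ∩ φ.symm ⁻¹' ψ.source) (v : Coord n) :
    dsymm φ x v = dsymm ψ (ψ (φ.symm x)) (fderiv ℝ (fun y => ψ (φ.symm y)) x v) := by
  set F : Coord n → Coord n := fun y => ψ (φ.symm y) with hF
  have hV := isOpen_transition φ ψ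
  have hd : DifferentiableAt ℝ F x :=
    ((contDiffOn_transition hφ hψ).contDiffAt (hV.mem_nhds hx)).differentiableAt (by simp)
  have hm : HasMFDerivAt (𝓡 n) (𝓡 n) F x (fderiv ℝ F x) := hd.hasFDerivAt.hasMFDerivAt
  have hs : MDifferentiableAt (𝓡 n) (𝓡 n) ψ.symm (F x) :=
    mdifferentiableAt_symm hψ (ψ.map_source hx.2)
  have hc := hs.hasMFDerivAt.comp x hm
  have he : (ψ.symm ∘ F) =ᶠ[nhds x] φ.symm := by
    filter_upwards [hV.mem_nhds hx] with y hy
    exact ψ.left_inv hy.2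
  have := (hc.congr_of_eventuallyEq he.symm).mfderiv
  exact congrArg (fun L : Coord n →L[ℝ] Coord n => L v) this

/-- The derivative of the chart itself is a left inverse. -/
lemma dsymm_injective (hφ : φ ∈ IsManifold.maximalAtlas (𝓡 n) ∞ M) {x : Coord n}
    (hx : x ∈ φ.target) : Function.Injective (dsymm φ x) := by
  have h1 := (mdifferentiableAt_chart hφ (φ.map_target hx)).hasMFDerivAt
  have h2 := (mdifferentiableAt_symm hφ hx).hasMFDerivAt
  have hc := h1.comp x h2
  have he : (φ ∘ φ.symm) =ᶠ[nhds x] id := by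
    filter_upwards [φ.open_target.mem_nhds hx] with y hy
    exact φ.right_inv hy
  have hid := (hc.congr_of_eventuallyEq he.symm).mfderiv
  rw [mfderiv_id] at hid
  have hl : Function.LeftInverse (mfderiv (𝓡 n) (𝓡 n) φ (φ.symm x)) (dsymm φ x) := fun v =>
    (congrArg (fun L : Coord n →L[ℝ] Coord n => L v) hid).symm
  exact hl.injective

lemma eq_sum_single (v : Coord n) : v = ∑ k, v k • (EuclideanSpace.single k (1:ℝ) : Coord n) := by
  ext i; simp [Finset.sum_apply, Pi.single_apply]

/-- The matrix of a pulled back bilinear form. -/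
lemma bilin_apply (b : Coord n →L[ℝ] Coord n →L[ℝ] ℝ) (L : Coord n →L[ℝ] Coord n)
    (v w : Coord n) : b (L v) (L w) = ∑ i, ∑ j, v i * w j *
      b (L (EuclideanSpace.single i 1)) (L (EuclideanSpace.single j 1)) := by
  conv_lhs => rw [eq_sum_single v, eq_sum_single w]
  simp only [map_sum, map_smul, sum_apply, smul_apply,
    smul_eq_mul]
  rw [Finset.sum_comm]
  simp only [Finset.mul_sum, mul_assoc, mul_left_comm]

variable [IsManifold (𝓡 n) ∞ M]

/-- The metric at a point, as a bilinear form on the model space. -/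
def formAt (g : SmoothMetric n M) (p : M) : Coord n →L[ℝ] Coord n →L[ℝ] ℝ := g.inner p

lemma coeff_apply (g : SmoothMetric n M) (x : Coord n) (i j : Fin n) :
    coeff g φ x i j = formAt g (φ.symm x) (dsymm φ x (EuclideanSpace.single i 1))
      (dsymm φ x (EuclideanSpace.single j 1)) := rfl

lemma formAt_symm (g : SmoothMetric n M) (p : M) (v w : Coord n) :
    formAt g p v w = formAt g p w v := g.symm p v w

lemma formAt_pos (g : SmoothMetric n M) (p : M) {v : Coord n} (hv : v ≠ 0) :
    0 < formAt g p v v := g.pos p v hv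

lemma posDef_coeff (g : SmoothMetric n M) (hφ : φ ∈ IsManifold.maximalAtlas (𝓡 n) ∞ M)
    {x : Coord n} (hx : x ∈ φ.target) : (coeff g φ x).PosDef := by
  refine Matrix.PosDef.of_dotProduct_mulVec_pos ?_ fun v hv => ?_
  · ext i j
    exact formAt_symm g _ _ _
  · set w : Coord n := WithLp.toLp 2 v with hw
    have hw0 : w ≠ 0 := fun h => hv (by simpa [hw] using congrArg WithLp.ofLp h)
    have h0 : dsymm φ x w ≠ 0 := fun h =>
      hw0 (dsymm_injective hφ hx (h.trans (map_zero _).symm))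
    have := formAt_pos g (φ.symm x) h0
    rw [bilin_apply] at this
    refine this.trans_eq ?_
    simp only [dotProduct, Matrix.mulVec, Finset.mul_sum]
    refine Finset.sum_congr rfl fun i _ => Finset.sum_congr rfl fun j _ => ?_
    rw [coeff_apply]
    simp [hw]; ring

/-- The coordinate field is the tangent map of the inverse chart applied to a constant section. -/
lemma contMDiffOn_coordVec (hφ : φ ∈ IsManifold.maximalAtlas (𝓡 n) ∞ M) (i : Fin n) :
    ContMDiffOn (𝓡 n) (𝓡 n).tangent ∞
      (fun x => (⟨φ.symm x, coordVec φ x i⟩ : TangentBundle (𝓡 n) M)) φ.target := by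
  have h1 := (contMDiffOn_symm_of_mem_maximalAtlas hφ).contMDiffOn_tangentMapWithin (m := ∞)
    (by simp) φ.open_target.uniqueMDiffOn
  have h2 : ContMDiff (𝓡 n) (𝓡 n).tangent ∞ (fun x : Coord n =>
      (⟨x, (EuclideanSpace.single i (1 : ℝ) : Coord n)⟩ : TangentBundle (𝓡 n) (Coord n))) :=
    contMDiff_vectorSpace_iff_contDiff.2 contDiff_const
  refine (h1.comp h2.contMDiffOn (fun x hx => hx)).congr fun x hx => ?_
  simp only [Function.comp, tangentMapWithin, coordVec, mfderivWithin_of_isOpen φ.open_target hx]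

lemma smooth_coeff (g : SmoothMetric n M) (hφ : φ ∈ IsManifold.maximalAtlas (𝓡 n) ∞ M) :
    SmoothM φ.target (coeff g φ) := by
  intro i j
  rw [← contMDiffOn_iff_contDiffOn]
  intro x hx
  have hb := contMDiffOn_symm_of_mem_maximalAtlas hφ x hx
  have : ContMDiffWithinAt (𝓡 n) ((𝓡 n).prod 𝓘(ℝ)) ∞
      (fun m ↦ Bundle.TotalSpace.mk' ℝ (E := Bundle.Trivial M ℝ) (φ.symm m)
        (g.inner (φ.symm m) (coordVec φ m i) (coordVec φ m j))) φ.target x := by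
    apply ContMDiffWithinAt.clm_bundle_apply₂ (F₁ := Coord n) (F₂ := Coord n)
    · exact ContMDiffAt.comp_contMDiffWithinAt x g.contMDiff.contMDiffAt hb
    · exact contMDiffOn_coordVec hφ i x hx
    · exact contMDiffOn_coordVec hφ j x hx
  simp only [Bundle.contMDiffWithinAt_totalSpace] at this
  exact this.2

lemma metricOn_coeff (g : SmoothMetric n M) (hφ : φ ∈ IsManifold.maximalAtlas (𝓡 n) ∞ M) :
    MetricOn (coeff g φ) φ.target :=
  ⟨φ.open_target, smooth_coeff g hφ, fun _ hx => posDef_coeff g hφ hx⟩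

lemma MetricOn.mono {g : Coord n → Matrix (Fin n) (Fin n) ℝ} {U V : Set (Coord n)}
    (hg : MetricOn g U) (hV : IsOpen V) (h : V ⊆ U) : MetricOn g V :=
  ⟨hV, fun i j => (hg.smooth i j).mono h, fun x hx => hg.posDef x (h hx)⟩

lemma isPullback_coeff (g : SmoothMetric n M) (hφ : φ ∈ IsManifold.maximalAtlas (𝓡 n) ∞ M)
    (hψ : ψ ∈ IsManifold.maximalAtlas (𝓡 n) ∞ M) :
    IsPullback (coeff g φ) (coeff g ψ) (fun x => ψ (φ.symm x))
      (φ.target ∩ φ.symm ⁻¹' ψ.source) ψ.target where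
  source := (metricOn_coeff g hφ).mono (isOpen_transition φ ψ) Set.inter_subset_left
  target := metricOn_coeff g hψ
  smooth := contDiffOn_transition hφ hψ
  mapsTo := fun x hx => ψ.map_source hx.2
  eq := by
    intro x hx
    have hd : DifferentiableAt ℝ (fun y => ψ (φ.symm y)) x :=
      ((contDiffOn_transition hφ hψ).contDiffAt
        ((isOpen_transition φ ψ).mem_nhds hx)).differentiableAt (by simp)
    ext i j
    rw [coeff_apply, dsymm_transition hφ hψ hx, dsymm_transition hφ hψ hx, bilin_apply,
      Matrix.mul_assoc, Matrix.mul_apply]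
    refine Finset.sum_congr rfl fun a _ => ?_
    rw [Matrix.mul_apply, Finset.mul_sum]
    refine Finset.sum_congr rfl fun b _ => ?_
    rw [coeff_apply, ψ.left_inv hx.2, Matrix.transpose_apply, jac, jac, pderiv, pderiv,
      fderiv_coord hd, fderiv_coord hd]
    ring

end Charts

/-! ### The Bochner argument on a closed manifold -/

section Closed

variable {M : Type*} [TopologicalSpace M] [ChartedSpace (Coord n) M] [IsManifold (𝓡 n) ∞ M]
  {φ : OpenPartialHomeomorph M (Coord n)}

/-- The function `|W|²` on a Riemannian manifold. -/
def weylNormSqAt (g : SmoothMetric n M) (p : M) : ℝ :=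
  weylNormSq (coeff g (chartAt (Coord n) p)) (chartAt (Coord n) p p)

/-- The chart `φ` and the preferred chart at the point are related by a pullback, so `|W|²` is one
function on `M`, to which the maximum principle can be applied chart by chart. -/
lemma weylNormSq_coeff (hn : 4 ≤ n) (g : SmoothMetric n M)
    (hφ : φ ∈ IsManifold.maximalAtlas (𝓡 n) ∞ M) {x : Coord n} (hx : x ∈ φ.target) :
    weylNormSq (coeff g φ) x = weylNormSqAt g (φ.symm x) := by
  have hψ := IsManifold.chart_mem_maximalAtlas (I := 𝓡 n) (n := ∞) (φ.symm x)
  have hx' : x ∈ φ.target ∩ φ.symm ⁻¹' (chartAt (Coord n) (φ.symm x)).source :=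
    ⟨hx, mem_chart_source (Coord n) (φ.symm x)⟩
  have h := (isPullback_coeff g hφ hψ).weylNormSq_eq hn hx'
  rw [h, weylNormSqAt]

lemma weylNormSqAt_eq (hn : 4 ≤ n) (g : SmoothMetric n M)
    (hφ : φ ∈ IsManifold.maximalAtlas (𝓡 n) ∞ M) {p : M} (hp : p ∈ φ.source) :
    weylNormSqAt g p = weylNormSq (coeff g φ) (φ p) := by
  rw [weylNormSq_coeff hn g hφ (φ.map_source hp), φ.left_inv hp]

lemma continuous_weylNormSqAt (hn : 4 ≤ n) (g : SmoothMetric n M) :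
    Continuous (weylNormSqAt g) := by
  rw [continuous_iff_continuousAt]
  intro p
  have hφ := IsManifold.chart_mem_maximalAtlas (I := 𝓡 n) (n := ∞) p
  have hp := mem_chart_source (Coord n) p
  have h1 : ContinuousAt (weylNormSq (coeff g (chartAt (Coord n) p))) (chartAt (Coord n) p p) :=
    ((metricOn_coeff g hφ).contDiffOn_weylNormSq hn).continuousOn.continuousAt
      ((chartAt (Coord n) p).open_target.mem_nhds ((chartAt (Coord n) p).map_source hp))
  refine (h1.comp ((chartAt (Coord n) p).continuousAt hp)).congr ?_
  filter_upwards [(chartAt (Coord n) p).open_source.mem_nhds hp] with q hq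
  exact (weylNormSqAt_eq hn g hφ hq).symm

lemma half_pred_pos (hn : 4 ≤ n) : (0 : ℝ) < ((n - 1) / 2 : ℕ) := by
  exact_mod_cast (show 0 < (n - 1) / 2 by omega)

lemma laplacian_nonneg (hn : 4 ≤ n) {g : SmoothMetric n M} (hdiv : WeylDivergenceFree g)
    (hpos : EigenvalueSumNonneg g ((n - 1) / 2)) (hφ : φ ∈ IsManifold.maximalAtlas (𝓡 n) ∞ M)
    {x : Coord n} (hx : x ∈ φ.target) :
    0 ≤ laplacian (coeff g φ) (weylNormSq (coeff g φ)) x := by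
  have hg := metricOn_coeff g hφ
  have h4 : (4 : ℝ) ≤ n := by exact_mod_cast hn
  have h1 : (0 : ℝ) ≤ (n : ℝ) - 1 := by linarith
  refine le_trans ?_ (hg.bochner_inequality hn (hdiv φ hφ) hx)
  have h2 := hg.covWeylNormSq_nonneg hx
  have h3 := hg.weylNormSq_nonneg hx
  have h5 := hpos φ hφ x hx
  have h6 := half_pred_pos hn
  positivity

/-- By the strong maximum principle `|W|` is constant. -/
lemma weylNormSqAt_const [CompactSpace M] [ConnectedSpace M] (hn : 4 ≤ n) {g : SmoothMetric n M}
    (hdiv : WeylDivergenceFree g) (hpos : EigenvalueSumNonneg g ((n - 1) / 2)) :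
    ∃ c, ∀ p, weylNormSqAt g p = c := by
  have hc := continuous_weylNormSqAt hn g
  obtain ⟨q, -, hq⟩ := isCompact_univ.exists_isMaxOn Set.univ_nonempty hc.continuousOn
  -- The set where the maximum is attained is closed by continuity and open by the strong maximum
  -- principle, hence everything by connectedness.
  set S : Set M := {p | weylNormSqAt g p = weylNormSqAt g q} with hS
  have hclosed : IsClosed S := isClosed_eq hc continuous_const
  have hopen : IsOpen S := by
    rw [isOpen_iff_mem_nhds]
    intro p hp
    have hφ := IsManifold.chart_mem_maximalAtlas (I := 𝓡 n) (n := ∞) p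
    have hps := mem_chart_source (Coord n) p
    set φ := chartAt (Coord n) p
    have hg := metricOn_coeff g hφ
    have hmax := hg.strong_maximum_principle (hg.contDiffOn_weylNormSq hn)
      (fun x hx => laplacian_nonneg hn hdiv hpos hφ hx) (M := weylNormSqAt g q)
      (fun x hx => by rw [weylNormSq_coeff hn g hφ hx]; exact hq (Set.mem_univ _))
      (φ.map_source hps) ((weylNormSqAt_eq hn g hφ hps).symm.trans hp)
    filter_upwards [(φ.continuousAt hps).eventually hmax, φ.open_source.mem_nhds hps] with r hr hrs
    exact (weylNormSqAt_eq hn g hφ hrs).trans hr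
  have huniv : S = Set.univ := IsClopen.eq_univ ⟨hclosed, hopen⟩ ⟨q, rfl⟩
  exact ⟨weylNormSqAt g q, fun p => (huniv ▸ Set.mem_univ p : p ∈ S)⟩

lemma laplacian_eq_zero_of_const {g : Coord n → Matrix (Fin n) (Fin n) ℝ} {u : Coord n → ℝ}
    {U : Set (Coord n)} (hU : IsOpen U) {c : ℝ} (hu : ∀ x ∈ U, u x = c) {x : Coord n}
    (hx : x ∈ U) : laplacian g u x = 0 := by
  have h1 : ∀ m, ∀ y ∈ U, pderiv m u y = 0 := fun m y hy => by
    rw [pderiv_congr (f₂ := fun _ => c) hU hy (fun z hz => hu z hz), pderiv_const]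
  have h2 : ∀ a m, pderiv a (pderiv m u) x = 0 := fun a m => by
    rw [pderiv_congr (f₂ := fun _ => 0) hU hx (fun z hz => h1 m z hz), pderiv_const]
  simp [laplacian, h1 _ x hx, h2]

lemma laplacian_weylNormSq_eq_zero [CompactSpace M] [ConnectedSpace M] (hn : 4 ≤ n)
    {g : SmoothMetric n M} (hdiv : WeylDivergenceFree g)
    (hpos : EigenvalueSumNonneg g ((n - 1) / 2)) (hφ : φ ∈ IsManifold.maximalAtlas (𝓡 n) ∞ M)
    {x : Coord n} (hx : x ∈ φ.target) :
    laplacian (coeff g φ) (weylNormSq (coeff g φ)) x = 0 := by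
  obtain ⟨c, hc⟩ := weylNormSqAt_const hn hdiv hpos
  exact laplacian_eq_zero_of_const φ.open_target
    (fun y hy => by rw [weylNormSq_coeff hn g hφ hy, hc]) hx

/-- As `|W|²` is constant, the left side of the Bochner inequality is at most zero; both of its
terms are nonnegative, so `|∇W|² = 0`. -/
theorem weylParallel_of_eigenvalueSumNonneg [CompactSpace M] [ConnectedSpace M] (hn : 4 ≤ n)
    {g : SmoothMetric n M} (hdiv : WeylDivergenceFree g)
    (hpos : EigenvalueSumNonneg g ((n - 1) / 2)) : WeylParallel g := by
  intro φ hφ x hx m i j k l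
  have hg := metricOn_coeff g hφ
  have h4 : (4 : ℝ) ≤ n := by exact_mod_cast hn
  have h0 : (0 : ℝ) ≤ (n : ℝ) - 1 := by linarith
  have h1 := hg.bochner_inequality hn (hdiv φ hφ) hx
  rw [laplacian_weylNormSq_eq_zero hn hdiv hpos hφ hx] at h1
  have h2 := hg.covWeylNormSq_nonneg hx
  have h3 := hg.weylNormSq_nonneg hx
  have h5 := hpos φ hφ x hx
  have h6 := half_pred_pos hn
  have h7 : 0 ≤ 4 * ((n : ℝ) - 1) * weylNormSq (coeff g φ) x / ((n - 1) / 2 : ℕ) *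
    lowestEigenvalueSum (coeff g φ) ((n - 1) / 2) x := by positivity
  have h8 := hg.cov_weylF_eq_zero hx (le_antisymm (by linarith) h2) m
  rw [covDeriv_eq_cov]
  exact congrFun (congrFun (congrFun (congrFun h8 i) j) k) l

/-- The eigenvalue sum now has a strictly positive factor in front of `|W|²`, which must therefore
vanish. -/
theorem weylF_eq_zero_of_eigenvalueSumPos [CompactSpace M] [ConnectedSpace M] (hn : 4 ≤ n)
    {g : SmoothMetric n M} (hdiv : WeylDivergenceFree g)
    (hpos : EigenvalueSumPos g ((n - 1) / 2)) (hφ : φ ∈ IsManifold.maximalAtlas (𝓡 n) ∞ M)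
    {x : Coord n} (hx : x ∈ φ.target) : weylF (coeff g φ) x = 0 := by
  have hg := metricOn_coeff g hφ
  have h4 : (4 : ℝ) ≤ n := by exact_mod_cast hn
  have h0 : (0 : ℝ) < (n : ℝ) - 1 := by linarith
  have h1 := hg.bochner_inequality hn (hdiv φ hφ) hx
  rw [laplacian_weylNormSq_eq_zero hn hdiv (fun ψ hψ y hy => (hpos ψ hψ y hy).le) hφ hx] at h1
  have h2 := hg.covWeylNormSq_nonneg hx
  have h3 := hg.weylNormSq_nonneg hx
  have h5 := hpos φ hφ x hx
  have h6 := half_pred_pos hn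
  refine hg.weylF_eq_zero hx (le_antisymm (not_lt.1 fun h => ?_) h3)
  have h7 : 0 < 4 * ((n : ℝ) - 1) * weylNormSq (coeff g φ) x / ((n - 1) / 2 : ℕ) *
    lowestEigenvalueSum (coeff g φ) ((n - 1) / 2) x := by positivity
  linarith

end Closed

/-! ### Flat linear systems of first order equations -/

section FlatSystem

set_option maxSynthPendingDepth 3

open Metric

variable {X Y E : Type*} [NormedAddCommGroup X] [NormedSpace ℝ X] [NormedAddCommGroup Y]
  [NormedSpace ℝ Y] [NormedAddCommGroup E] [NormedSpace ℝ E]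

/-- Local bounds for a smooth map and the remainder of its first order expansion. -/
lemma exists_local_bounds {f : X → Y} {U : Set X} (hU : IsOpen U) (hf : ContDiffOn ℝ ∞ f U)
    {p : X} (hp : p ∈ U) : ∃ r > 0, ∃ C ≥ 0, ball p r ⊆ U ∧
      (∀ x ∈ ball p r, ‖f x‖ ≤ C) ∧ (∀ x ∈ ball p r, ‖fderiv ℝ f x‖ ≤ C) ∧
      (∀ x ∈ ball p r, ∀ y ∈ ball p r, ‖f y - f x‖ ≤ C * ‖y - x‖) ∧
      ∀ x ∈ ball p r, ∀ y ∈ ball p r, ‖f y - f x - fderiv ℝ f x (y - x)‖ ≤ C * ‖y - x‖ ^ 2 := by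
  have h1 : ContDiffOn ℝ ∞ (fderiv ℝ f) U := hf.fderiv_of_isOpen hU (by simp)
  have h2 : ContDiffOn ℝ ∞ (fderiv ℝ (fderiv ℝ f)) U := h1.fderiv_of_isOpen hU (by simp)
  set C := (‖f p‖ + 1) + (‖fderiv ℝ f p‖ + 1) + (‖fderiv ℝ (fderiv ℝ f) p‖ + 1) with hC
  have n0 := norm_nonneg (f p)
  have n1 := norm_nonneg (fderiv ℝ f p)
  have n2 := norm_nonneg (fderiv ℝ (fderiv ℝ f) p)
  have hev : ∀ᶠ x in nhds p, x ∈ U ∧ ‖f x‖ ≤ C ∧ ‖fderiv ℝ f x‖ ≤ C ∧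
      ‖fderiv ℝ (fderiv ℝ f) x‖ ≤ C := by
    have c0 : ContinuousAt (fun x => ‖f x‖) p :=
      (hf.continuousOn.continuousAt (hU.mem_nhds hp)).norm
    have c1 : ContinuousAt (fun x => ‖fderiv ℝ f x‖) p :=
      (h1.continuousOn.continuousAt (hU.mem_nhds hp)).norm
    have c2 : ContinuousAt (fun x => ‖fderiv ℝ (fderiv ℝ f) x‖) p :=
      (h2.continuousOn.continuousAt (hU.mem_nhds hp)).norm
    have b0 := c0.eventually_lt continuousAt_const (show ‖f p‖ < C by linarith)
    have b1 := c1.eventually_lt continuousAt_const (show ‖fderiv ℝ f p‖ < C by linarith)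
    have b2 := c2.eventually_lt continuousAt_const
      (show ‖fderiv ℝ (fderiv ℝ f) p‖ < C by linarith)
    filter_upwards [hU.mem_nhds hp, b0, b1, b2] with x a0 a1 a2 a3
    exact ⟨a0, a1.le, a2.le, a3.le⟩
  obtain ⟨r, hr, hball⟩ := Metric.eventually_nhds_iff_ball.1 hev
  have hd0 : ∀ x ∈ ball p r, DifferentiableAt ℝ f x := fun x hx =>
    (hf.contDiffAt (hU.mem_nhds (hball x hx).1)).differentiableAt (by simp)
  have hd1 : ∀ x ∈ ball p r, DifferentiableAt ℝ (fderiv ℝ f) x := fun x hx =>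
    (h1.contDiffAt (hU.mem_nhds (hball x hx).1)).differentiableAt (by simp)
  refine ⟨r, hr, C, by linarith, fun x hx => (hball x hx).1, fun x hx => (hball x hx).2.1,
    fun x hx => (hball x hx).2.2.1, fun x hx y hy => ?_, fun x hx y hy => ?_⟩
  · exact (convex_ball p r).norm_image_sub_le_of_norm_fderiv_le hd0
      (fun z hz => (hball z hz).2.2.1) hx hy
  · have hseg : segment ℝ x y ⊆ ball p r := (convex_ball p r).segment_subset hx hy
    have := (convex_segment x y).norm_image_sub_le_of_norm_hasFDerivWithin_le'
      (f := f) (f' := fderiv ℝ f) (φ := fderiv ℝ f x) (C := C * ‖y - x‖)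
      (fun z hz => (hd0 z (hseg hz)).hasFDerivAt.hasFDerivWithinAt) (fun z hz => ?_)
      (left_mem_segment ℝ x y) (right_mem_segment ℝ x y)
    · rwa [mul_assoc, ← sq] at this
    · have h3 := (convex_ball p r).norm_image_sub_le_of_norm_fderiv_le hd1
        (fun z hz => (hball z hz).2.2.2) hx (hseg hz)
      refine h3.trans (mul_le_mul_of_nonneg_left ?_ (by linarith))
      obtain ⟨a, b, ha, hb, hab, rfl⟩ := hz
      have e : a • x + b • y - x = b • (y - x) := by
        rw [← eq_sub_iff_add_eq] at hab
        rw [hab]; module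
      rw [e, norm_smul, Real.norm_of_nonneg hb]
      exact mul_le_of_le_one_left (norm_nonneg _) (by linarith)

/-- Global solutions on `[0,1]` of linear equations with small coefficients. -/
lemma exists_linear_ode [CompleteSpace E] {B : ℝ → E →L[ℝ] E}
    (hB : ContinuousOn B (Set.Icc 0 1)) (hb : ∀ t ∈ Set.Icc (0 : ℝ) 1, ‖B t‖ ≤ 1 / 2) (s₀ : E) :
    ∃ σ : ℝ → E, σ 0 = s₀ ∧
      (∀ t ∈ Set.Icc (0 : ℝ) 1, HasDerivWithinAt σ (B t (σ t)) (Set.Icc 0 1) t) ∧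
      ∀ t ∈ Set.Icc (0 : ℝ) 1, ‖σ t‖ ≤ ‖s₀‖ * Real.exp 1 := by
  have hn := norm_nonneg s₀
  -- On the ball of radius `‖s₀‖ + 1` about `s₀` the speed is at most `(2 ‖s₀‖ + 1) / 2 ≤ ‖s₀‖ + 1`,
  -- so the solution stays there for unit time.
  have hpl : IsPicardLindelof (fun t σ => B t σ) (tmin := 0) (tmax := 1)
      ⟨0, by simp⟩ s₀ ⟨‖s₀‖ + 1, by positivity⟩ 0 ⟨‖s₀‖ + 1, by positivity⟩ ⟨1 / 2, by norm_num⟩ := by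
    refine ⟨fun t ht => ?_, fun σ _ => hB.clm_apply continuousOn_const, fun t ht σ hσ => ?_, ?_⟩
    · exact ((B t).lipschitz.weaken (hb t ht)).lipschitzOnWith
    · have h1 : ‖σ‖ ≤ ‖s₀‖ + (‖s₀‖ + 1) := by
        have h2 : ‖σ - s₀‖ ≤ ‖s₀‖ + 1 := by
          rw [← dist_eq_norm]; exact hσ
        have := norm_add_le (σ - s₀) s₀
        rw [sub_add_cancel] at this
        linarith
      have h3 : ‖B t σ‖ ≤ 1 / 2 * ‖σ‖ := (B t).le_of_opNorm_le (hb t ht) σ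
      change ‖B t σ‖ ≤ ‖s₀‖ + 1
      linarith
    · simp
  obtain ⟨σ, h0, hσ⟩ := hpl.exists_eq_forall_mem_Icc_hasDerivWithinAt₀
  refine ⟨σ, h0, hσ, fun t ht => ?_⟩
  have hg := norm_le_gronwallBound_of_norm_deriv_right_le (f := σ) (f' := fun t => B t (σ t))
    (δ := ‖s₀‖) (K := 1 / 2) (ε := 0) (a := 0) (b := 1)
    (fun t ht => (hσ t ht).continuousWithinAt)
    (fun t ht => ((hσ t ⟨ht.1, ht.2.le⟩).mono_of_mem_nhdsWithin
      (Icc_mem_nhdsGE_of_mem ht)))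
    (by rw [← h0]) (fun t ht => by
      rw [add_zero]; exact (B t).le_of_opNorm_le (hb t ⟨ht.1, ht.2.le⟩) _) t ht
  rw [gronwallBound_ε0] at hg
  refine hg.trans (mul_le_mul_of_nonneg_left (Real.exp_le_exp.2 ?_) hn)
  linarith [ht.2]

/-- The Grönwall estimate behind `exists_flat_section`. There `a`, `c` are the values of `A` at `p +
t • y`, `p + t • x`, `d` is the derivative of `A` at the latter point, and `u'`, `u` are the ray
solutions. If `t • c h u` is the first variation of the solution, the derivative of the defect is a
small multiple of the defect plus `O(‖h‖²)`; flatness cancels the terms linear in `h`. -/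
lemma norm_flat_remainder_le {a c : X →L[ℝ] E →L[ℝ] E} {d : X →L[ℝ] X →L[ℝ] E →L[ℝ] E}
    {x y h : X} {u : E} {t C b : ℝ} (hC : 0 ≤ C) (ht : t ∈ Set.Icc (0 : ℝ) 1) (hyx : y = x + h)
    (hy : ‖y‖ ≤ 1) (hfl : d x h u + c h (c x u) = d h x u + c x (c h u)) (hay : ‖a y‖ ≤ 1 / 2)
    (hc : ‖c‖ ≤ C) (hd : ‖d‖ ≤ C) (hL : ‖a - c‖ ≤ C * ‖h‖)
    (hT : ‖a - c - d (t • h)‖ ≤ C * ‖h‖ ^ 2) (hu : ‖u‖ ≤ b) (u' : E) :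
    ‖a y u' - c x u - (t • (d x h u + c h (c x u)) + (1 : ℝ) • c h u)‖ ≤
      1 / 2 * ‖u' - u - t • c h u‖ + 2 * C * (1 + C) * b * ‖h‖ ^ 2 := by
  have hdec : a y u' - c x u - (t • (d x h u + c h (c x u)) + (1 : ℝ) • c h u) =
      a y (u' - u - t • c h u) + ((a - c - d (t • h)) y u + t • d h h u) +
        t • ((a - c) y (c h u) + c h (c h u)) := by
    have e1 : c x u = c y u - c h u := by rw [hyx, map_add, add_apply]; abel
    have e2 : c x (c h u) = c y (c h u) - c h (c h u) := by rw [hyx, map_add, add_apply]; abel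
    have e3 : d h x u = d h y u - d h h u := by rw [hyx, map_add, add_apply]; abel
    rw [hfl, e1, e2, e3]
    simp only [sub_apply, map_smul, map_sub, smul_apply]
    module
  have hCb : ∀ (L : X →L[ℝ] E →L[ℝ] E) (N : ℝ) (_ : ‖L‖ ≤ N) (w : X) (z : E),
      ‖L w z‖ ≤ N * ‖w‖ * ‖z‖ := fun L N hN w z =>
    (L w).le_of_opNorm_le (L.le_of_opNorm_le hN w) z
  have hh0 := norm_nonneg h
  have hb0 : 0 ≤ b := (norm_nonneg u).trans hu
  have hts : ∀ z : E, ‖t • z‖ ≤ ‖z‖ := fun z => by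
    rw [norm_smul, Real.norm_of_nonneg ht.1]
    exact mul_le_of_le_one_left (norm_nonneg z) ht.2
  have n1 : ‖a y (u' - u - t • c h u)‖ ≤ 1 / 2 * ‖u' - u - t • c h u‖ :=
    (a y).le_of_opNorm_le hay _
  have n2 : ‖(a - c - d (t • h)) y u‖ ≤ C * ‖h‖ ^ 2 * b := by
    refine (hCb _ _ hT y _).trans ?_
    calc C * ‖h‖ ^ 2 * ‖y‖ * ‖u‖ ≤ C * ‖h‖ ^ 2 * 1 * b := by gcongr
      _ = _ := by ring
  have n3 : ‖t • d h h u‖ ≤ C * ‖h‖ ^ 2 * b := by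
    refine (hts _).trans ((hCb _ _ (d.le_of_opNorm_le hd h) h _).trans ?_)
    calc C * ‖h‖ * ‖h‖ * ‖u‖ ≤ C * ‖h‖ * ‖h‖ * b := by gcongr
      _ = _ := by ring
  have n4 : ‖c h u‖ ≤ C * ‖h‖ * b := by
    refine (hCb _ _ hc h _).trans ?_
    gcongr
  have n5 : ‖(a - c) y (c h u)‖ ≤ C ^ 2 * ‖h‖ ^ 2 * b := by
    refine (hCb _ _ hL y _).trans ?_
    calc C * ‖h‖ * ‖y‖ * ‖c h u‖ ≤ C * ‖h‖ * 1 * (C * ‖h‖ * b) := by gcongr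
      _ = _ := by ring
  have n6 : ‖c h (c h u)‖ ≤ C ^ 2 * ‖h‖ ^ 2 * b := by
    refine (hCb _ _ hc h _).trans ?_
    calc C * ‖h‖ * ‖c h u‖ ≤ C * ‖h‖ * (C * ‖h‖ * b) := by gcongr
      _ = _ := by ring
  rw [hdec]
  refine (norm_add_le _ _).trans ?_
  have m1 := norm_add_le (a y (u' - u - t • c h u)) ((a - c - d (t • h)) y u + t • d h h u)
  have m2 := norm_add_le ((a - c - d (t • h)) y u) (t • d h h u)
  have m3 := norm_add_le ((a - c) y (c h u)) (c h (c h u))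
  have m4 := hts ((a - c) y (c h u) + c h (c h u))
  have : 2 * C * (1 + C) * b * ‖h‖ ^ 2 = C * ‖h‖ ^ 2 * b + C * ‖h‖ ^ 2 * b +
    (C ^ 2 * ‖h‖ ^ 2 * b + C ^ 2 * ‖h‖ ^ 2 * b) := by ring
  linarith

/-- A linear system `ds = A s` whose connection `d - A` is flat has local solutions with
arbitrary initial value. -/
theorem exists_flat_section [CompleteSpace E] {A : X → X →L[ℝ] E →L[ℝ] E} {U : Set X}
    (hU : IsOpen U) (hA : ContDiffOn ℝ ∞ A U)
    (hflat : ∀ x ∈ U, ∀ v w, fderiv ℝ A x v w + A x w ∘L A x v =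
      fderiv ℝ A x w v + A x v ∘L A x w) {p : X} (hp : p ∈ U) :
    ∃ r > 0, ball p r ⊆ U ∧ ∀ s₀ : E, ∃ s : X → E, s p = s₀ ∧
      ∀ x ∈ ball p r, HasFDerivAt s ((A x).flip (s x)) x := by
  obtain ⟨r₁, hr₁, C, hC, hsub, hAb, hDb, hLip, hTay⟩ := exists_local_bounds hU hA hp
  -- `C * r ≤ 1 / 2` is the smallness needed by `exists_linear_ode`; `r ≤ 1` gives the bound `‖y‖ ≤
  -- 1` in `norm_flat_remainder_le`.
  set r := min r₁ (1 / (2 * (C + 1))) with hr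
  have hr0 : 0 < r := lt_min hr₁ (by positivity)
  have hrC : C * r ≤ 1 / 2 := by
    calc C * r ≤ (C + 1) * (1 / (2 * (C + 1))) :=
          mul_le_mul (by linarith) (min_le_right _ _) hr0.le (by linarith)
      _ = 1 / 2 := by field_simp
  have hr1 : r ≤ 1 := by
    refine (min_le_right _ _).trans ?_
    rw [div_le_one (by positivity)]; linarith
  have hrr : ball p r ⊆ ball p r₁ := ball_subset_ball (min_le_left _ _)
  have hmem : ∀ y : X, ‖y‖ < r → ∀ t ∈ Set.Icc (0 : ℝ) 1, p + t • y ∈ ball p r₁ := by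
    intro y hy t ht
    apply hrr
    rw [mem_ball, dist_eq_norm, add_sub_cancel_left, norm_smul, Real.norm_of_nonneg ht.1]
    exact (mul_le_of_le_one_left (norm_nonneg y) ht.2).trans_lt hy
  have hray : ∀ y : X, ∀ t : ℝ, HasDerivAt (fun t : ℝ => p + t • y) y t := fun y t => by
    simpa using ((hasDerivAt_id t).smul_const y).const_add p
  have hAray : ∀ y : X, ‖y‖ < r → ∀ t ∈ Set.Icc (0 : ℝ) 1,
      HasDerivAt (fun t : ℝ => A (p + t • y)) (fderiv ℝ A (p + t • y) y) t := by
    intro y hy t ht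
    have hd : DifferentiableAt ℝ A (p + t • y) :=
      (hA.contDiffAt (hU.mem_nhds (hsub (hmem y hy t ht)))).differentiableAt (by simp)
    exact HasFDerivAt.comp_hasDerivAt (f := fun t : ℝ => p + t • y) t hd.hasFDerivAt (hray y t)
  have hBb : ∀ y : X, ‖y‖ < r → ∀ t ∈ Set.Icc (0 : ℝ) 1, ‖A (p + t • y) y‖ ≤ 1 / 2 := by
    intro y hy t ht
    refine ((A (p + t • y)).le_of_opNorm_le (hAb _ (hmem y hy t ht)) y).trans ?_
    exact (mul_le_mul_of_nonneg_left hy.le hC).trans hrC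
  refine ⟨r, hr0, hrr.trans hsub, fun s₀ => ?_⟩
  -- Solve along the ray `t ↦ p + t • y`; the section at `p + y` will be the value at time `1`.
  have hex : ∀ y : X, ∃ σ : ℝ → E, ‖y‖ < r → (σ 0 = s₀ ∧
      (∀ t ∈ Set.Icc (0 : ℝ) 1, HasDerivWithinAt σ (A (p + t • y) y (σ t)) (Set.Icc 0 1) t) ∧
      ∀ t ∈ Set.Icc (0 : ℝ) 1, ‖σ t‖ ≤ ‖s₀‖ * Real.exp 1) := by
    intro y
    by_cases hy : ‖y‖ < r
    · obtain ⟨σ, hσ⟩ := exists_linear_ode (B := fun t => A (p + t • y) y)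
        (fun t ht => (((hAray y hy t ht).clm_apply
          (hasDerivAt_const t y)).continuousAt).continuousWithinAt) (hBb y hy) s₀
      exact ⟨σ, fun _ => hσ⟩
    · exact ⟨0, fun h => absurd h hy⟩
  choose σ hσ using hex
  set b := ‖s₀‖ * Real.exp 1 with hb
  have hb0 : 0 ≤ b := by positivity
  set D := 2 * C * (1 + C) * b with hD
  have hD0 : 0 ≤ D := by positivity
  have key : ∀ x y : X, ‖x‖ < r → ‖y‖ < r →
      ‖σ y 1 - σ x 1 - A (p + x) (y - x) (σ x 1)‖ ≤
        (D / (1 / 2) * (Real.exp (1 / 2 * 1) - 1)) * ‖y - x‖ ^ 2 := by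
    intro x y hx hy
    obtain ⟨hx0, hxd, hxb⟩ := hσ x hx
    obtain ⟨hy0, hyd, hyb⟩ := hσ y hy
    set h := y - x with hh
    -- The defect between the increment of the ray solutions and the expected derivative. It
    -- vanishes at `t = 0`, so Grönwall gives a bound quadratic in `h` at `t = 1`.
    set v : ℝ → E := fun t => σ y t - σ x t - t • A (p + t • x) h (σ x t) with hv
    set v' : ℝ → E := fun t => A (p + t • y) y (σ y t) - A (p + t • x) x (σ x t) -
      (t • (fderiv ℝ A (p + t • x) x h (σ x t) + A (p + t • x) h (A (p + t • x) x (σ x t))) +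
        (1 : ℝ) • A (p + t • x) h (σ x t)) with hv'
    have hvd : ∀ t ∈ Set.Icc (0 : ℝ) 1, HasDerivWithinAt v (v' t) (Set.Icc 0 1) t := by
      intro t ht
      have h1 : HasDerivAt (fun t : ℝ => A (p + t • x) h) (fderiv ℝ A (p + t • x) x h) t := by
        simpa using (hAray x hx t ht).clm_apply (hasDerivAt_const t h)
      exact ((hyd t ht).sub (hxd t ht)).sub
        ((hasDerivWithinAt_id t _).smul (h1.hasDerivWithinAt.clm_apply (hxd t ht)))
    have hbound : ∀ t ∈ Set.Ico (0 : ℝ) 1, ‖v' t‖ ≤ 1 / 2 * ‖v t‖ + D * ‖h‖ ^ 2 := by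
      intro t ht'
      have ht : t ∈ Set.Icc (0 : ℝ) 1 := ⟨ht'.1, ht'.2.le⟩
      have hxm := hmem x hx t ht
      have hym := hmem y hy t ht
      have hdiff : p + t • y - (p + t • x) = t • h := by rw [hh]; module
      have hth : ‖t • h‖ ≤ ‖h‖ := by
        rw [norm_smul, Real.norm_of_nonneg ht.1]
        exact mul_le_of_le_one_left (norm_nonneg h) ht.2
      have hT : ‖A (p + t • y) - A (p + t • x) - fderiv ℝ A (p + t • x) (t • h)‖ ≤
          C * ‖h‖ ^ 2 := by
        have := hTay _ hxm _ hym
        rw [hdiff] at this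
        refine this.trans (mul_le_mul_of_nonneg_left ?_ hC)
        exact pow_le_pow_left₀ (norm_nonneg _) hth 2
      have hL : ‖A (p + t • y) - A (p + t • x)‖ ≤ C * ‖h‖ := by
        have := hLip _ hxm _ hym
        rw [hdiff] at this
        exact this.trans (mul_le_mul_of_nonneg_left hth hC)
      have hfl := congrArg (fun L : E →L[ℝ] E => L (σ x t)) (hflat _ (hsub hxm) x h)
      have hyx : y = x + h := by rw [hh]; abel
      exact norm_flat_remainder_le hC ht hyx (hy.le.trans hr1) hfl (hBb y hy t ht)
        (hAb _ hxm) (hDb _ hxm) hL hT (hxb t ht) (σ y t)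
    have hg := norm_le_gronwallBound_of_norm_deriv_right_le (f := v) (f' := v')
      (δ := 0) (K := 1 / 2) (ε := D * ‖h‖ ^ 2) (a := 0) (b := 1)
      (fun t ht => (hvd t ht).continuousWithinAt)
      (fun t ht => (hvd t ⟨ht.1, ht.2.le⟩).mono_of_mem_nhdsWithin (Icc_mem_nhdsGE_of_mem ht))
      (by simp [hv, hx0, hy0]) hbound 1 (by simp)
    rw [gronwallBound_of_K_ne_0 (by norm_num)] at hg
    simp only [hv, one_smul, zero_mul, zero_add, sub_zero] at hg
    refine hg.trans_eq ?_
    ring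
  refine ⟨fun z => σ (z - p) 1, ?_, fun x hx => ?_⟩
  -- The ray to `p` itself is constant and its equation is `σ' = 0`, whence the initial value.
  · obtain ⟨h0, h1, -⟩ := hσ 0 (by simpa using hr0)
    have hc := constant_of_derivWithin_zero (f := σ 0) (a := 0) (b := 1)
      (fun t ht => (h1 t ht).differentiableWithinAt) (fun t ht => by
        rw [(h1 t ⟨ht.1, ht.2.le⟩).derivWithin (uniqueDiffOn_Icc zero_lt_one t ⟨ht.1, ht.2.le⟩)]
        simp) 1 (by simp)
    simp only [sub_self, hc, h0]
  · have hx' : ‖x - p‖ < r := by rwa [← dist_eq_norm]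
    -- An error of order `‖z - x‖²` gives differentiability with the prescribed derivative.
    have hO : (fun z => σ (z - p) 1 - σ (x - p) 1 - A x (z - x) (σ (x - p) 1)) =O[nhds x]
        fun z => ‖z - x‖ ^ 2 := by
      refine Asymptotics.IsBigO.of_bound (D / (1 / 2) * (Real.exp (1 / 2 * 1) - 1)) ?_
      filter_upwards [isOpen_ball.mem_nhds hx] with z hz
      have hz' : ‖z - p‖ < r := by rwa [← dist_eq_norm]
      have := key (x - p) (z - p) hx' hz'
      rw [sub_sub_sub_cancel_right, add_sub_cancel] at this
      rwa [Real.norm_of_nonneg (by positivity)]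
    have h1 := Asymptotics.IsBigO.hasFDerivAt (𝕜 := ℝ) hO one_lt_two
    have h2 : HasFDerivAt (fun z => A x (z - x) (σ (x - p) 1)) ((A x).flip (σ (x - p) 1)) x := by
      have := ((A x).flip (σ (x - p) 1)).hasFDerivAt.comp x ((hasFDerivAt_id x).sub_const x)
      rw [ContinuousLinearMap.comp_id] at this
      exact this
    have h3 := (h1.add h2).add_const (σ (x - p) 1)
    rw [zero_add] at h3
    refine h3.congr_of_eventuallyEq (Filter.Eventually.of_forall fun z => ?_)
    simp

/-- Solutions of a linear system with smooth coefficients are smooth. -/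
lemma contDiffOn_of_hasFDerivAt {A : X → X →L[ℝ] E →L[ℝ] E} {U : Set X} (hU : IsOpen U)
    (hA : ContDiffOn ℝ ∞ A U) {s : X → E}
    (hs : ∀ x ∈ U, HasFDerivAt s ((A x).flip (s x)) x) : ContDiffOn ℝ ∞ s U := by
  rw [contDiffOn_infty]
  intro k
  induction k with
  | zero =>
    exact contDiffOn_zero.2 fun x hx => (hs x hx).continuousAt.continuousWithinAt
  | succ k ih =>
    rw [Nat.cast_succ, contDiffOn_succ_iff_fderiv_of_isOpen hU]
    refine ⟨fun x hx => (hs x hx).differentiableAt.differentiableWithinAt, by simp, ?_⟩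
    have hAk : ContDiffOn ℝ k A U := hA.of_le (by exact_mod_cast le_top)
    have hfl : ContDiffOn ℝ k (fun x => (A x).flip) U :=
      (ContinuousLinearMap.flipₗᵢ ℝ X E E).contDiff.comp_contDiffOn hAk
    -- Bootstrapping: if `s` is `C^k`, so is the right side of the equation, which is the derivative
    -- of `s`.
    have h1 : ContDiffOn ℝ k (fun x => (A x).flip (s x)) U := hfl.clm_apply ih
    exact h1.congr fun x hx => (hs x hx).fderiv

end FlatSystem

section FlatMatrixSystem

set_option maxSynthPendingDepth 3

variable {ι : Type*} [Fintype ι] [DecidableEq ι]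

/-- The linear map `v, s ↦ vᵢ s_b e_a`. -/
def elemForm (i : Fin n) (a b : ι) : Coord n →L[ℝ] (ι → ℝ) →L[ℝ] (ι → ℝ) :=
  (EuclideanSpace.proj i : Coord n →L[ℝ] ℝ).smulRight
    ((ContinuousLinearMap.proj (R := ℝ) (φ := fun _ : ι => ℝ) b).smulRight (Pi.single a (1 : ℝ)))

/-- The matrix-valued one-form with components `N i`. -/
def connForm (N : Fin n → Coord n → Matrix ι ι ℝ) (x : Coord n) :
    Coord n →L[ℝ] (ι → ℝ) →L[ℝ] (ι → ℝ) :=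
  ∑ i, ∑ a, ∑ b, N i x a b • elemForm i a b

lemma sum_elemForm_apply (c : Fin n → ι → ι → ℝ) (v : Coord n) (s : ι → ℝ) (e : ι) :
    (∑ i, ∑ a, ∑ b, c i a b • elemForm i a b : Coord n →L[ℝ] (ι → ℝ) →L[ℝ] (ι → ℝ)) v s e =
      ∑ i, v i * ∑ b, c i e b * s b := by
  simp only [sum_apply, smul_apply, Finset.sum_apply, Pi.smul_apply, elemForm,
    ContinuousLinearMap.smulRight_apply, EuclideanSpace.coe_proj, ContinuousLinearMap.proj_apply,
    smul_eq_mul, Pi.single_apply]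
  refine Finset.sum_congr rfl fun i _ => ?_
  rw [Finset.sum_eq_single e (fun a _ ha => by simp [ha.symm]) (by simp), Finset.mul_sum]
  refine Finset.sum_congr rfl fun b _ => ?_
  simp; ring

lemma connForm_apply (N : Fin n → Coord n → Matrix ι ι ℝ) (x v : Coord n) (s : ι → ℝ) :
    connForm N x v s = ∑ i, v i • (N i x).mulVec s := by
  ext e
  refine (sum_elemForm_apply (fun i a b => N i x a b) v s e).trans ?_
  simp [Matrix.mulVec, dotProduct]

lemma fderiv_connForm_apply {N : Fin n → Coord n → Matrix ι ι ℝ} {U : Set (Coord n)}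
    (hU : IsOpen U) (hN : ∀ i, SmoothM U (N i)) {x : Coord n} (hx : x ∈ U) (v w : Coord n)
    (s : ι → ℝ) : fderiv ℝ (connForm N) x v w s =
      ∑ j, ∑ i, (w j * v i) • (mpd i (N j) x).mulVec s := by
  have h : HasFDerivAt (connForm N) (∑ i, ∑ a, ∑ b,
      (fderiv ℝ (fun y => N i y a b) x).smulRight
        (elemForm i a b : Coord n →L[ℝ] (ι → ℝ) →L[ℝ] (ι → ℝ))) x := by
    unfold connForm
    refine HasFDerivAt.fun_sum fun i _ => HasFDerivAt.fun_sum fun a _ =>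
      HasFDerivAt.fun_sum fun b _ => ?_
    exact ((hN i).dAt hU hx a b).hasFDerivAt.smul_const (elemForm i a b)
  rw [h.fderiv]
  have h2 : (∑ i, ∑ a, ∑ b, (fderiv ℝ (fun y => N i y a b) x).smulRight
        (elemForm i a b : Coord n →L[ℝ] (ι → ℝ) →L[ℝ] (ι → ℝ))) v =
      ∑ i, ∑ a, ∑ b, (fderiv ℝ (fun y => N i y a b) x v) • elemForm i a b := by
    simp only [sum_apply, ContinuousLinearMap.smulRight_apply]
  rw [h2]
  ext e
  rw [sum_elemForm_apply]
  simp only [Finset.sum_apply, Pi.smul_apply, smul_eq_mul, Matrix.mulVec, dotProduct]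
  refine Finset.sum_congr rfl fun j _ => ?_
  simp only [mul_assoc, ← Finset.mul_sum]
  congr 1
  simp only [fderiv_eq_sum_pderiv v, Finset.sum_mul, Finset.mul_sum, mpd]
  rw [Finset.sum_comm]
  exact Finset.sum_congr rfl fun i _ => Finset.sum_congr rfl fun b _ => by ring

lemma contDiffOn_connForm {N : Fin n → Coord n → Matrix ι ι ℝ} {U : Set (Coord n)}
    (hN : ∀ i, SmoothM U (N i)) : ContDiffOn ℝ ∞ (connForm N) U := by
  unfold connForm
  exact ContDiffOn.sum fun i _ => ContDiffOn.sum fun a _ => ContDiffOn.sum fun b _ =>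
    (hN i a b).smul contDiffOn_const

/-- A system `∂ᵢ s = Nᵢ s` satisfying the integrability conditions has local solutions with
arbitrary initial value. -/
theorem exists_flat_section_matrix {N : Fin n → Coord n → Matrix ι ι ℝ} {U : Set (Coord n)}
    (hU : IsOpen U) (hN : ∀ i, SmoothM U (N i))
    (hflat : ∀ x ∈ U, ∀ i j, mpd i (N j) x + N j x * N i x = mpd j (N i) x + N i x * N j x)
    {p : Coord n} (hp : p ∈ U) :
    ∃ r > 0, Metric.ball p r ⊆ U ∧ ∀ s₀ : ι → ℝ, ∃ s : Coord n → ι → ℝ, s p = s₀ ∧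
      (∀ a, ContDiffOn ℝ ∞ (fun x => s x a) (Metric.ball p r)) ∧
      ∀ x ∈ Metric.ball p r, ∀ i a, pderiv i (fun y => s y a) x = (N i x).mulVec (s x) a := by
  have hA := contDiffOn_connForm hN
  have hfl : ∀ x ∈ U, ∀ v w, fderiv ℝ (connForm N) x v w + connForm N x w ∘L connForm N x v =
      fderiv ℝ (connForm N) x w v + connForm N x v ∘L connForm N x w := by
    intro x hx v w
    ext1 s
    have key : ∀ v w, fderiv ℝ (connForm N) x v w s + connForm N x w (connForm N x v s) =
        ∑ j, ∑ i, (w j * v i) • (mpd i (N j) x + N j x * N i x).mulVec s := by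
      intro v w
      rw [fderiv_connForm_apply hU hN hx, connForm_apply, connForm_apply]
      simp only [Matrix.mulVec_sum, Matrix.mulVec_smul, Matrix.mulVec_mulVec, Matrix.add_mulVec,
        smul_add, Finset.sum_add_distrib, Finset.smul_sum, smul_smul]
    have h1 := key v w
    have h2 := key w v
    simp only [add_apply, ContinuousLinearMap.comp_apply]
    rw [h1, h2, Finset.sum_comm]
    exact Finset.sum_congr rfl fun i _ => Finset.sum_congr rfl fun j _ => by
      rw [hflat x hx, mul_comm]
  obtain ⟨r, hr, hsub, hex⟩ := exists_flat_section hU hA hfl hp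
  refine ⟨r, hr, hsub, fun s₀ => ?_⟩
  obtain ⟨s, hs0, hs⟩ := hex s₀
  refine ⟨s, hs0, fun a => ?_, fun x hx i a => ?_⟩
  · exact contDiffOn_pi.1 (contDiffOn_of_hasFDerivAt Metric.isOpen_ball (hA.mono hsub) hs) a
  · have h := hasFDerivAt_pi'.1 (hs x hx) a
    rw [pderiv, h.fderiv]
    simp [connForm_apply]

end FlatMatrixSystem

/-! ### The conformal tractor connection -/

/-- The index set of the tractor bundle. -/
abbrev TractorIdx (n : ℕ) : Type := Unit ⊕ Fin n ⊕ Unit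

/-- The Schouten tensor with one index raised. -/
def schoutenEnd (g : Coord n → Matrix (Fin n) (Fin n) ℝ) (x : Coord n) :
    Matrix (Fin n) (Fin n) ℝ := schouten g x * (g x)⁻¹

/-- The connection matrices of the system
`∂ᵢσ = μᵢ`, `∇ᵢμⱼ = - Pᵢⱼ σ - gᵢⱼ ρ`, `∂ᵢρ = Pᵢᵖ μₚ`, where `P` is the Schouten tensor. -/
def tractorConn (g : Coord n → Matrix (Fin n) (Fin n) ℝ) (j : Fin n) (x : Coord n) :
    Matrix (TractorIdx n) (TractorIdx n) ℝ := fun a b =>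
  match a, b with
  | .inl _, .inl _ => 0
  | .inl _, .inr (.inl p) => (1 : Matrix (Fin n) (Fin n) ℝ) j p
  | .inl _, .inr (.inr _) => 0
  | .inr (.inl k), .inl _ => - schouten g x j k
  | .inr (.inl k), .inr (.inl p) => gam g j x p k
  | .inr (.inl k), .inr (.inr _) => - g x j k
  | .inr (.inr _), .inl _ => 0
  | .inr (.inr _), .inr (.inl p) => schoutenEnd g x j p
  | .inr (.inr _), .inr (.inr _) => 0

namespace MetricOn

variable {g : Coord n → Matrix (Fin n) (Fin n) ℝ} {U : Set (Coord n)} {x : Coord n}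

lemma smooth_tractorConn (hg : MetricOn g U) (j : Fin n) : SmoothM U (tractorConn g j) := by
  rintro (_ | k | _) (_ | p | _)
  · exact contDiffOn_const
  · exact contDiffOn_const
  · exact contDiffOn_const
  · exact (hg.smooth_schouten j k).neg
  · exact hg.smooth_gam j p k
  · exact (hg.smooth j k).neg
  · exact contDiffOn_const
  · exact (hg.smooth_schouten.mul hg.smooth_inv) j p
  · exact contDiffOn_const

lemma mpd_schoutenEnd (hg : MetricOn g U) (hx : x ∈ U) (i : Fin n) :
    mpd i (schoutenEnd g) x + schoutenEnd g x * (gam g i x).transpose =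
      cov₂ g i (schouten g) x * (g x)⁻¹ + (gam g i x).transpose * schoutenEnd g x := by
  have h : schoutenEnd g = fun y => schouten g y * (g y)⁻¹ := rfl
  rw [h, mpd_mul hg.isOpen hx hg.smooth_schouten hg.smooth_inv, hg.mpd_inv_eq hx, cov₂]
  noncomm_ring

lemma curv_eq_of_weylF (hn : 4 ≤ n) (hg : MetricOn g U) (hx : x ∈ U) (hW : weylF g x = 0)
    (i j p k : Fin n) : curv g i j x p k =
      (1 : Matrix (Fin n) (Fin n) ℝ) i p * schouten g x j k -
        g x i k * schoutenEnd g x j p + g x j k * schoutenEnd g x i p -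
        (1 : Matrix (Fin n) (Fin n) ℝ) j p * schouten g x i k := by
  have hR : riemF g x = kulkarniNomizu (g x) (schouten g x) := by
    rw [weylF_eq hn] at hW; exact sub_eq_zero.1 hW
  have h1 : ∀ i, (1 : Matrix (Fin n) (Fin n) ℝ) i p = ∑ l, (g x)⁻¹ p l * g x i l := fun i => by
    rw [← hg.mul_inv hx, Matrix.mul_apply]
    exact Finset.sum_congr rfl fun l _ => by rw [hg.inv_symm hx, mul_comm]
  have h2 : ∀ j, schoutenEnd g x j p = ∑ l, (g x)⁻¹ p l * schouten g x j l := fun j => by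
    rw [schoutenEnd, Matrix.mul_apply]
    exact Finset.sum_congr rfl fun l _ => by rw [hg.inv_symm hx, mul_comm]
  rw [hg.curv_eq_inv_mul hx, hR, Matrix.mul_apply, h1, h1, h2, h2]
  simp only [Finset.mul_sum, Finset.sum_mul, ← Finset.sum_sub_distrib, ← Finset.sum_add_distrib]
  refine Finset.sum_congr rfl fun l _ => ?_
  simp only [Matrix.of_apply, kulkarniNomizu]
  ring

/-- Block by block, the curvature of this connection is `W` (from `μ` to `μ`) and the Cotton tensor
(from `σ` to `μ` and from `μ` to `ρ`); the other blocks vanish by the symmetry of `Γ`, `g` and `P`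
and by `∇g = 0`. As `W` vanishes on an open set so does its divergence, and for `n ≥ 4` the Cotton
tensor follows. -/
lemma tractorConn_flat (hn : 4 ≤ n) (hg : MetricOn g U) (hW : ∀ y ∈ U, weylF g y = 0)
    (hx : x ∈ U) (i j : Fin n) :
    mpd i (tractorConn g j) x + tractorConn g j x * tractorConn g i x =
      mpd j (tractorConn g i) x + tractorConn g i x * tractorConn g j x := by
  have hP := fun i j => hg.schouten_symm hx i j
  have hcov : ∀ m, cov g m (weylF g) x = 0 := by
    intro m
    have h0 : pd m (weylF g) x = 0 := by
      ext a b c d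
      have := pderiv_congr (f₁ := fun y => weylF g y a b c d) (f₂ := fun _ => 0) hg.isOpen hx
        (fun y hy => by simp [hW y hy]) m
      rw [pderiv_const] at this
      exact this
    rw [cov, h0, hW x hx]
    simpa using rho_smul (gam g m x) 0 0
  have hdiv : ∀ j k l, divergence g (weyl g) j k l x = 0 := fun j k l => by
    rw [divergence_eq]; simp [hcov]
  have hcot' : ∀ i j k, cov₂ g i (schouten g) x j k = cov₂ g j (schouten g) x i k :=
    fun i j k => hg.cotton_eq_zero hn hx hdiv k i j
  have hΓ : ∀ q i j, gam g i x q j = gam g j x q i := fun q i j => hg.christoffel_symm hx q i j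
  have hPd : ∀ i j k, pderiv i (fun y => schouten g y j k) x = cov₂ g i (schouten g) x j k +
      (∑ q, gam g i x q j * schouten g x q k + ∑ q, schouten g x j q * gam g i x q k) := by
    intro i j k
    have h : cov₂ g i (schouten g) x j k = mpd i (schouten g) x j k -
        ((gam g i x).transpose * schouten g x + schouten g x * gam g i x) j k := rfl
    rw [h, Matrix.add_apply, Matrix.mul_apply, Matrix.mul_apply, mpd_apply]
    simp only [Matrix.transpose_apply]
    ring
  have hQd : ∀ i j p, pderiv i (fun y => schoutenEnd g y j p) x +
      ∑ q, schoutenEnd g x j q * gam g i x p q =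
      ∑ q, cov₂ g i (schouten g) x j q * (g x)⁻¹ q p + ∑ q, gam g i x q j * schoutenEnd g x q p :=
    fun i j p => congrFun (congrFun (hg.mpd_schoutenEnd hx i) j) p
  have hQg : schoutenEnd g x * g x = schouten g x := by
    rw [schoutenEnd, Matrix.mul_assoc, hg.inv_mul hx, mul_one]
  have hPt : (schouten g x).transpose = schouten g x := by ext a b; exact hP b a
  have hQP : (schoutenEnd g x * schouten g x).transpose = schoutenEnd g x * schouten g x := by
    rw [schoutenEnd, Matrix.transpose_mul, Matrix.transpose_mul, hPt, hg.inv_transpose hx,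
      Matrix.mul_assoc]
  ext (_ | k | _) (_ | p | _) <;>
    simp only [Matrix.add_apply, mpd_apply, Matrix.mul_apply, Fintype.sum_sum_type, tractorConn,
      Finset.univ_unique, Finset.sum_singleton, mul_zero, zero_mul, add_zero, zero_add,
      pderiv_const]
  · simp [Matrix.one_apply, hP j i]
  · simp [Matrix.one_apply, hΓ p j i]
  · simp [Matrix.one_apply, hg.symm hx j i]
  · rw [pderiv_neg, pderiv_neg, hPd, hPd, hcot' i j k]
    simp only [hΓ _ i j, neg_mul, Finset.sum_neg_distrib, mul_comm (gam g _ x _ k)]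
    ring
  · have h := hg.curv_eq_of_weylF hn hx (hW x hx) i j p k
    rw [curv_eq] at h
    simp only [Matrix.add_apply, Matrix.sub_apply, mpd_apply, Matrix.mul_apply] at h
    simp only [mul_comm (gam g _ x _ k)]
    linarith
  · rw [pderiv_neg, pderiv_neg, hg.pderiv_metric hx, hg.pderiv_metric hx]
    simp only [hg.christoffel_symm hx _ i j, mul_neg, Finset.sum_neg_distrib,
      Finset.sum_add_distrib, gam]
    ring
  · have h := congrFun (congrFun hQP i) j
    simp only [Matrix.transpose_apply, Matrix.mul_apply] at h
    simp only [mul_neg, Finset.sum_neg_distrib, hP i, hP j, h]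
  · rw [hQd, hQd]
    simp only [hcot' i j, hΓ _ i j]
  · have h : ∀ i j, ∑ q, schoutenEnd g x j q * g x i q = schouten g x j i := fun i j => by
      conv_rhs => rw [← hQg, Matrix.mul_apply]
      exact Finset.sum_congr rfl fun q _ => by rw [hg.symm hx]
    simp only [mul_neg, Finset.sum_neg_distrib, h, hP i j]

end MetricOn

/-! ### Conformal coordinates from parallel tractors -/

/-- `s` is a parallel section of the tractor bundle over `V`. -/
structure IsParallelTractor (g : Coord n → Matrix (Fin n) (Fin n) ℝ)
    (s : Coord n → TractorIdx n → ℝ) (V : Set (Coord n)) : Prop where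
  smooth : ∀ a, ContDiffOn ℝ ∞ (fun x => s x a) V
  pderiv_eq : ∀ x ∈ V, ∀ i a, pderiv i (fun y => s y a) x = (tractorConn g i x).mulVec (s x) a

/-- The component `σ` of a tractor. -/
def scalePart (s : TractorIdx n → ℝ) : ℝ := s (.inl ())
/-- The component `μ` of a tractor. -/
def formPart (s : TractorIdx n → ℝ) : Fin n → ℝ := fun p => s (.inr (.inl p))
/-- The component `ρ` of a tractor. -/
def tailPart (s : TractorIdx n → ℝ) : ℝ := s (.inr (.inr ()))

/-- The tractor with given components. -/
def mkTractor (σ : ℝ) (μ : Fin n → ℝ) (ρ : ℝ) : TractorIdx n → ℝ :=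
  Sum.elim (fun _ => σ) (Sum.elim μ fun _ => ρ)

lemma scalePart_mkTractor (σ : ℝ) (μ : Fin n → ℝ) (ρ : ℝ) :
    scalePart (mkTractor σ μ ρ) = σ := rfl
lemma formPart_mkTractor (σ : ℝ) (μ : Fin n → ℝ) (ρ : ℝ) :
    formPart (mkTractor σ μ ρ) = μ := rfl
lemma tailPart_mkTractor (σ : ℝ) (μ : Fin n → ℝ) (ρ : ℝ) :
    tailPart (mkTractor σ μ ρ) = ρ := rfl

/-- The tractor metric. -/
def tractorForm (h : Matrix (Fin n) (Fin n) ℝ) (s t : TractorIdx n → ℝ) : ℝ :=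
  scalePart s * tailPart t + tailPart s * scalePart t + formPart s ⬝ᵥ h.mulVec (formPart t)

lemma pderiv_dotProduct_mulVec {V : Set (Coord n)} (hV : IsOpen V) {x : Coord n} (hx : x ∈ V)
    {m m' : Coord n → Fin n → ℝ} {H : Coord n → Matrix (Fin n) (Fin n) ℝ}
    (hm : ∀ p, ContDiffOn ℝ ∞ (fun y => m y p) V) (hm' : ∀ p, ContDiffOn ℝ ∞ (fun y => m' y p) V)
    (hH : SmoothM V H) (i : Fin n) :
    pderiv i (fun y => m y ⬝ᵥ (H y).mulVec (m' y)) x =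
      (fun p => pderiv i (fun y => m y p) x) ⬝ᵥ (H x).mulVec (m' x) +
      m x ⬝ᵥ (mpd i H x).mulVec (m' x) +
      m x ⬝ᵥ (H x).mulVec (fun p => pderiv i (fun y => m' y p) x) := by
  have d1 := fun p => diffAt_of_smooth (hm p) hV hx
  have d2 := fun p => diffAt_of_smooth (hm' p) hV hx
  have d3 := fun p q => hH.dAt hV hx p q
  simp only [dotProduct, Matrix.mulVec]
  rw [pderiv_sum _ _ fun p _ => (d1 p).fun_mul
    (DifferentiableAt.fun_sum fun q _ => (d3 p q).fun_mul (d2 q)),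
    ← Finset.sum_add_distrib, ← Finset.sum_add_distrib]
  refine Finset.sum_congr rfl fun p _ => ?_
  rw [pderiv_mul _ (d1 p) (DifferentiableAt.fun_sum fun q _ => (d3 p q).fun_mul (d2 q)),
    pderiv_sum _ _ fun q _ => (d3 p q).fun_mul (d2 q)]
  simp only [fun q => pderiv_mul i (d3 p q) (d2 q), Finset.sum_add_distrib, mpd]
  ring

namespace IsParallelTractor

variable {g : Coord n → Matrix (Fin n) (Fin n) ℝ} {U V : Set (Coord n)} {x : Coord n}
  {s t : Coord n → TractorIdx n → ℝ}

lemma pderiv_scalePart (hs : IsParallelTractor g s V) (hx : x ∈ V) (i : Fin n) :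
    pderiv i (fun y => scalePart (s y)) x = formPart (s x) i := by
  have := hs.pderiv_eq x hx i (.inl ())
  simp only [Matrix.mulVec, dotProduct, Fintype.sum_sum_type, tractorConn, Finset.univ_unique,
    Finset.sum_singleton, zero_mul, add_zero, zero_add, Matrix.one_apply, ite_mul, one_mul,
    Finset.sum_ite_eq, Finset.mem_univ, if_true] at this
  exact this

lemma pderiv_formPart (hs : IsParallelTractor g s V) (hx : x ∈ V) (i : Fin n) :
    (fun k => pderiv i (fun y => formPart (s y) k) x) = - scalePart (s x) • schouten g x i +
      (gam g i x).transpose.mulVec (formPart (s x)) - tailPart (s x) • g x i := by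
  ext k
  have := hs.pderiv_eq x hx i (.inr (.inl k))
  simp only [Matrix.mulVec, dotProduct, Fintype.sum_sum_type, tractorConn, Finset.univ_unique,
    Finset.sum_singleton] at this
  refine this.trans ?_
  simp only [Pi.add_apply, Pi.sub_apply, Pi.smul_apply, smul_eq_mul, Matrix.mulVec, dotProduct,
    Matrix.transpose_apply, scalePart, formPart, tailPart]
  change _ + (_ + - g x i k * s x (.inr (.inr ()))) = _
  ring

lemma pderiv_tailPart (hs : IsParallelTractor g s V) (hx : x ∈ V) (i : Fin n) :
    pderiv i (fun y => tailPart (s y)) x = schouten g x i ⬝ᵥ (g x)⁻¹.mulVec (formPart (s x)) := by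
  have := hs.pderiv_eq x hx i (.inr (.inr ()))
  simp only [Matrix.mulVec, dotProduct, Fintype.sum_sum_type, tractorConn, Finset.univ_unique,
    Finset.sum_singleton, zero_mul, add_zero, zero_add] at this
  refine this.trans ?_
  change ((schouten g x * (g x)⁻¹).mulVec (formPart (s x))) i = _
  rw [← Matrix.mulVec_mulVec]
  rfl

/-- The tractor connection is metric: the `P`-terms of the `μ` and `ρ` equations cancel, as do the
`g`-terms of the `μ` and `σ` equations, and the `Γ`-terms disappear by `∇g⁻¹ = 0`. -/
lemma pderiv_tractorForm (hg : MetricOn g U) (hV : IsOpen V) (hVU : V ⊆ U)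
    (hs : IsParallelTractor g s V) (ht : IsParallelTractor g t V) (hx : x ∈ V) (i : Fin n) :
    pderiv i (fun y => tractorForm (g y)⁻¹ (s y) (t y)) x = 0 := by
  have hxU := hVU hx
  have hH : SmoothM V (fun y => (g y)⁻¹) := fun a b => (hg.smooth_inv a b).mono hVU
  have dσ : DifferentiableAt ℝ (fun y => scalePart (s y)) x :=
    diffAt_of_smooth (hs.smooth (.inl ())) hV hx
  have dσ' : DifferentiableAt ℝ (fun y => scalePart (t y)) x :=
    diffAt_of_smooth (ht.smooth (.inl ())) hV hx
  have dρ : DifferentiableAt ℝ (fun y => tailPart (s y)) x :=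
    diffAt_of_smooth (hs.smooth (.inr (.inr ()))) hV hx
  have dρ' : DifferentiableAt ℝ (fun y => tailPart (t y)) x :=
    diffAt_of_smooth (ht.smooth (.inr (.inr ()))) hV hx
  have e := pderiv_dotProduct_mulVec hV hx (m := fun y => formPart (s y))
    (m' := fun y => formPart (t y)) (H := fun y => (g y)⁻¹) (fun p => hs.smooth (.inr (.inl p)))
    (fun p => ht.smooth (.inr (.inl p))) hH i
  have hd : DifferentiableAt ℝ (fun y => formPart (s y) ⬝ᵥ (g y)⁻¹.mulVec (formPart (t y))) x := by
    simp only [dotProduct, Matrix.mulVec]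
    exact DifferentiableAt.fun_sum fun p _ =>
      (diffAt_of_smooth (hs.smooth (.inr (.inl p))) hV hx).fun_mul
        (DifferentiableAt.fun_sum fun q _ => (hH.dAt hV hx p q).fun_mul
          (diffAt_of_smooth (ht.smooth (.inr (.inl q))) hV hx))
  unfold tractorForm
  rw [pderiv_add (f₁ := fun y => scalePart (s y) * tailPart (t y) + tailPart (s y) *
      scalePart (t y)) i ((dσ.fun_mul dρ').fun_add (dρ.fun_mul dσ')) hd,
    pderiv_add i (f₁ := fun y => scalePart (s y) * tailPart (t y)) (dσ.fun_mul dρ')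
      (dρ.fun_mul dσ'), pderiv_mul i dσ dρ',
    pderiv_mul i dρ dσ', e, hs.pderiv_scalePart hx,
    ht.pderiv_scalePart hx, hs.pderiv_tailPart hx, ht.pderiv_tailPart hx, hs.pderiv_formPart hx,
    ht.pderiv_formPart hx, hg.mpd_inv_eq hxU]
  set H := (g x)⁻¹ with hHdef
  set m := formPart (s x)
  set m' := formPart (t x)
  have hsym : ∀ u w : Fin n → ℝ, u ⬝ᵥ H.mulVec w = w ⬝ᵥ H.mulVec u := fun u w => by
    rw [Matrix.dotProduct_mulVec, ← Matrix.mulVec_transpose, hg.inv_transpose hxU,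
      dotProduct_comm]
  have hgi : ∀ w : Fin n → ℝ, g x i ⬝ᵥ H.mulVec w = w i := fun w => by
    have : (g x).mulVec (H.mulVec w) = w := by
      rw [Matrix.mulVec_mulVec, hg.mul_inv hxU, Matrix.one_mulVec]
    exact congrFun this i
  have hΓ : ∀ u w : Fin n → ℝ, (gam g i x).transpose.mulVec u ⬝ᵥ H.mulVec w =
      u ⬝ᵥ (gam g i x * H).mulVec w := fun u w => by
    rw [Matrix.mulVec_transpose, ← Matrix.dotProduct_mulVec, Matrix.mulVec_mulVec]
  have hΓ' : ∀ u w : Fin n → ℝ, u ⬝ᵥ H.mulVec ((gam g i x).transpose.mulVec w) =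
      u ⬝ᵥ (H * (gam g i x).transpose).mulVec w := fun u w => by rw [Matrix.mulVec_mulVec]
  simp only [sub_dotProduct, add_dotProduct, smul_dotProduct, Matrix.mulVec_sub,
    Matrix.mulVec_add, Matrix.mulVec_smul, dotProduct_sub, dotProduct_add, dotProduct_smul,
    Matrix.neg_mulVec, Matrix.add_mulVec, dotProduct_neg, hgi, hΓ, hΓ', smul_eq_mul,
    hsym m (schouten g x i), hsym m (g x i)]
  ring

lemma tractorForm_const (hg : MetricOn g U) {p : Coord n} {r : ℝ} (hVU : Metric.ball p r ⊆ U)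
    (hs : IsParallelTractor g s (Metric.ball p r)) (ht : IsParallelTractor g t (Metric.ball p r))
    (hr : 0 < r) (hx : x ∈ Metric.ball p r) :
    tractorForm (g x)⁻¹ (s x) (t x) = tractorForm (g p)⁻¹ (s p) (t p) := by
  have hsm : ContDiffOn ℝ ∞ (fun y => tractorForm (g y)⁻¹ (s y) (t y)) (Metric.ball p r) := by
    unfold tractorForm scalePart tailPart formPart dotProduct Matrix.mulVec dotProduct
    exact (((hs.smooth _).mul (ht.smooth _)).add ((hs.smooth _).mul (ht.smooth _))).add
      (ContDiffOn.sum fun p _ => (hs.smooth _).mul (ContDiffOn.sum fun q _ =>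
        ((hg.smooth_inv p q).mono hVU).mul (ht.smooth _)))
  refine Metric.isOpen_ball.is_const_of_fderiv_eq_zero (𝕜 := ℝ) (convex_ball p r).isPreconnected
    (hsm.differentiableOn (by simp)) (fun y hy => ?_) hx (Metric.mem_ball_self hr)
  ext v
  rw [fderiv_eq_sum_pderiv]
  simp [pderiv_tractorForm hg Metric.isOpen_ball hVU hs ht hy]

end IsParallelTractor

/-- A metric with vanishing Weyl tensor is locally conformal to a flat metric. -/
theorem MetricOn.exists_conformal_coordinates {g : Coord n → Matrix (Fin n) (Fin n) ℝ}
    {U : Set (Coord n)} (hn : 4 ≤ n) (hg : MetricOn g U) (hW : ∀ y ∈ U, weylF g y = 0)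
    {p : Coord n} (hp : p ∈ U) :
    ∃ V, IsOpen V ∧ p ∈ V ∧ V ⊆ U ∧ ∃ (y : Coord n → Coord n) (τ : Coord n → ℝ),
      ContDiffOn ℝ ∞ y V ∧ ContDiffOn ℝ ∞ τ V ∧ (∀ x ∈ V, 0 < τ x) ∧
      ∀ x ∈ V, g x = τ x ^ 2 • ((jac y x).transpose * jac y x) := by
  obtain ⟨r, hr, hsub, hex⟩ := exists_flat_section_matrix hg.isOpen hg.smooth_tractorConn
    (fun x hx => hg.tractorConn_flat hn hW hx) hp
  have hex' : ∀ s₀, ∃ s : Coord n → TractorIdx n → ℝ, s p = s₀ ∧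
      IsParallelTractor g s (Metric.ball p r) := fun s₀ => by
    obtain ⟨s, h0, h1, h2⟩ := hex s₀
    exact ⟨s, h0, h1, h2⟩
  obtain ⟨B, hB, hBu⟩ := hg.exists_frame hp
  -- At `p` the tractor `s` is null with scale `1`. The rows of `B⁻¹` are an orthonormal coframe, so
  -- the `t i` are orthonormal and orthogonal to `s`. These relations persist because the tractor
  -- form is constant.
  obtain ⟨s, hs0, hs⟩ := hex' (mkTractor 1 0 0)
  choose t ht0 ht using fun i => hex' (mkTractor 0 (B⁻¹ i) 0)
  set b := Metric.ball p r with hb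
  have hpb : p ∈ b := Metric.mem_ball_self hr
  have hss : ∀ x ∈ b, tractorForm (g x)⁻¹ (s x) (s x) = 0 := fun x hx => by
    rw [IsParallelTractor.tractorForm_const hg hsub hs hs hr hx, hs0]
    simp [tractorForm, scalePart_mkTractor, formPart_mkTractor, tailPart_mkTractor]
  have hst : ∀ i, ∀ x ∈ b, tractorForm (g x)⁻¹ (s x) (t i x) = 0 := fun i x hx => by
    rw [IsParallelTractor.tractorForm_const hg hsub hs (ht i) hr hx, hs0, ht0]
    simp [tractorForm, scalePart_mkTractor, formPart_mkTractor, tailPart_mkTractor]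
  have htt : ∀ i j, ∀ x ∈ b, tractorForm (g x)⁻¹ (t i x) (t j x) =
      (1 : Matrix (Fin n) (Fin n) ℝ) i j := fun i j x hx => by
    rw [IsParallelTractor.tractorForm_const hg hsub (ht i) (ht j) hr hx, ht0, ht0]
    have h1 : B⁻¹ * (g p)⁻¹ * (B⁻¹).transpose = 1 := by
      have hBt : IsUnit B.transpose.det := by rwa [Matrix.det_transpose]
      rw [hB, ← Matrix.mul_assoc, Matrix.nonsing_inv_mul _ hBu, one_mul,
        Matrix.transpose_nonsing_inv, Matrix.mul_nonsing_inv _ hBt]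
    rw [← h1]
    simp only [tractorForm, scalePart_mkTractor, formPart_mkTractor, tailPart_mkTractor,
      mul_zero, zero_add, Matrix.mul_assoc]
    rfl
  set τ : Coord n → ℝ := fun x => scalePart (s x) with hτ
  have hτs : ContDiffOn ℝ ∞ τ b := hs.smooth (.inl ())
  set V := b ∩ τ ⁻¹' Set.Ioi 0 with hV
  have hVo : IsOpen V := hτs.continuousOn.isOpen_inter_preimage Metric.isOpen_ball isOpen_Ioi
  have hVb : V ⊆ b := Set.inter_subset_left
  have hpos : ∀ x ∈ V, 0 < τ x := fun x hx => hx.2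
  have hpV : p ∈ V := ⟨hpb, by
    change 0 < scalePart (s p)
    rw [hs0, scalePart_mkTractor]; exact one_pos⟩
  -- The coordinates are ratios of scales, as for stereographic coordinates on the projectivised
  -- null cone.
  set y : Coord n → Coord n := fun x => WithLp.toLp 2 fun i => scalePart (t i x) / τ x with hy
  have hys : ContDiffOn ℝ ∞ y V := contDiffOn_euclidean.2 fun i =>
    (((ht i).smooth (.inl ())).mono hVb).div (hτs.mono hVb) fun x hx => (hpos x hx).ne'
  refine ⟨V, hVo, hpV, hVb.trans hsub, y, τ, hys, hτs.mono hVb, hpos, fun x hx => ?_⟩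
  have hxb := hVb hx
  have hprod : ∀ i, ∀ z ∈ V, y z i * τ z = scalePart (t i z) := fun i z hz =>
    div_mul_cancel₀ _ (hpos z hz).ne'
  -- `τ dyᵢ` is the `μ`-part of `tᵢ - yᵢ s`, whose scale is zero; the `g⁻¹`-products of these
  -- covectors are thus tractor products, equal to `δᵢⱼ`, and `τ dy` is an orthonormal coframe.
  have hJ : ∀ i, τ x • jac y x i = formPart (t i x) - y x i • formPart (s x) := by
    intro i
    ext a
    have h1 := pderiv_mul a (diffAt_of_smooth (contDiffOn_coord hys i) hVo hx)
      (diffAt_of_smooth (hτs.mono hVb) hVo hx)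
    rw [pderiv_congr hVo hx (fun z hz => hprod i z hz), (ht i).pderiv_scalePart hxb,
      hs.pderiv_scalePart hxb] at h1
    simp only [Pi.smul_apply, Pi.sub_apply, smul_eq_mul, jac]
    linarith
  set H := (g x)⁻¹ with hH
  set K : Matrix (Fin n) (Fin n) ℝ := τ x • jac y x with hK
  have hKK : K * H * K.transpose = 1 := by
    ext i j
    have h1 := hss x hxb
    have h2 := hst i x hxb
    have h3 := hst j x hxb
    have h4 := htt i j x hxb
    have hsym : formPart (t i x) ⬝ᵥ H.mulVec (formPart (s x)) =
        formPart (s x) ⬝ᵥ H.mulVec (formPart (t i x)) := by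
      rw [Matrix.dotProduct_mulVec, ← Matrix.mulVec_transpose, hg.inv_transpose (hsub hxb),
        dotProduct_comm]
    have e : (K * H * K.transpose) i j = K i ⬝ᵥ H.mulVec (K j) := by
      rw [Matrix.mul_assoc]; rfl
    have hKi : ∀ i, K i = formPart (t i x) - y x i • formPart (s x) := hJ
    rw [e, hKi, hKi, ← h4]
    simp only [Matrix.mulVec_sub, Matrix.mulVec_smul, sub_dotProduct, dotProduct_sub,
      smul_dotProduct, dotProduct_smul, smul_eq_mul, hsym]
    unfold tractorForm at h1 h2 h3 ⊢
    have p1 := hprod i x hx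
    have p2 := hprod j x hx
    have p3 : scalePart (s x) = τ x := rfl
    rw [← p1, p3] at h2
    rw [← p2, p3] at h3
    rw [p3] at h1
    rw [← p1, ← p2]
    linear_combination y x i * y x j * h1 - y x j * h2 - y x i * h3
  have hgK : g x = K.transpose * K := by
    have h1 : H * K.transpose * K = 1 := by
      rw [Matrix.mul_assoc] at hKK
      exact mul_eq_one_comm.1 hKK
    have h2 := congrArg (fun L => g x * L) h1
    simp only [mul_one, ← Matrix.mul_assoc] at h2
    rw [hg.mul_inv (hsub hxb), one_mul] at h2
    exact h2.symm
  rw [hgK, hK, Matrix.transpose_smul, Matrix.smul_mul, Matrix.mul_smul, smul_smul, sq]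

/-! ### Conformally flat charts -/

lemma fderiv_apply_eq_mulVec {y : Coord n → Coord n} {x : Coord n} (hy : DifferentiableAt ℝ y x)
    (v : Coord n) (a : Fin n) : fderiv ℝ y x v a = (jac y x).mulVec v a := by
  rw [← fderiv_coord hy, fderiv_eq_sum_pderiv, Matrix.mulVec, dotProduct]
  exact Finset.sum_congr rfl fun k _ => mul_comm _ _

lemma exists_hasFDerivAt_equiv {y : Coord n → Coord n} {x : Coord n}
    (hy : DifferentiableAt ℝ y x) (hu : IsUnit (jac y x).det) :
    ∃ e : Coord n ≃L[ℝ] Coord n, HasFDerivAt y (e : Coord n →L[ℝ] Coord n) x := by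
  have hinj : Function.Injective (fderiv ℝ y x : Coord n →ₗ[ℝ] Coord n) := by
    rw [injective_iff_map_eq_zero]
    intro v hv
    have h1 : (jac y x).mulVec v = 0 := by
      ext a
      rw [← fderiv_apply_eq_mulVec hy]
      exact congrArg (fun w : Coord n => w a) hv
    have h2 : (WithLp.ofLp v : Fin n → ℝ) = 0 := by
      rw [← Matrix.one_mulVec (WithLp.ofLp v), ← Matrix.nonsing_inv_mul _ hu,
        ← Matrix.mulVec_mulVec, h1, Matrix.mulVec_zero]
    ext a
    exact congrFun h2 a
  refine ⟨(LinearEquiv.ofInjectiveEndo _ hinj).toContinuousLinearEquiv, ?_⟩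
  convert! hy.hasFDerivAt using 1

section Manifold

variable {M : Type*} [TopologicalSpace M] [ChartedSpace (Coord n) M] [IsManifold (𝓡 n) ∞ M]

/-- The Weyl–Schouten theorem: in dimension at least four a Riemannian manifold with vanishing
Weyl tensor is locally conformally flat. -/
theorem conformallyFlat_of_weylF_eq_zero (hn : 4 ≤ n) (g : SmoothMetric n M)
    (hW : ∀ φ ∈ IsManifold.maximalAtlas (𝓡 n) ∞ M, ∀ x ∈ φ.target, weylF (coeff g φ) x = 0) :
    ConformallyFlat g := by
  intro q
  have hφ := IsManifold.chart_mem_maximalAtlas (I := 𝓡 n) (n := ∞) q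
  have hq := mem_chart_source (Coord n) q
  set φ := chartAt (Coord n) q
  have hg := metricOn_coeff g hφ
  obtain ⟨V, hVo, hqV, hVφ, y, τ, hy, hτ, hτ0, hgy⟩ :=
    hg.exists_conformal_coordinates hn (hW φ hφ) (φ.map_source hq)
  have hyd : ∀ x ∈ V, DifferentiableAt ℝ y x := fun x hx =>
    (hy.contDiffAt (hVo.mem_nhds hx)).differentiableAt (by simp)
  have hu : ∀ x ∈ V, IsUnit (jac y x).det := by
    intro x hx
    have h1 := hg.det_ne (hVφ hx)
    rw [hgy x hx, Matrix.det_smul, Matrix.det_mul] at h1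
    exact (right_ne_zero_of_mul (right_ne_zero_of_mul h1)).isUnit
  obtain ⟨L, hL⟩ := exists_hasFDerivAt_equiv (hyd _ hqV) (hu _ hqV)
  set e₀ := (hy.contDiffAt (hVo.mem_nhds hqV)).toOpenPartialHomeomorph y hL (by simp) with he₀
  -- The inverse function theorem gives smoothness of the inverse at one point; restricted to `V`,
  -- where the Jacobian is invertible everywhere, the inverse is smooth on its whole domain.
  set e := e₀.restrOpen V hVo with he
  have hey : ∀ x, e x = y x := fun x => rfl
  have heV : e.source ⊆ V := Set.inter_subset_right
  have hqe : φ q ∈ e.source :=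
    ⟨ContDiffAt.mem_toOpenPartialHomeomorph_source _ hL (by simp), hqV⟩
  have hes : ContDiffOn ℝ ∞ e e.source := hy.mono heV
  have hes' : ContDiffOn ℝ ∞ e.symm e.target := by
    intro z hz
    have hx := heV (e.map_target hz)
    obtain ⟨L', hL'⟩ := exists_hasFDerivAt_equiv (hyd _ hx) (hu _ hx)
    exact (e.contDiffAt_symm hz hL' (hy.contDiffAt (hVo.mem_nhds hx))).contDiffWithinAt
  set ψ := φ.trans e with hψdef
  have hψs : ∀ m ∈ ψ.source, m ∈ φ.source ∧ φ m ∈ e.source := fun m hm => by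
    rwa [hψdef, OpenPartialHomeomorph.trans_source] at hm
  have hψt : ∀ z ∈ ψ.target, z ∈ e.target ∧ e.symm z ∈ φ.target := fun z hz => by
    rwa [hψdef, OpenPartialHomeomorph.trans_target] at hz
  have hψ : ψ ∈ IsManifold.maximalAtlas (𝓡 n) ∞ M := by
    rw [IsManifold.mem_maximalAtlas_iff_contMDiffOn]
    refine ⟨?_, ?_⟩
    · exact (contMDiffOn_iff_contDiffOn.2 hes).comp
        ((contMDiffOn_of_mem_maximalAtlas hφ).mono fun m hm => (hψs m hm).1)
        fun m hm => (hψs m hm).2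
    · exact (contMDiffOn_symm_of_mem_maximalAtlas hφ).comp
        ((contMDiffOn_iff_contDiffOn.2 hes').mono fun z hz => (hψt z hz).1)
        fun z hz => (hψt z hz).2
  -- `f = log τ` in the new coordinates, so that `e^{2f} = τ²`.
  refine ⟨ψ, hψ, ?_, fun z => Real.log (τ (e.symm z)), ?_, fun z hz => ?_⟩
  · rw [hψdef, OpenPartialHomeomorph.trans_source]
    exact ⟨hq, hqe⟩
  · have h1 : ContDiffOn ℝ ∞ (fun z => τ (e.symm z)) ψ.target :=
      hτ.comp (hes'.mono fun z hz => (hψt z hz).1) fun z hz => heV (e.map_target (hψt z hz).1)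
    exact h1.log fun z hz => (hτ0 _ (heV (e.map_target (hψt z hz).1))).ne'
  · obtain ⟨hze, hzφ⟩ := hψt z hz
    set x := e.symm z with hx
    have hxe : x ∈ e.source := e.map_target hze
    have hxV := heV hxe
    have hmem : ∀ w ∈ e.source, w ∈ φ.target ∩ φ.symm ⁻¹' ψ.source := fun w hw => by
      refine ⟨hVφ (heV hw), ?_⟩
      rw [Set.mem_preimage, hψdef, OpenPartialHomeomorph.trans_source]
      refine ⟨φ.map_target (hVφ (heV hw)), ?_⟩
      rwa [Set.mem_preimage, φ.right_inv (hVφ (heV hw))]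
    have hF : ∀ w ∈ e.source, ψ (φ.symm w) = y w := fun w hw => by
      change e (φ (φ.symm w)) = y w
      rw [φ.right_inv (hVφ (heV hw)), hey]
    have hJ : jac (fun w => ψ (φ.symm w)) x = jac y x := by
      ext a i
      exact pderiv_congr e.open_source hxe (fun w hw => by simp only [hF w hw]) i
    have h1 := (isPullback_coeff g hφ hψ).eq x (hmem x hxe)
    have hz' : ψ (φ.symm x) = z := by
      rw [hF x hxe, ← hey, hx, e.right_inv hze]
    rw [hJ, hgy x hxV] at h1
    simp only [hz'] at h1
    set J := jac y x
    have hJu : IsUnit J.det := hu x hxV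
    have hJt : IsUnit J.transpose.det := by rwa [Matrix.det_transpose]
    -- The pullback law now equates `τ² JᵀJ` with `Jᵀ N J`, where `N` is the matrix of the metric in
    -- the chart `ψ`; cancel `J`.
    have h2 := congrArg (fun N => (J.transpose)⁻¹ * N * J⁻¹) h1
    simp only [Matrix.mul_smul, Matrix.smul_mul] at h2
    have e1 : ∀ N : Matrix (Fin n) (Fin n) ℝ, (J.transpose)⁻¹ * (J.transpose * N * J) * J⁻¹ = N := by
      intro N
      rw [Matrix.mul_assoc, Matrix.mul_assoc (J.transpose * N), Matrix.mul_nonsing_inv _ hJu,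
        mul_one, ← Matrix.mul_assoc, Matrix.nonsing_inv_mul _ hJt, one_mul]
    have e2 := e1 1
    rw [mul_one] at e2
    rw [e1, e2] at h2
    rw [← h2, two_mul, Real.exp_add, Real.exp_log (hτ0 x hxV), sq]

end Manifold

end WeylBochner

end

theorem corollary3p3 {n : ℕ} (hn : 4 ≤ n) {M : Type*} [TopologicalSpace M] [T2Space M]
    [CompactSpace M] [ConnectedSpace M] [ChartedSpace (EuclideanSpace ℝ (Fin n)) M]
    [IsManifold (𝓡 n) ∞ M] (g : WeylBochner.SmoothMetric n M)
    (hdiv : WeylBochner.WeylDivergenceFree g) :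
    (WeylBochner.EigenvalueSumNonneg g ((n - 1) / 2) → WeylBochner.WeylParallel g) ∧
      (WeylBochner.EigenvalueSumPos g ((n - 1) / 2) → WeylBochner.ConformallyFlat g) := by
  exact ⟨WeylBochner.weylParallel_of_eigenvalueSumNonneg hn hdiv, fun hpos =>
    WeylBochner.conformallyFlat_of_weylF_eq_zero hn g fun _ hφ _ hx =>
      WeylBochner.weylF_eq_zero_of_eigenvalueSumPos hn hdiv hpos hφ hx⟩
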